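/- Let $\Bbbk$ be a commutative ring. For a graded $\Bbbk$-module $M$ let $sM=M[1]$, $(sM)^d=M^{d+1}$; maps are composed from left to right, with the Koszul rule $(x\otimes y)(f\otimes g)=(-1)^{\deg y\cdot\deg f}\,xf\otimes yg$. An $A_\infty$-category $\mathcal A$ is given by a small graded $\Bbbk$-linear quiver with operations $b_n:s\mathcal A(X_0,X_1)\otimes\dots\otimes s\mathcal A(X_{n-1},X_n)\to s\mathcal A(X_0,X_n)$ of degree $1$, $b_0=0$, whose extension to a coderivation $b$ of the tensor cocategory $Ts\mathcal A$ satisfies $b^2=0$. An $A_\infty$-functor $f:\mathcal A\to\mathcal C$ is a cocategory homomorphism $Ts\mathcal A\to Ts\mathcal C$ of degree $0$ (with components $f_n$, $f_0=0$) such that $fb=bf$. For $(f,g)$-coderivations $r:Ts\mathcal A\to Ts\mathcal C$ put $rB_1=rb-(-1)^{\deg r}br$; for an $(f,g)$-coderivation $r$ and a $(g,h)$-coderivation $p$ let $(r\otimes p)B_2$ be the $(f,h)$-coderivation with components $\sum(f_{a_1}\otimes\dots\otimes f_{a_\alpha}\otimes r_j\otimes g_{c_1}\otimes\dots\otimes g_{c_\beta}\otimes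 p_t\otimes h_{e_1}\otimes\dots\otimes h_{e_\gamma})b_{\alpha+\beta+\gamma+2}$. A natural $A_\infty$-transformation $r:f\to g$ is an $(f,g)$-coderivation of degree $-1$ with $rB_1=0$. For $(f,g)$-coderivations of degree $-1$, $r\equiv p$ means that $r-p=vB_1$ for some $(f,g)$-coderivation $v$ of degree $-2$. A unit transformation of $\mathcal C$ is a natural $A_\infty$-transformation $\mathbf i^{\mathcal C}:\mathrm{id}_{\mathcal C}\to\mathrm{id}_{\mathcal C}$ such that $(\mathbf i^{\mathcal C}\otimes\mathbf i^{\mathcal C})B_2\equiv\mathbf i^{\mathcal C}$ and the chain maps $({}_X\mathbf i^{\mathcal C}_0\otimes1)b_2$, $(1\otimes{}_Y\mathbf i^{\mathcal C}_0)b_2$ of $(s\mathcal C(X,Y),b_1)$ to itself are homotopy invertible for all objects $X,Y$; $\mathcal C$ is unital if it has a unit transformation. An $A_\infty$-functor $f:\mathcal B\to\mathcal C$ between unital $A_\infty$-categories with unit transformations $\mathbf i^{\mathcal B}$, $\mathbf i^{\mathcal C}$ is unital if $f\mathbf i^{\mathcal C}\equiv\mathbf i^{\mathcal B}f$. **Proposition.**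 Let $\mathcal B,\mathcal C$ be unital $A_\infty$-categories with unit transformations $\mathbf i^{\mathcal B},\mathbf i^{\mathcal C}$ and let $f:\mathcal B\to\mathcal C$ be a unital $A_\infty$-functor. Let $g:\operatorname{Ob}\mathcal B\to\operatorname{Ob}\mathcal C$ be a map, and for every $X\in\operatorname{Ob}\mathcal B$ let $r_X\in\mathcal C^0(Xf,Xg)$ be an element with $r_Xsb_1=0$. Assume that for all objects $X,Y$ of $\mathcal B$ and every complex $N=s\mathcal B(X_0,X_1)\otimes_\Bbbk\dots\otimes_\Bbbk s\mathcal B(X_{n-1},X_n)$, $n\ge0$ (with $N=\Bbbk$ for $n=0$), with the differential induced by $b_1$, the chain map $$\operatorname{Hom}(N,(r_Xs\otimes1)b_2):\operatorname{Hom}^\bullet_\Bbbk(N,s\mathcal C(Xg,Yg))\to\operatorname{Hom}^\bullet_\Bbbk(N,s\mathcal C(Xf,Yg))$$ is a quasi-isomorphism, where $(r_Xs\otimes1)b_2$ is the chain map $p\mapsto(-1)^{\deg p}(r_Xs\otimes p)b_2$. Let $g:\mathcal B\to\mathcal C$ be any $A_\infty$-functor that extends the given map on objects and for which there is a natural $A_\infty$-transformation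 $r:f\to g:\mathcal B\to\mathcal C$ with the $0$-th component ${}_Xr_0:\Bbbk\to s\mathcal C(Xf,Xg)$, $1\mapsto r_Xs$. Then the $A_\infty$-functor $g$ is unital. -/

import Mathlib

open scoped TensorProduct

universe u

namespace AInf

/-! ### Graded quivers, tensor products along a sequence of objects -/

/-- A graded `k`-linear quiver `A`: a set of objects and, for each pair of objects, a `ℤ`-graded
`k`-module `A(X,Y) = ⨁ d, A(X,Y)^d`. -/
structure GrQuiver (k : Type u) [CommRing k] where
  Ob : Type u
  hom : Ob → Ob → Type u
  [acg : ∀ X Y, AddCommGroup (hom X Y)]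
  [mod : ∀ X Y, Module k (hom X Y)]
  gr : ∀ X Y, ℤ → Submodule k (hom X Y)
  internal : ∀ X Y, DirectSum.IsInternal (gr X Y)

attribute [instance] GrQuiver.acg GrQuiver.mod

section Quiver

variable {k : Type u} [CommRing k]

namespace GrQuiver

variable (Q : GrQuiver k)

/-- The suspension `sA(X,Y) = A(X,Y)[1]` is the same module with the grading
`(sA)^d = A^(d+1)`. -/
def sgr (X Y : Q.Ob) (d : ℤ) : Submodule k (Q.hom X Y) := Q.gr X Y (d + 1)

theorem gr_bijective (X Y : Q.Ob) :
    Function.Bijective (DirectSum.coeLinearMap (Q.gr X Y)) := Q.internal X Y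

/-- The Koszul sign operator of exponent `e` on `sA(X,Y)`: it sends `x` of degree `d` in `sA`
(that is, of degree `i = d + 1` in `A`) to `(-1)^(e * d) x`. -/
noncomputable def koszul (e : ℤ) (X Y : Q.Ob) : Q.hom X Y →ₗ[k] Q.hom X Y :=
  (DirectSum.toModule k ℤ (Q.hom X Y)
    (fun i => (e * (i - 1)).negOnePow • (Q.gr X Y i).subtype)) ∘ₗ
  (LinearEquiv.ofBijective (DirectSum.coeLinearMap (Q.gr X Y)) (Q.gr_bijective X Y)).symm.toLinearMap

/-- Finite sequences of objects `X = X₀, X₁, …, Xₙ = Y`, `n ≥ 0`. -/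
inductive Seq : Q.Ob → Q.Ob → Type u
  | nil (X : Q.Ob) : Seq X X
  | cons (X : Q.Ob) {Y Z : Q.Ob} (p : Seq Y Z) : Seq X Z

/-- Composable strings `x₁ ⊗ … ⊗ xₙ` (pure tensors), `xᵢ ∈ sA(Xᵢ₋₁,Xᵢ)`, `n ≥ 0`. -/
inductive Str : Q.Ob → Q.Ob → Type u
  | nil (X : Q.Ob) : Str X X
  | cons {X Y Z : Q.Ob} (x : Q.hom X Y) (s : Str Y Z) : Str X Z

variable {Q}

/-- The `k`-module `sA(X₀,X₁) ⊗ sA(X₁,X₂) ⊗ … ⊗ sA(Xₙ₋₁,Xₙ)`; it is `k` for `n = 0`. -/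
noncomputable def Ten : ∀ {X Y : Q.Ob}, Q.Seq X Y → ModuleCat.{u} k
  | _, _, .nil _ => ModuleCat.of k k
  | _, _, @Seq.cons _ _ _ X Y _ p => ModuleCat.of k (Q.hom X Y ⊗[k] Ten p)

/-- The homogeneous component of degree `d` of `sA(X₀,X₁) ⊗ … ⊗ sA(Xₙ₋₁,Xₙ)`. -/
noncomputable def tenGr : ∀ {X Y : Q.Ob} (p : Q.Seq X Y), ℤ → Submodule k (Ten p)
  | _, _, .nil _ => fun d =>
      if d = 0 then (⊤ : Submodule k k) else (⊥ : Submodule k k)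
  | _, _, @Seq.cons _ _ _ X Y _ p => fun d =>
      (⨆ i : ℤ, Submodule.map₂ (TensorProduct.mk k (Q.hom X Y) (Ten p))
        (Q.sgr X Y i) (tenGr p (d - i)) : Submodule k (Q.hom X Y ⊗[k] Ten p))

/-- The Koszul sign operator `z ↦ (-1)^(e * deg z) z` on `sA(X₀,X₁) ⊗ … ⊗ sA(Xₙ₋₁,Xₙ)`. -/
noncomputable def tenKoszul (e : ℤ) : ∀ {X Y : Q.Ob} (p : Q.Seq X Y), Ten p →ₗ[k] Ten p
  | _, _, .nil _ => (LinearMap.id : k →ₗ[k] k)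
  | _, _, @Seq.cons _ _ _ X Y _ p =>
      (TensorProduct.map (Q.koszul e X Y) (tenKoszul e p) :
        Q.hom X Y ⊗[k] Ten p →ₗ[k] Q.hom X Y ⊗[k] Ten p)

namespace Str

/-- The objects `X₀, …, Xₙ` of a string. -/
def seq : ∀ {X Y : Q.Ob}, Q.Str X Y → Q.Seq X Y
  | _, _, .nil X => .nil X
  | _, _, @Str.cons _ _ _ X _ _ _ s => .cons X s.seq

/-- The element `x₁ ⊗ … ⊗ xₙ` of the tensor product. -/
noncomputable def ten : ∀ {X Y : Q.Ob} (s : Q.Str X Y), Ten s.seq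
  | _, _, .nil _ => (1 : k)
  | _, _, @Str.cons _ _ _ X Y _ x s => (x ⊗ₜ[k] s.ten : Q.hom X Y ⊗[k] Ten s.seq)

/-- Concatenation of strings. -/
def append : ∀ {X Y Z : Q.Ob}, Q.Str X Y → Q.Str Y Z → Q.Str X Z
  | _, _, _, .nil _, t => t
  | _, _, _, .cons x s, t => .cons x (s.append t)

/-- `x₁ ⊗ … ⊗ xₙ ↦ (-1)^(e * (deg x₁ + … + deg xₙ)) x₁ ⊗ … ⊗ xₙ`, the sign that appears when a map
of degree `e` is moved across the string. -/
noncomputable def twist (e : ℤ) : ∀ {X Y : Q.Ob}, Q.Str X Y → Q.Str X Y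
  | _, _, .nil X => .nil X
  | _, _, @Str.cons _ _ _ X Y _ x s => .cons (Q.koszul e X Y x) (s.twist e)

/-- The cut comultiplication: the list of all `(x₁ ⊗ … ⊗ xᵢ, xᵢ₊₁ ⊗ … ⊗ xₙ)`, `0 ≤ i ≤ n`. -/
def cuts : ∀ {X Z : Q.Ob}, Q.Str X Z → List (Σ Y : Q.Ob, Q.Str X Y × Q.Str Y Z)
  | _, _, .nil X => [⟨X, .nil X, .nil X⟩]
  | X, _, .cons x s => ⟨X, .nil X, .cons x s⟩ ::
      s.cuts.map (fun c => ⟨c.1, .cons x c.2.1, c.2.2⟩)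

end Str

end GrQuiver

open GrQuiver

/-- Maps that send a composable string of `A` to a finite formal sum (a list) of composable strings
of `C`: values of maps `TsA → TsC` on pure tensors. -/
abbrev StrMap (A C : GrQuiver k) (f g : A.Ob → C.Ob) : Type u :=
  ∀ ⦃X Y : A.Ob⦄, A.Str X Y → List (C.Str (f X) (g Y))

/-- Values on pure tensors of maps `TsA → sC`. -/
abbrev StrFun (A C : GrQuiver k) (f g : A.Ob → C.Ob) : Type u :=
  ∀ ⦃X Y : A.Ob⦄, A.Str X Y → C.hom (f X) (g Y)

/-- Families of `k`-linear maps
`sA(X₀,X₁) ⊗ … ⊗ sA(Xₙ₋₁,Xₙ) → sC(X₀f,Xₙg)`, `n ≥ 0`. -/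
abbrev Family (A C : GrQuiver k) (f g : A.Ob → C.Ob) : Type u :=
  ∀ ⦃X Y : A.Ob⦄ (p : A.Seq X Y), Ten p →ₗ[k] C.hom (f X) (g Y)

variable {A C D : GrQuiver k}

/-- The values of a family on pure tensors. -/
noncomputable def Family.val {f g : A.Ob → C.Ob} (φ : Family A C f g) : StrFun A C f g :=
  fun _ _ x => φ x.seq x.ten

/-- All members of the family have degree `e` (as maps between the suspended modules). -/
def Family.HasDegree {f g : A.Ob → C.Ob} (φ : Family A C f g) (e : ℤ) : Prop :=
  ∀ ⦃X Y : A.Ob⦄ (p : A.Seq X Y) (d : ℤ), ∀ z ∈ tenGr p d, φ p z ∈ C.sgr (f X) (g Y) (d + e)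

/-- The identity map `TsA → TsA`. -/
def idStr (A : GrQuiver k) : StrMap A A (fun X => X) (fun X => X) := fun _ _ x => [x]

/-- The composite `Φφ` of `Φ : TsA → TsC` with `φ : TsC → sD` (first `Φ`, then `φ`). -/
def StrMap.then {f g : A.Ob → C.Ob} {h l : C.Ob → D.Ob} (Φ : StrMap A C f g)
    (φ : StrFun C D h l) : StrFun A D (fun X => h (f X)) (fun X => l (g X)) :=
  fun _ _ x => ((Φ x).map (fun y => φ y)).sum

/-- The map `Δ⁽³⁾(Φ ⊗ φ ⊗ Ψ) : TsA → TsC`, where `φ : TsA → sC` has degree `e` and `Φ` has degree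
`0`: the sum of `(-1)^(e * deg w) (u)Φ ⊗ (v)φ ⊗ (w)Ψ` over all ways to cut a string into three
consecutive strings `u`, `v`, `w` (possibly empty). -/
noncomputable def sandwich {f f' g' g : A.Ob → C.Ob} (Φ : StrMap A C f f') (e : ℤ)
    (φ : StrFun A C f' g') (Ψ : StrMap A C g' g) : StrMap A C f g :=
  fun _ _ x =>
    x.cuts.flatMap fun c => c.2.2.cuts.flatMap fun c' =>
      (Φ c.2.1).flatMap fun u => (Ψ (c'.2.2.twist e)).map fun w =>
        u.append (.cons (φ c'.2.1) w)

/-- Auxiliary to `functorStr`: the sum over all decompositions of `s` into consecutive strings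
`v₀, v₁, …, vₗ` with `v₁, …, vₗ` non-empty, of
`(u v₀)φ ⊗ (v₁)φ ⊗ … ⊗ (vₗ)φ`; here `u` is the block that is being read. -/
def functorStrAux {f : A.Ob → C.Ob} (φ : StrFun A C f f) :
    ∀ {X Y Z : A.Ob}, A.Str X Y → A.Str Y Z → List (C.Str (f X) (f Z))
  | _, _, _, u, .nil _ => [.cons (φ u) (.nil _)]
  | _, _, _, u, .cons x s =>
      (functorStrAux φ (.cons x (.nil _)) s).map (fun t => .cons (φ u) t) ++
        functorStrAux φ (u.append (.cons x (.nil _))) s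

/-- The cocategory homomorphism `TsA → TsC` of degree `0` with components `φₙ`, `n ≥ 1`: a string
goes to the sum of `(v₁)φ ⊗ … ⊗ (vₗ)φ` over all its decompositions into consecutive non-empty
strings `v₁, …, vₗ`. The empty string goes to the empty string. -/
def functorStr {f : A.Ob → C.Ob} (φ : StrFun A C f f) : StrMap A C f f
  | _, _, .nil X => [.nil (f X)]
  | _, _, .cons x s => functorStrAux φ (.cons x (.nil _)) s

end Quiver

/-! ### `A∞`-categories, `A∞`-functors, coderivations -/

/-- An `A∞`-category: a graded quiver with operations
`bₙ : sA(X₀,X₁) ⊗ … ⊗ sA(Xₙ₋₁,Xₙ) → sA(X₀,Xₙ)` of degree `1`, `b₀ = 0`, such that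
`∑_{q+n+t=l} (1^{⊗q} ⊗ bₙ ⊗ 1^{⊗t}) b_{q+1+t} = 0` for all `l`. -/
structure AInfCat (k : Type u) [CommRing k] extends GrQuiver k where
  b : Family toGrQuiver toGrQuiver (fun X => X) (fun X => X)
  b_degree : b.HasDegree 1
  b_zero : ∀ X, b (.nil X) = 0
  b_b : ∀ ⦃X Y : Ob⦄ (x : toGrQuiver.Str X Y),
    (sandwich (idStr toGrQuiver) 1 b.val (idStr toGrQuiver)).then b.val x = 0

section Cat

variable {k : Type u} [CommRing k]

open GrQuiver

namespace AInfCat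

/-- The codifferential `b = ∑ 1^{⊗q} ⊗ bₙ ⊗ 1^{⊗t} : TsA → TsA`. -/
noncomputable def bStr (A : AInfCat k) :
    StrMap A.toGrQuiver A.toGrQuiver (fun X => X) (fun X => X) :=
  sandwich (idStr A.toGrQuiver) 1 A.b.val (idStr A.toGrQuiver)

/-- The differential `b₁ : sA(X,Y) → sA(X,Y)`. -/
noncomputable def b₁ (A : AInfCat k) (X Y : A.Ob) : A.hom X Y →ₗ[k] A.hom X Y :=
  (A.b (.cons X (.nil Y)) : A.hom X Y ⊗[k] k →ₗ[k] A.hom X Y) ∘ₗ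
    (TensorProduct.mk k (A.hom X Y) k).flip 1

/-- The operation `b₂`, as a bilinear map `(x, y) ↦ (x ⊗ y)b₂`. -/
noncomputable def b₂ (A : AInfCat k) (X Y Z : A.Ob) :
    A.hom X Y →ₗ[k] A.hom Y Z →ₗ[k] A.hom X Z :=
  (TensorProduct.mk k (A.hom X Y) (A.hom Y Z ⊗[k] k)).compr₂
    (A.b (.cons X (.cons Y (.nil Z))) : A.hom X Y ⊗[k] (A.hom Y Z ⊗[k] k) →ₗ[k] A.hom X Z) |>.compl₂
    ((TensorProduct.mk k (A.hom Y Z) k).flip 1)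

/-- For `r ∈ sA(X,Y)` of degree `-1`, the map `(r ⊗ 1)b₂ : sA(Y,Z) → sA(X,Z)`,
`p ↦ (-1)^(deg p) (r ⊗ p)b₂`. -/
noncomputable def leftMul (A : AInfCat k) {X Y : A.Ob} (r : A.hom X Y) (Z : A.Ob) :
    A.hom Y Z →ₗ[k] A.hom X Z :=
  A.b₂ X Y Z r ∘ₗ A.koszul (-1) Y Z

/-- For `r ∈ sA(Y,Z)`, the map `(1 ⊗ r)b₂ : sA(X,Y) → sA(X,Z)`, `p ↦ (p ⊗ r)b₂`. -/
noncomputable def rightMul (A : AInfCat k) (X : A.Ob) {Y Z : A.Ob} (r : A.hom Y Z) :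
    A.hom X Y →ₗ[k] A.hom X Z :=
  (A.b₂ X Y Z).flip r

/-- The differential `∑ 1^{⊗q} ⊗ b₁ ⊗ 1^{⊗t}` of `sA(X₀,X₁) ⊗ … ⊗ sA(Xₙ₋₁,Xₙ)`; on
`x ⊗ y` it is `x ⊗ yd + (-1)^(deg y) xb₁ ⊗ y`. -/
noncomputable def tenD (A : AInfCat k) : ∀ {X Y : A.Ob} (p : A.Seq X Y), Ten p →ₗ[k] Ten p
  | _, _, .nil _ => (0 : k →ₗ[k] k)
  | _, _, @Seq.cons _ _ _ X Y _ p =>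
      (TensorProduct.map LinearMap.id (A.tenD p) +
        TensorProduct.map (A.b₁ X Y) (tenKoszul 1 p) :
        A.hom X Y ⊗[k] Ten p →ₗ[k] A.hom X Y ⊗[k] Ten p)

end AInfCat

/-- An `A∞`-functor `f : A → C`: a map on objects and components
`fₙ : sA(X₀,X₁) ⊗ … ⊗ sA(Xₙ₋₁,Xₙ) → sC(X₀f,Xₙf)` of degree `0`, `f₀ = 0`, such that the cocategory
homomorphism `f : TsA → TsC` satisfies `fb = bf`. -/
structure AInfFunctor (A C : AInfCat k) where
  obj : A.Ob → C.Ob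
  comp : Family A.toGrQuiver C.toGrQuiver obj obj
  comp_degree : comp.HasDegree 0
  comp_zero : ∀ X, comp (.nil X) = 0
  comp_b : ∀ ⦃X Y : A.Ob⦄ (x : A.Str X Y),
    (functorStr comp.val).then C.b.val x = A.bStr.then comp.val x

/-- The cocategory homomorphism `TsA → TsC` of an `A∞`-functor. -/
noncomputable def AInfFunctor.str {A C : AInfCat k} (f : AInfFunctor A C) :
    StrMap A.toGrQuiver C.toGrQuiver f.obj f.obj :=
  functorStr f.comp.val

/-- The components `rₙ : sA(X₀,X₁) ⊗ … ⊗ sA(Xₙ₋₁,Xₙ) → sC(X₀f,Xₙg)`, `n ≥ 0`, of an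
`(f,g)`-coderivation `r : TsA → TsC` of degree `e`. The coderivation itself is
`∑ f_{i₁} ⊗ … ⊗ f_{i_q} ⊗ rₙ ⊗ g_{j₁} ⊗ … ⊗ g_{j_t}` (see `coderStr`). -/
structure Coder (A C : AInfCat k) (f g : A.Ob → C.Ob) (e : ℤ) where
  comp : Family A.toGrQuiver C.toGrQuiver f g
  degree : comp.HasDegree e

section Coder

variable {A C : AInfCat k} {f g h : A.Ob → C.Ob}

/-- The coderivation `TsA → TsC` with given components, with respect to cocategory homomorphisms
`F` and `G` (whose maps on objects are `f` and `g`). -/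
noncomputable def coderStr {e : ℤ} (F : StrMap A.toGrQuiver C.toGrQuiver f f)
    (r : Coder A C f g e) (G : StrMap A.toGrQuiver C.toGrQuiver g g) :
    StrMap A.toGrQuiver C.toGrQuiver f g :=
  sandwich F e r.comp.val G

/-- The components of the `(F,G)`-coderivation `rB₁ = [r,b] = rb - (-1)^(deg r) br`. -/
noncomputable def B₁ {e : ℤ} (F : StrMap A.toGrQuiver C.toGrQuiver f f)
    (r : Coder A C f g e) (G : StrMap A.toGrQuiver C.toGrQuiver g g) :
    StrFun A.toGrQuiver C.toGrQuiver f g :=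
  fun _ _ x => (coderStr F r G).then C.b.val x - e.negOnePow • A.bStr.then r.comp.val x

/-- The components of the `(F,H)`-coderivation `(r ⊗ p)B₂`, for an `(F,G)`-coderivation `r` and a
`(G,H)`-coderivation `p`: they are `∑ (f_{a₁} ⊗ … ⊗ f_{a_α} ⊗ r_j ⊗ g_{c₁} ⊗ … ⊗ g_{c_β} ⊗ p_t ⊗
h_{e₁} ⊗ … ⊗ h_{e_γ}) b_{α+β+γ+2}`. -/
noncomputable def B₂ {e e' : ℤ} (F : StrMap A.toGrQuiver C.toGrQuiver f f)
    (r : Coder A C f g e) (G : StrMap A.toGrQuiver C.toGrQuiver g g)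
    (p : Coder A C g h e') (H : StrMap A.toGrQuiver C.toGrQuiver h h) :
    StrFun A.toGrQuiver C.toGrQuiver f h :=
  (sandwich F e r.comp.val (coderStr G p H)).then C.b.val

/-- Equivalence `φ ≡ ψ` of `(F,G)`-coderivations of degree `-1`, given by their components:
`φ - ψ = vB₁ = vb - bv` for some `(F,G)`-coderivation `v` of degree `-2`. -/
def Equivalent (F : StrMap A.toGrQuiver C.toGrQuiver f f)
    (G : StrMap A.toGrQuiver C.toGrQuiver g g)
    (φ ψ : StrFun A.toGrQuiver C.toGrQuiver f g) : Prop :=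
  ∃ v : Coder A C f g (-2), ∀ ⦃X Y : A.Ob⦄ (x : A.Str X Y), φ x - ψ x = B₁ F v G x

/-- A natural `A∞`-transformation `F → G` is an `(F,G)`-coderivation `r` of degree `-1` with
`rb + br = 0`. -/
def IsNatural (F : StrMap A.toGrQuiver C.toGrQuiver f f) (r : Coder A C f g (-1))
    (G : StrMap A.toGrQuiver C.toGrQuiver g g) : Prop :=
  ∀ ⦃X Y : A.Ob⦄ (x : A.Str X Y), B₁ F r G x = 0

/-- The element `ₓr₀ = (1)ₓr₀ ∈ sC(Xf,Xg)`, where `ₓr₀ : k → sC(Xf,Xg)` is the `0`-th component. -/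
noncomputable def Coder.zeroth {e : ℤ} (r : Coder A C f g e) (X : A.Ob) : C.hom (f X) (g X) :=
  r.comp.val (.nil X)

end Coder

/-! ### Unitality -/

/-- A chain map `a : (M,d) → (M,d)` of degree `0` is homotopy invertible: there is a chain map `c` of
degree `0` such that both composites of `a` and `c` are homotopic to the identity. -/
def HomotopyInvertible {M : Type u} [AddCommGroup M] [Module k M] (gr : ℤ → Submodule k M)
    (d a : M →ₗ[k] M) : Prop :=
  ∃ c s s' : M →ₗ[k] M,
    (∀ i, ∀ x ∈ gr i, c x ∈ gr i) ∧ c ∘ₗ d = d ∘ₗ c ∧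
    (∀ i, ∀ x ∈ gr i, s x ∈ gr (i - 1)) ∧ (∀ i, ∀ x ∈ gr i, s' x ∈ gr (i - 1)) ∧
    c ∘ₗ a = LinearMap.id + d ∘ₗ s + s ∘ₗ d ∧
    a ∘ₗ c = LinearMap.id + d ∘ₗ s' + s' ∘ₗ d

/-- A unit transformation of an `A∞`-category `C`: a natural `A∞`-transformation
`i : id_C → id_C` such that `(i ⊗ i)B₂ ≡ i` and all the chain maps
`(ₓi₀ ⊗ 1)b₂, (1 ⊗ ᵧi₀)b₂ : sC(X,Y) → sC(X,Y)` are homotopy invertible. -/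
structure IsUnitTransformation (C : AInfCat k)
    (i : Coder C C (fun X => X) (fun X => X) (-1)) : Prop where
  natural : IsNatural (idStr C.toGrQuiver) i (idStr C.toGrQuiver)
  idem : Equivalent (idStr C.toGrQuiver) (idStr C.toGrQuiver)
    (B₂ (idStr C.toGrQuiver) i (idStr C.toGrQuiver) i (idStr C.toGrQuiver)) i.comp.val
  left_inv : ∀ X Y : C.Ob,
    HomotopyInvertible (C.sgr X Y) (C.b₁ X Y) (C.leftMul (i.zeroth X) Y)
  right_inv : ∀ X Y : C.Ob,
    HomotopyInvertible (C.sgr X Y) (C.b₁ X Y) (C.rightMul X (i.zeroth Y))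

/-- The components of `f i^C` (first `f`, then `i^C`): `∑ (f_{i₁} ⊗ … ⊗ f_{i_l}) i^C_l`. -/
noncomputable def functorThenUnit {A C : AInfCat k} (f : AInfFunctor A C)
    (i : Coder C C (fun X => X) (fun X => X) (-1)) :
    StrFun A.toGrQuiver C.toGrQuiver f.obj f.obj :=
  f.str.then i.comp.val

/-- The components of `i^A f` (first `i^A`, then `f`): `∑ (1^{⊗q} ⊗ i^A_n ⊗ 1^{⊗t}) f_{q+1+t}`. -/
noncomputable def unitThenFunctor {A C : AInfCat k}
    (i : Coder A A (fun X => X) (fun X => X) (-1)) (f : AInfFunctor A C) :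
    StrFun A.toGrQuiver C.toGrQuiver f.obj f.obj :=
  (coderStr (idStr A.toGrQuiver) i (idStr A.toGrQuiver)).then f.comp.val

/-- An `A∞`-functor `f : A → C` between `A∞`-categories with unit transformations `i^A`, `i^C` is
unital if `f i^C ≡ i^A f`. -/
def AInfFunctor.IsUnital {A C : AInfCat k} (f : AInfFunctor A C)
    (iA : Coder A A (fun X => X) (fun X => X) (-1))
    (iC : Coder C C (fun X => X) (fun X => X) (-1)) : Prop :=
  Equivalent f.str f.str (functorThenUnit f iC) (unitThenFunctor iA f)

/-! ### The complexes `Hom(N, sC(X,Y))` and quasi-isomorphisms between them -/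

/-- `Hom^d(N, sC(U,V))` for `N = sB(X₀,X₁) ⊗ … ⊗ sB(Xₙ₋₁,Xₙ)`: linear maps of degree `d`. -/
def HomDeg {B : AInfCat k} {X₀ Xₙ : B.Ob} (p : B.Seq X₀ Xₙ) (C : AInfCat k) (U V : C.Ob) (d : ℤ) :
    Submodule k (Ten p →ₗ[k] C.hom U V) where
  carrier := {φ | ∀ j : ℤ, ∀ z ∈ tenGr p j, φ z ∈ C.sgr U V (j + d)}
  add_mem' := fun ha hb j z hz => Submodule.add_mem _ (ha j z hz) (hb j z hz)
  zero_mem' := fun _ _ _ => Submodule.zero_mem _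
  smul_mem' := fun c _ ha j z hz => Submodule.smul_mem _ c (ha j z hz)

/-- The differential of `Hom(N, sC(U,V))` on elements `φ` of degree `d`:
`φ ↦ φ b₁ - (-1)^d d_N φ` (composition from left to right). -/
noncomputable def homD {B : AInfCat k} {X₀ Xₙ : B.Ob} (p : B.Seq X₀ Xₙ) (C : AInfCat k)
    (U V : C.Ob) (d : ℤ) : (Ten p →ₗ[k] C.hom U V) →ₗ[k] (Ten p →ₗ[k] C.hom U V) :=
  LinearMap.llcomp k (Ten p) (C.hom U V) (C.hom U V) (C.b₁ U V) -
    d.negOnePow • LinearMap.lcomp k (C.hom U V) (B.tenD p)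

/-- A chain map `u` of degree `0` between complexes of `k`-modules `E` and `E'`, given by the
homogeneous components `E d`, `E' d` (as submodules of ambient modules) and the differentials on
them, is a quasi-isomorphism: in every degree the induced map in cohomology is injective and
surjective. -/
def IsQuasiIso {M M' : Type u} [AddCommGroup M] [Module k M] [AddCommGroup M'] [Module k M']
    (E : ℤ → Submodule k M) (δ : ℤ → M →ₗ[k] M) (E' : ℤ → Submodule k M') (δ' : ℤ → M' →ₗ[k] M')
    (u : M →ₗ[k] M') : Prop :=
  ∀ d : ℤ,
    (∀ φ ∈ E d, δ d φ = 0 → (∃ ψ ∈ E' (d - 1), δ' (d - 1) ψ = u φ) →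
      ∃ χ ∈ E (d - 1), δ (d - 1) χ = φ) ∧
    (∀ ψ ∈ E' d, δ' d ψ = 0 →
      ∃ φ ∈ E d, δ d φ = 0 ∧ ∃ χ ∈ E' (d - 1), δ' (d - 1) χ = ψ - u φ)

/-- The assumptions on an `A∞`-functor `f : B → C`, a map `g : Ob B → Ob C` and elements
`r_X ∈ C⁰(Xf,Xg)`: `r_X s b₁ = 0`, and for all objects `X`, `Y` of `B` and every complex
`N = sB(X₀,X₁) ⊗ … ⊗ sB(Xₙ₋₁,Xₙ)`, `n ≥ 0`, the chain map
`Hom(N, (r_X s ⊗ 1)b₂) : Hom(N, sC(Xg,Yg)) → Hom(N, sC(Xf,Yg))` is a quasi-isomorphism. -/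
structure ResolutionAssumptions {B C : AInfCat k} (f : AInfFunctor B C) (g : B.Ob → C.Ob)
    (r : ∀ X : B.Ob, C.hom (f.obj X) (g X)) : Prop where
  degree : ∀ X, r X ∈ C.gr (f.obj X) (g X) 0
  cycle : ∀ X, C.b₁ (f.obj X) (g X) (r X) = 0
  quasiIso : ∀ (X Y X₀ Xₙ : B.Ob) (p : B.Seq X₀ Xₙ),
    IsQuasiIso
      (HomDeg p C (g X) (g Y)) (homD p C (g X) (g Y))
      (HomDeg p C (f.obj X) (g Y)) (homD p C (f.obj X) (g Y))
      (LinearMap.llcomp k (Ten p) (C.hom (g X) (g Y)) (C.hom (f.obj X) (g Y))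
        (C.leftMul (r X) (g Y)))

end Cat

end AInf

/-! ### Strings, sums over their cuts, and the tensor module -/

namespace AInf

namespace GrQuiver

variable {k : Type u} [CommRing k] {Q : GrQuiver k}

namespace Str

/-! Put t = g i^C - i^B g, a (g,g)-coderivation of degree -1 with tB₁ = 0; it has to be shown that t
is a boundary. Naturality of i^C gives a homotopy between (r ⊗ g i^C)B₂ and (f i^C ⊗ r)B₂,
naturality of i^B one between (r ⊗ i^B g)B₂ and (i^B f ⊗ r)B₂ (`B₁e_toComp`, `B₁e_pre`). Since f is
unital, f i^C - i^B f = v₀B₁, and (v₀B₁ ⊗ r)B₂ = ((v₀ ⊗ r)B₂)B₁ (`B₁e_B₂eo`). Altogether (r ⊗ t)B₂ =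
yB₁ for an explicit y of degree -2.

So multiplication by r kills the class of t, and it remains to cancel r. The pair (t, y) is a cycle
in the cone of (r ⊗ -)B₂, and this cone is filtered by the length of strings. On the component of
lowest length B₁ is the differential of Hom(N, sC), and (r ⊗ -)B₂ is, up to sign, composition with
(r_X s ⊗ 1)b₂ (`B₁e_lowest`, `B₁o_lowest`, `B₂oe_lowest`, `B₂oo_lowest`). By assumption that map is
a quasi-isomorphism, so (t, y) can be made a boundary one length at a time: injectivity in
cohomology corrects t, surjectivity corrects y (`IsApprox.step`). The corrections at stage n leave
the components of length less than n alone, so they converge to v with t = vB₁ (`exists_eq_B₁e`).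

The algebra is carried out with linear maps on the tensor module `T` instead of lists of strings.
With the convolution product ⋆, an (F,G)-coderivation with components r is `F ⋆ r.up ⋆ G`, and
Koszul signs enter as precomposition with the sign operator `K`. Since signs depend only on parity,
B₁ and B₂ come in even and odd versions. Identities between coderivations then become additive
identities between ⋆-words. -/

@[simp] theorem nil_append {X Y : Q.Ob} (s : Q.Str X Y) : (nil X).append s = s := rfl

@[simp] theorem cons_append {X Y Z W : Q.Ob} (x : Q.hom X Y) (s : Q.Str Y Z) (t : Q.Str Z W) :
    (cons x s).append t = cons x (s.append t) := rfl

@[simp] theorem append_nil : ∀ {X Y : Q.Ob} (s : Q.Str X Y), s.append (nil Y) = s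
  | _, _, .nil _ => rfl
  | _, _, .cons x s => by rw [cons_append, append_nil s]

theorem append_assoc : ∀ {X Y Z W : Q.Ob} (s : Q.Str X Y) (t : Q.Str Y Z) (u : Q.Str Z W),
    (s.append t).append u = s.append (t.append u)
  | _, _, _, _, .nil _, _, _ => rfl
  | _, _, _, _, .cons x s, t, u => by simp only [cons_append, append_assoc s t u]

/-- The number of entries of a string. -/
def length : ∀ {X Y : Q.Ob}, Q.Str X Y → ℕ
  | _, _, .nil _ => 0
  | _, _, .cons _ s => s.length + 1

@[simp] theorem length_nil (X : Q.Ob) : (nil X : Q.Str X X).length = 0 := rfl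

@[simp] theorem length_cons {X Y Z : Q.Ob} (x : Q.hom X Y) (s : Q.Str Y Z) :
    (cons x s).length = s.length + 1 := rfl

@[simp] theorem length_append : ∀ {X Y Z : Q.Ob} (s : Q.Str X Y) (t : Q.Str Y Z),
    (s.append t).length = s.length + t.length
  | _, _, _, .nil _, _ => by simp
  | _, _, _, .cons x s, t => by simp only [cons_append, length_cons, length_append s t]; omega

@[simp] theorem twist_nil (e : ℤ) (X : Q.Ob) : (nil X : Q.Str X X).twist e = nil X := rfl

@[simp] theorem twist_cons (e : ℤ) {X Y Z : Q.Ob} (x : Q.hom X Y) (s : Q.Str Y Z) :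
    (cons x s).twist e = cons (Q.koszul e X Y x) (s.twist e) := rfl

@[simp] theorem twist_append (e : ℤ) : ∀ {X Y Z : Q.Ob} (s : Q.Str X Y) (t : Q.Str Y Z),
    (s.append t).twist e = (s.twist e).append (t.twist e)
  | _, _, _, .nil _, _ => rfl
  | _, _, _, .cons x s, t => by simp only [cons_append, twist_cons, twist_append e s t]

@[simp] theorem length_twist (e : ℤ) : ∀ {X Y : Q.Ob} (s : Q.Str X Y),
    (s.twist e).length = s.length
  | _, _, .nil _ => rfl
  | _, _, .cons x s => by simp only [twist_cons, length_cons, length_twist e s]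

section Sums

variable {P : Type*} [AddCommMonoid P]

/-- The sum of the values of a function over all cuts of a string. -/
def csum {X Z : Q.Ob} (g : ∀ Y, Q.Str X Y → Q.Str Y Z → P) (s : Q.Str X Z) : P :=
  (s.cuts.map fun c => g c.1 c.2.1 c.2.2).sum

@[simp] theorem csum_nil {X : Q.Ob} (g : ∀ Y, Q.Str X Y → Q.Str Y X → P) :
    csum g (nil X) = g X (nil X) (nil X) := by
  simp [csum, cuts]

theorem csum_cons {X Y Z : Q.Ob} (g : ∀ Y, Q.Str X Y → Q.Str Y Z → P) (x : Q.hom X Y)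
    (s : Q.Str Y Z) :
    csum g (cons x s) = g X (nil X) (cons x s) + csum (fun W u v => g W (cons x u) v) s := by
  simp [csum, cuts, Function.comp_def]

theorem length_of_mem_cuts {X Z : Q.Ob} (s : Q.Str X Z) :
    ∀ c ∈ s.cuts, c.2.1.length + c.2.2.length = s.length := by
  induction s with
  | nil X => simp [cuts]
  | cons x s ih =>
    intro c hc
    simp only [cuts, List.mem_cons, List.mem_map] at hc
    rcases hc with rfl | ⟨c', hc', rfl⟩
    · simp
    · have := ih c' hc'
      simp only [length_cons]
      omega

/-- The length condition in the hypothesis is what lets inductions on string length be applied to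
the pieces of a cut. -/
theorem csum_congr {X Z : Q.Ob} {g g' : ∀ Y, Q.Str X Y → Q.Str Y Z → P} {s : Q.Str X Z}
    (h : ∀ Y u v, u.length + v.length = s.length → g Y u v = g' Y u v) :
    csum g s = csum g' s := by
  unfold csum
  congr 1
  exact List.map_congr_left fun c hc => h _ _ _ (length_of_mem_cuts s c hc)

theorem csum_add {X Z : Q.Ob} (g g' : ∀ Y, Q.Str X Y → Q.Str Y Z → P) (s : Q.Str X Z) :
    csum (fun Y u v => g Y u v + g' Y u v) s = csum g s + csum g' s := by
  unfold csum
  exact List.sum_map_add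

theorem csum_zero {X Z : Q.Ob} (s : Q.Str X Z) :
    csum (fun _ _ _ => (0 : P)) s = 0 := by
  simp [csum]

theorem map_csum {P' F : Type*} [AddCommMonoid P'] [FunLike F P P'] [AddMonoidHomClass F P P']
    {X Z : Q.Ob} (φ : F) (g : ∀ Y, Q.Str X Y → Q.Str Y Z → P) (s : Q.Str X Z) :
    φ (csum g s) = csum (fun Y u v => φ (g Y u v)) s := by
  unfold csum
  rw [map_list_sum, List.map_map]
  rfl

/-- A cut falls either to the left or to the right of a chosen entry x, so in every summand x occurs
in exactly one of the two pieces. Multilinearity of cut sums and the splitting rules for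
coderivations rest on this. -/
theorem csum_append_cons : ∀ {X U V Z : Q.Ob} (g : ∀ Y, Q.Str X Y → Q.Str Y Z → P)
    (u : Q.Str X U) (x : Q.hom U V) (w : Q.Str V Z),
    csum g (u.append (cons x w)) =
      csum (fun Y u₁ u₂ => g Y u₁ (u₂.append (cons x w))) u +
        csum (fun Y w₁ w₂ => g Y (u.append (cons x w₁)) w₂) w
  | _, _, _, _, g, .nil _, x, w => by simp [csum_cons]
  | _, _, _, _, g, .cons y u, x, w => by
    simp only [cons_append, csum_cons, csum_append_cons _ u x w, add_assoc]

theorem csum_twist (e : ℤ) {X Z : Q.Ob} (g : ∀ Y, Q.Str X Y → Q.Str Y Z → P) (s : Q.Str X Z) :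
    csum g (s.twist e) = csum (fun Y u v => g Y (u.twist e) (v.twist e)) s := by
  induction s with
  | nil X => simp
  | cons x s ih => simp only [twist_cons, csum_cons, ih, twist_nil]

/-- Coassociativity of the cut comultiplication. -/
theorem csum_assoc {X Z : Q.Ob} (s : Q.Str X Z)
    (g : ∀ Y W, Q.Str X Y → Q.Str Y W → Q.Str W Z → P) :
    csum (fun Y u v => csum (fun W v₁ v₂ => g Y W u v₁ v₂) v) s =
      csum (fun W u v => csum (fun Y u₁ u₂ => g Y W u₁ u₂ v) u) s := by
  induction s with
  | nil X => simp
  | cons x s ih =>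
    simp only [csum_cons, csum_nil, csum_add, ih, add_assoc]

/-- Together with its mirror image, this isolates the single cut that survives when one factor
vanishes on all shorter strings; leading components are computed this way. -/
theorem csum_eq_left {X Z : Q.Ob} {g : ∀ Y, Q.Str X Y → Q.Str Y Z → P} {s : Q.Str X Z}
    (h : ∀ Y u v, u.length + v.length = s.length → u.length < s.length → g Y u v = 0) :
    csum g s = g Z s (nil Z) := by
  induction s with
  | nil X => simp
  | cons x s ih =>
    rw [csum_cons, ih, h _ _ _ (by simp) (by simp), zero_add]
    intro Y u v h₁ h₂
    exact h _ _ _ (by simp; omega) (by simp; omega)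

theorem csum_eq_right {X Z : Q.Ob} {g : ∀ Y, Q.Str X Y → Q.Str Y Z → P} {s : Q.Str X Z}
    (h : ∀ Y u v, u.length + v.length = s.length → v.length < s.length → g Y u v = 0) :
    csum g s = g X (nil X) s := by
  cases s with
  | nil X => simp
  | cons x s =>
    rw [csum_cons, csum_congr (g' := fun _ _ _ => 0), csum_zero, add_zero]
    intro Y u v h₁
    exact h _ _ _ (by simp; omega) (by simp; omega)

end Sums

end Str

/-! ### The tensor module -/

/-- Multilinear functions on strings. -/
def IsMulti {X Y : Q.Ob} {M : Type*} [AddCommGroup M] [Module k M] (φ : Q.Str X Y → M) : Prop :=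
  ∀ ⦃U V : Q.Ob⦄ (u : Q.Str X U) (w : Q.Str V Y),
    IsLinearMap k fun x : Q.hom U V => φ (u.append (.cons x w))

theorem IsMulti.add {X Y U V : Q.Ob} {M : Type*} [AddCommGroup M] [Module k M] {φ : Q.Str X Y → M}
    (h : IsMulti φ) (u : Q.Str X U) (w : Q.Str V Y) (x y : Q.hom U V) :
    φ (u.append (.cons (x + y) w)) = φ (u.append (.cons x w)) + φ (u.append (.cons y w)) :=
  (h u w).map_add x y

theorem IsMulti.smul {X Y U V : Q.Ob} {M : Type*} [AddCommGroup M] [Module k M] {φ : Q.Str X Y → M}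
    (h : IsMulti φ) (u : Q.Str X U) (w : Q.Str V Y) (c : k) (x : Q.hom U V) :
    φ (u.append (.cons (c • x) w)) = c • φ (u.append (.cons x w)) :=
  (h u w).map_smul c x

/-- The multilinearity relations between strings. -/
inductive TRel (X Y : Q.Ob) : (Q.Str X Y →₀ k) → Prop
  | add {U V : Q.Ob} (u : Q.Str X U) (w : Q.Str V Y) (x y : Q.hom U V) :
      TRel X Y (Finsupp.single (u.append (.cons (x + y) w)) 1 -
        (Finsupp.single (u.append (.cons x w)) 1 + Finsupp.single (u.append (.cons y w)) 1))
  | smul {U V : Q.Ob} (u : Q.Str X U) (w : Q.Str V Y) (c : k) (x : Q.hom U V) :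
      TRel X Y (Finsupp.single (u.append (.cons (c • x) w)) 1 -
        c • Finsupp.single (u.append (.cons x w)) 1)

variable (Q) in
/-- The module `TsA(X,Y)`, the sum of `sA(X₀,X₁) ⊗ … ⊗ sA(Xₙ₋₁,Xₙ)` over all sequences of objects
from `X` to `Y`. -/
def T (X Y : Q.Ob) : Type u := (Q.Str X Y →₀ k) ⧸ Submodule.span k {z | TRel X Y z}

noncomputable instance (X Y : Q.Ob) : AddCommGroup (Q.T X Y) :=
  inferInstanceAs (AddCommGroup ((Q.Str X Y →₀ k) ⧸ Submodule.span k {z | TRel X Y z}))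

noncomputable instance (X Y : Q.Ob) : Module k (Q.T X Y) :=
  inferInstanceAs (Module k ((Q.Str X Y →₀ k) ⧸ Submodule.span k {z | TRel X Y z}))

/-- The class of a string in the tensor module. -/
noncomputable def Str.cl {X Y : Q.Ob} (s : Q.Str X Y) : Q.T X Y :=
  Submodule.Quotient.mk (p := Submodule.span k {z | TRel X Y z}) (Finsupp.single s 1)

theorem Str.isMulti_cl {X Y : Q.Ob} : IsMulti fun s : Q.Str X Y => s.cl := by
  intro U V u w
  refine ⟨fun x y => ?_, fun c x => ?_⟩
  · exact (Submodule.Quotient.eq _).2 (Submodule.subset_span (TRel.add u w x y))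
  · exact (Submodule.Quotient.eq _).2 (Submodule.subset_span (TRel.smul u w c x))

section Lift

variable {X Y : Q.Ob} {M : Type*} [AddCommGroup M] [Module k M]

theorem T.hom_ext {φ ψ : Q.T X Y →ₗ[k] M} (h : ∀ s : Q.Str X Y, φ s.cl = ψ s.cl) : φ = ψ := by
  apply Submodule.linearMap_qext
  apply Finsupp.lhom_ext
  intro s c
  have : (Finsupp.single s c : Q.Str X Y →₀ k) = c • Finsupp.single s 1 := by simp
  rw [this, map_smul, map_smul]
  exact congrArg (c • ·) (h s)

/-- The linear map on the tensor module given by a multilinear function on strings. -/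
noncomputable def T.lift (φ : Q.Str X Y → M) (h : IsMulti φ) : Q.T X Y →ₗ[k] M :=
  Submodule.liftQ (Submodule.span k {z | TRel X Y z}) (Finsupp.linearCombination k φ) <| by
    rw [Submodule.span_le]
    rintro z (⟨u, w, x, y⟩ | ⟨u, w, c, x⟩)
    · simp [(h u w).map_add]
    · simp [(h u w).map_smul]

@[simp] theorem T.lift_cl (φ : Q.Str X Y → M) (h : IsMulti φ) (s : Q.Str X Y) :
    T.lift φ h s.cl = φ s := by
  refine (Submodule.liftQ_apply _ _ _).trans ?_
  simp

end Lift

theorem IsMulti.comp {X Y : Q.Ob} {M N : Type*} [AddCommGroup M] [Module k M] [AddCommGroup N]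
    [Module k N] {φ : Q.Str X Y → M} (h : IsMulti φ) (l : M →ₗ[k] N) :
    IsMulti fun s => l (φ s) := fun _ _ u w =>
  ⟨fun x y => by simp only [h.add, map_add], fun c x => by simp only [h.smul, map_smul]⟩

theorem IsMulti.of_linear {X Y : Q.Ob} {M : Type*} [AddCommGroup M] [Module k M]
    (φ : Q.T X Y →ₗ[k] M) : IsMulti fun s : Q.Str X Y => φ s.cl :=
  Str.isMulti_cl.comp φ

theorem isMulti_cl_append_right {X Y Z : Q.Ob} (s : Q.Str X Y) :
    IsMulti fun t : Q.Str Y Z => (s.append t).cl := fun U V u w => by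
  simpa only [Str.append_assoc] using Str.isMulti_cl (s.append u) w

theorem isMulti_cl_append_left {X Y Z : Q.Ob} (t : Q.Str Y Z) :
    IsMulti fun s : Q.Str X Y => (s.append t).cl := fun U V u w => by
  simpa only [Str.append_assoc, Str.cons_append] using Str.isMulti_cl u (w.append t)

theorem isMulti_lift_append (X Y Z : Q.Ob) :
    IsMulti fun s : Q.Str X Y =>
      T.lift (fun t : Q.Str Y Z => (s.append t).cl) (isMulti_cl_append_right s) := by
  intro U V u w
  refine ⟨fun x y => T.hom_ext fun t => ?_, fun c x => T.hom_ext fun t => ?_⟩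
  · simpa only [T.lift_cl, LinearMap.add_apply] using (isMulti_cl_append_left t).add u w x y
  · simpa only [T.lift_cl, LinearMap.smul_apply] using (isMulti_cl_append_left t).smul u w c x

/-- Concatenation in the tensor module. -/
noncomputable def T.app (X Y Z : Q.Ob) : Q.T X Y →ₗ[k] Q.T Y Z →ₗ[k] Q.T X Z :=
  T.lift (fun s => T.lift (fun t => (s.append t).cl) (isMulti_cl_append_right s))
    (isMulti_lift_append X Y Z)

@[simp] theorem T.app_cl {X Y Z : Q.Ob} (s : Q.Str X Y) (t : Q.Str Y Z) :
    T.app X Y Z s.cl t.cl = (s.append t).cl := by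
  rw [T.app, T.lift_cl, T.lift_cl]

end GrQuiver

end AInf

namespace AInf

namespace GrQuiver

variable {k : Type u} [CommRing k] {Q A C : GrQuiver k}

/-! ### Koszul signs -/

theorem koszul_apply (e : ℤ) {X Y : Q.Ob} {i : ℤ} {x : Q.hom X Y} (hx : x ∈ Q.gr X Y i) :
    Q.koszul e X Y x = (e * (i - 1)).negOnePow • x := by
  have h : (LinearEquiv.ofBijective (DirectSum.coeLinearMap (Q.gr X Y)) (Q.gr_bijective X Y)).symm x
      = DirectSum.lof k ℤ (fun i => Q.gr X Y i) i ⟨x, hx⟩ := by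
    rw [LinearEquiv.symm_apply_eq]
    simp
  simp only [koszul, LinearMap.comp_apply, LinearEquiv.coe_coe, h, DirectSum.toModule_lof]
  rfl

theorem hom_linearMap_ext {X Y : Q.Ob} {M : Type*} [AddCommGroup M] [Module k M]
    {φ ψ : Q.hom X Y →ₗ[k] M} (h : ∀ i, ∀ x ∈ Q.gr X Y i, φ x = ψ x) : φ = ψ := by
  ext x
  obtain ⟨z, rfl⟩ := (Q.gr_bijective X Y).2 x
  induction z using DirectSum.induction_on with
  | zero => simp
  | of i x => simpa using h i x x.2
  | add a b ha hb => simp only [map_add, ha, hb]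

theorem koszul_even {e : ℤ} (he : Even e) (X Y : Q.Ob) : Q.koszul e X Y = LinearMap.id :=
  hom_linearMap_ext fun i x hx => by
    rw [koszul_apply e hx, Int.negOnePow_even _ (he.mul_right _), one_smul, LinearMap.id_apply]

/-- Only the parity of the exponent matters, which is why a single sign operator suffices for
coderivations of all degrees. -/
theorem koszul_odd {e : ℤ} (he : Odd e) (X Y : Q.Ob) : Q.koszul e X Y = Q.koszul 1 X Y :=
  hom_linearMap_ext fun i x hx => by
    rw [koszul_apply e hx, koszul_apply 1 hx]
    congr 1
    rw [Int.negOnePow_eq_iff, ← sub_mul]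
    exact (he.sub_odd odd_one).mul_right _

theorem koszul_koszul (X Y : Q.Ob) (x : Q.hom X Y) :
    Q.koszul 1 X Y (Q.koszul 1 X Y x) = x := by
  have : Q.koszul 1 X Y ∘ₗ Q.koszul 1 X Y = LinearMap.id :=
    hom_linearMap_ext fun i x hx => by
      rw [LinearMap.comp_apply, koszul_apply 1 hx, map_zsmul_unit, koszul_apply 1 hx, smul_smul,
        Int.units_mul_self, one_smul, LinearMap.id_apply]
  exact LinearMap.congr_fun this x

theorem Str.twist_even {e : ℤ} (he : Even e) : ∀ {X Y : Q.Ob} (s : Q.Str X Y), s.twist e = s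
  | _, _, .nil _ => rfl
  | _, _, .cons x s => by
    rw [twist_cons, twist_even he s, koszul_even he, LinearMap.id_apply]

theorem Str.twist_odd {e : ℤ} (he : Odd e) : ∀ {X Y : Q.Ob} (s : Q.Str X Y), s.twist e = s.twist 1
  | _, _, .nil _ => rfl
  | _, _, .cons x s => by rw [twist_cons, twist_odd he s, koszul_odd he, twist_cons]

theorem Str.twist_twist : ∀ {X Y : Q.Ob} (s : Q.Str X Y), (s.twist 1).twist 1 = s
  | _, _, .nil _ => rfl
  | _, _, .cons x s => by rw [twist_cons, twist_cons, twist_twist s, koszul_koszul]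

/-! ### Linear maps out of the tensor module -/

theorem T.induction {X Y : Q.Ob} {p : Q.T X Y → Prop} (zero : p 0) (cl : ∀ s : Q.Str X Y, p s.cl)
    (add : ∀ a b, p a → p b → p (a + b)) (smul : ∀ (c : k) a, p a → p (c • a)) (z : Q.T X Y) :
    p z := by
  obtain ⟨z, rfl⟩ := Submodule.Quotient.mk_surjective _ z
  induction z using Finsupp.induction_linear with
  | zero => exact zero
  | add a b ha hb => exact add _ _ ha hb
  | single s c =>
    have : (Finsupp.single s c : Q.Str X Y →₀ k) = c • Finsupp.single s 1 := by simp
    rw [this]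
    exact smul c _ (cl s)

theorem Str.csum_smul {P : Type*} [AddCommGroup P] [Module k P] (c : k) {X Z : Q.Ob}
    (g : ∀ Y, Q.Str X Y → Q.Str Y Z → P) (s : Q.Str X Z) :
    csum (fun Y u v => c • g Y u v) s = c • csum g s :=
  (map_csum (LinearMap.lsmul k P c) g s).symm

theorem Str.csum_comm {P : Type*} [AddCommMonoid P] {X Y Z W : Q.Ob}
    (g : ∀ U V, Q.Str X U → Q.Str U Y → Q.Str Z V → Q.Str V W → P) (s : Q.Str X Y)
    (t : Q.Str Z W) :
    csum (fun U u u' => csum (fun V v v' => g U V u u' v v') t) s =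
      csum (fun V v v' => csum (fun U u u' => g U V u u' v v') s) t := by
  induction s with
  | nil X => simp
  | cons x s ih => simp only [csum_cons, ih, csum_add]

theorem Str.csum_linear_apply {P P' : Type*} [AddCommGroup P] [Module k P] [AddCommGroup P']
    [Module k P'] {X Z : Q.Ob} (g : ∀ Y, Q.Str X Y → Q.Str Y Z → P' →ₗ[k] P) (s : Q.Str X Z)
    (z : P') : csum g s z = csum (fun Y u v => g Y u v z) s :=
  map_csum (LinearMap.applyₗ (R := k) (M₂ := P) z) g s

section CutSum

variable {P : Type*} [AddCommGroup P] [Module k P]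

theorem isMulti_csum {X Z : Q.Ob} (B : ∀ Y, Q.T X Y →ₗ[k] Q.T Y Z →ₗ[k] P) :
    IsMulti fun s : Q.Str X Z => s.csum fun Y u v => B Y u.cl v.cl := by
  intro U V u w
  constructor
  · intro x y
    simp only [Str.csum_append_cons, Str.isMulti_cl.add, map_add, LinearMap.add_apply, Str.csum_add]
    abel
  · intro c x
    simp only [Str.csum_append_cons, Str.isMulti_cl.smul, map_smul, LinearMap.smul_apply,
      Str.csum_smul, smul_add]

/-- The composite of the cut comultiplication with bilinear maps. -/
noncomputable def cutSum {X Z : Q.Ob} (B : ∀ Y, Q.T X Y →ₗ[k] Q.T Y Z →ₗ[k] P) : Q.T X Z →ₗ[k] P :=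
  T.lift (fun s => s.csum fun Y u v => B Y u.cl v.cl) (isMulti_csum B)

@[simp] theorem cutSum_cl {X Z : Q.Ob} (B : ∀ Y, Q.T X Y →ₗ[k] Q.T Y Z →ₗ[k] P) (s : Q.Str X Z) :
    cutSum B s.cl = s.csum fun Y u v => B Y u.cl v.cl :=
  T.lift_cl _ _ _

theorem cutSum_add {X Z : Q.Ob} (B B' : ∀ Y, Q.T X Y →ₗ[k] Q.T Y Z →ₗ[k] P) :
    cutSum (fun Y => B Y + B' Y) = cutSum B + cutSum B' :=
  T.hom_ext fun s => by simp [Str.csum_add]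

theorem cutSum_smul {X Z : Q.Ob} (c : k) (B : ∀ Y, Q.T X Y →ₗ[k] Q.T Y Z →ₗ[k] P) :
    cutSum (fun Y => c • B Y) = c • cutSum B :=
  T.hom_ext fun s => by simp [Str.csum_smul]

theorem cutSum_zero {X Z : Q.Ob} :
    cutSum (fun Y => (0 : Q.T X Y →ₗ[k] Q.T Y Z →ₗ[k] P)) = 0 :=
  T.hom_ext fun s => by simp [Str.csum_zero]

end CutSum

/-- Elements of `sA(X,Y)` as elements of the tensor module. -/
noncomputable def T.emb (X Y : Q.Ob) : Q.hom X Y →ₗ[k] Q.T X Y where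
  toFun x := (Str.cons x (.nil Y)).cl
  map_add' x y := Str.isMulti_cl.add (.nil X) (.nil Y) x y
  map_smul' c x := Str.isMulti_cl.smul (.nil X) (.nil Y) c x

theorem T.emb_apply {X Y : Q.Ob} (x : Q.hom X Y) : T.emb X Y x = (Str.cons x (.nil Y)).cl := rfl

@[simp] theorem T.app_emb_cl {X Y Z : Q.Ob} (x : Q.hom X Y) (s : Q.Str Y Z) :
    T.app X Y Z (T.emb X Y x) s.cl = (Str.cons x s).cl := by
  rw [emb_apply, app_cl]; rfl

@[simp] theorem T.nil_app {X Y : Q.Ob} (z : Q.T X Y) : T.app X X Y (Str.nil X).cl z = z := by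
  have : T.app X X Y (Str.nil X).cl = LinearMap.id := T.hom_ext fun s => by simp
  rw [this, LinearMap.id_apply]

@[simp] theorem T.app_nil {X Y : Q.Ob} (z : Q.T X Y) : T.app X Y Y z (Str.nil Y).cl = z := by
  have : (T.app X Y Y).flip (Str.nil Y).cl = LinearMap.id := T.hom_ext fun s => by simp
  exact LinearMap.congr_fun this z

theorem T.app_assoc {X Y Z W : Q.Ob} (a : Q.T X Y) (b : Q.T Y Z) (c : Q.T Z W) :
    T.app X Z W (T.app X Y Z a b) c = T.app X Y W a (T.app Y Z W b c) := by
  induction a using T.induction with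
  | zero => simp
  | add a a' h h' => simp only [map_add, LinearMap.add_apply, h, h']
  | smul r a h => simp only [map_smul, LinearMap.smul_apply, h]
  | cl s =>
    induction b using T.induction with
    | zero => simp
    | add a a' h h' => simp only [map_add, LinearMap.add_apply, h, h']
    | smul r a h => simp only [map_smul, LinearMap.smul_apply, h]
    | cl t =>
      induction c using T.induction with
      | zero => simp
      | add a a' h h' => simp only [map_add, h, h']
      | smul r a h => simp only [map_smul, h]
      | cl v => simp [Str.append_assoc]

/-- The linear form of `Str.csum_append_cons`: a cut of a ⊗ x ⊗ b lies inside a or inside b. The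
factors must be arbitrary tensors because they will be values of cocategory homomorphisms. -/
theorem cutSum_app_emb_app {P : Type*} [AddCommGroup P] [Module k P] {X U V Z : Q.Ob}
    (B : ∀ Y, Q.T X Y →ₗ[k] Q.T Y Z →ₗ[k] P) (a : Q.T X U) (x : Q.hom U V) (b : Q.T V Z) :
    cutSum B (T.app X U Z a (T.app U V Z (T.emb U V x) b)) =
      cutSum (fun Y => (B Y).compl₂ ((T.app Y U Z).flip (T.app U V Z (T.emb U V x) b))) a +
      cutSum (fun Y => B Y ∘ₗ T.app X U Y a ∘ₗ T.app U V Y (T.emb U V x)) b := by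
  induction a using T.induction with
  | zero =>
    simp only [map_zero, LinearMap.zero_apply, LinearMap.zero_comp, LinearMap.comp_zero, cutSum_zero,
      add_zero]
  | add a a' h h' =>
    simp only [map_add, LinearMap.add_apply, h, h', LinearMap.add_comp, LinearMap.comp_add,
      cutSum_add]
    abel
  | smul r a h =>
    simp only [map_smul, LinearMap.smul_apply, h, LinearMap.smul_comp, LinearMap.comp_smul,
      cutSum_smul, smul_add]
  | cl s =>
    induction b using T.induction with
    | zero =>
      have (Y : Q.Ob) : (B Y).compl₂ (0 : Q.T Y U →ₗ[k] Q.T Y Z) = 0 := by ext; simp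
      simp only [map_zero, this, cutSum_zero, LinearMap.zero_apply, add_zero]
    | add b b' h h' =>
      have (Y : Q.Ob) (l l' : Q.T Y U →ₗ[k] Q.T Y Z) :
          (B Y).compl₂ (l + l') = (B Y).compl₂ l + (B Y).compl₂ l' := by ext; simp
      simp only [map_add, h, h', this, cutSum_add, LinearMap.add_apply]
      abel
    | smul r b h =>
      have (Y : Q.Ob) (l : Q.T Y U →ₗ[k] Q.T Y Z) :
          (B Y).compl₂ (r • l) = r • (B Y).compl₂ l := by ext; simp
      simp only [map_smul, h, this, cutSum_smul, LinearMap.smul_apply, smul_add]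
    | cl t => simp [Str.csum_append_cons]

/-! ### The convolution product -/

/-- Families of linear maps `TsA(X,Y) → TsC(Xf,Yg)`. -/
abbrev LMap (A C : GrQuiver k) (f g : A.Ob → C.Ob) : Type u :=
  ∀ X Y, A.T X Y →ₗ[k] C.T (f X) (g Y)

/-- Families of linear maps `TsA(X,Y) → sC(Xf,Yg)`. -/
abbrev Comp (A C : GrQuiver k) (f g : A.Ob → C.Ob) : Type u :=
  ∀ X Y, A.T X Y →ₗ[k] C.hom (f X) (g Y)

variable {f g h l : A.Ob → C.Ob}

/-- The convolution product of `Φ` and `Ψ` (without signs): cut a string, apply `Φ` and `Ψ`,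
concatenate. -/
noncomputable def conv (Φ : LMap A C f g) (Ψ : LMap A C g h) : LMap A C f h :=
  fun X Z => cutSum fun Y => (T.app (f X) (g Y) (h Z)).compl₁₂ (Φ X Y) (Ψ Y Z)

scoped infixr:70 " ⋆ " => conv

theorem conv_cl (Φ : LMap A C f g) (Ψ : LMap A C g h) {X Z : A.Ob} (s : A.Str X Z) :
    (Φ ⋆ Ψ) X Z s.cl = s.csum fun Y u v => T.app _ _ _ (Φ X Y u.cl) (Ψ Y Z v.cl) := by
  simp [conv]

theorem LMap.ext_cl {Φ Ψ : LMap A C f g} (h : ∀ X Y (s : A.Str X Y), Φ X Y s.cl = Ψ X Y s.cl) :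
    Φ = Ψ :=
  funext fun X => funext fun Y => T.hom_ext (h X Y)

theorem Comp.ext_cl {Φ Ψ : Comp A C f g} (h : ∀ X Y (s : A.Str X Y), Φ X Y s.cl = Ψ X Y s.cl) :
    Φ = Ψ :=
  funext fun X => funext fun Y => T.hom_ext (h X Y)

/-- Coassociativity of cutting combined with associativity of concatenation. It permits nested
coderivation formulas to be written as plain ⋆-words. -/
theorem conv_assoc (Φ : LMap A C f g) (Ψ : LMap A C g h) (Θ : LMap A C h l) :
    (Φ ⋆ Ψ) ⋆ Θ = Φ ⋆ Ψ ⋆ Θ :=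
  LMap.ext_cl fun X Z s => by
    simp only [conv_cl, Str.map_csum, Str.csum_linear_apply, T.app_assoc]
    rw [Str.csum_assoc s]

theorem conv_add (Φ : LMap A C f g) (Ψ Ψ' : LMap A C g h) : Φ ⋆ (Ψ + Ψ') = Φ ⋆ Ψ + Φ ⋆ Ψ' :=
  LMap.ext_cl fun X Z s => by simp [conv_cl, Str.csum_add]

theorem add_conv (Φ Φ' : LMap A C f g) (Ψ : LMap A C g h) : (Φ + Φ') ⋆ Ψ = Φ ⋆ Ψ + Φ' ⋆ Ψ :=
  LMap.ext_cl fun X Z s => by simp [conv_cl, Str.csum_add]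

theorem conv_zero (Φ : LMap A C f g) : Φ ⋆ (0 : LMap A C g h) = 0 :=
  LMap.ext_cl fun X Z s => by simp [conv_cl, Str.csum_zero]

theorem zero_conv (Ψ : LMap A C g h) : (0 : LMap A C f g) ⋆ Ψ = 0 :=
  LMap.ext_cl fun X Z s => by simp [conv_cl, Str.csum_zero]

theorem conv_neg (Φ : LMap A C f g) (Ψ : LMap A C g h) : Φ ⋆ (-Ψ) = -(Φ ⋆ Ψ) :=
  eq_neg_of_add_eq_zero_left (by rw [← conv_add, neg_add_cancel, conv_zero])

theorem neg_conv (Φ : LMap A C f g) (Ψ : LMap A C g h) : (-Φ) ⋆ Ψ = -(Φ ⋆ Ψ) :=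
  eq_neg_of_add_eq_zero_left (by rw [← add_conv, neg_add_cancel, zero_conv])

theorem conv_sub (Φ : LMap A C f g) (Ψ Ψ' : LMap A C g h) : Φ ⋆ (Ψ - Ψ') = Φ ⋆ Ψ - Φ ⋆ Ψ' := by
  rw [sub_eq_add_neg, conv_add, conv_neg, sub_eq_add_neg]

theorem sub_conv (Φ Φ' : LMap A C f g) (Ψ : LMap A C g h) : (Φ - Φ') ⋆ Ψ = Φ ⋆ Ψ - Φ' ⋆ Ψ := by
  rw [sub_eq_add_neg, add_conv, neg_conv, sub_eq_add_neg]

/-- The unit of the convolution product. -/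
noncomputable def LMap.one (f : A.Ob → C.Ob) : LMap A C f f := fun X Y =>
  T.lift (fun s : A.Str X Y => match s with
    | .nil X => (Str.nil (f X)).cl
    | .cons _ _ => 0) <| by
      intro U V u w
      cases u <;> exact ⟨fun _ _ => (add_zero _).symm, fun _ _ => (smul_zero _).symm⟩

@[simp] theorem LMap.one_nil (X : A.Ob) : LMap.one f X X (Str.nil X).cl = (Str.nil (f X)).cl :=
  T.lift_cl _ _ _

@[simp] theorem LMap.one_cons {X Y Z : A.Ob} (x : A.hom X Y) (s : A.Str Y Z) :
    LMap.one f X Z (Str.cons x s).cl = 0 :=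
  T.lift_cl _ _ _

theorem LMap.one_of_pos {X Y : A.Ob} {s : A.Str X Y} (hs : 0 < s.length) :
    LMap.one f X Y s.cl = 0 := by
  cases s with
  | nil => simp at hs
  | cons x s => simp

theorem one_conv (Φ : LMap A C f g) : LMap.one f ⋆ Φ = Φ :=
  LMap.ext_cl fun X Z s => by
    rw [conv_cl, Str.csum_eq_right]
    · simp
    · intro Y u v h₁ h₂
      rw [LMap.one_of_pos (by omega), map_zero, LinearMap.zero_apply]

/-- A family of maps to `sC` as a family of maps to `TsC`. -/
noncomputable def Comp.up (r : Comp A C f g) : LMap A C f g := fun X Y => T.emb _ _ ∘ₗ r X Y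

theorem Comp.up_apply (r : Comp A C f g) {X Y : A.Ob} (z : A.T X Y) :
    r.up X Y z = T.emb _ _ (r X Y z) := rfl

theorem Comp.up_add (r r' : Comp A C f g) : (r + r').up = r.up + r'.up :=
  LMap.ext_cl fun X Y s => by simp [Comp.up_apply]

theorem Comp.up_sub (r r' : Comp A C f g) : (r - r').up = r.up - r'.up :=
  LMap.ext_cl fun X Y s => by simp [Comp.up_apply]

theorem Comp.up_neg (r : Comp A C f g) : (-r).up = -r.up :=
  LMap.ext_cl fun X Y s => by simp [Comp.up_apply]

theorem Comp.up_zero : (0 : Comp A C f g).up = 0 :=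
  LMap.ext_cl fun X Y s => by simp [Comp.up_apply]

/-! ### Comultiplication -/

/-- `(Φ)Δ = ∑ Δ(Φ'ᵢ ⊗ Φ''ᵢ)` for the list of the pairs `(Φ'ᵢ, Φ''ᵢ)`. -/
def Splits (Φ : LMap A C f g) (L : List (Σ h, LMap A C f h × LMap A C h g)) : Prop :=
  ∀ ⦃P : Type u⦄ [AddCommGroup P] [Module k P] ⦃X Z : A.Ob⦄
    (B : ∀ Y, C.T (f X) Y →ₗ[k] C.T Y (g Z) →ₗ[k] P) (s : A.Str X Z),
    cutSum B (Φ X Z s.cl) = (L.map fun c => s.csum fun Y u v =>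
      B (c.1 Y) (c.2.1 X Y u.cl) (c.2.2 Y Z v.cl)).sum

/-- Cocategory homomorphisms. -/
def Grouplike (F : LMap A C f f) : Prop := Splits F [⟨f, F, F⟩]

theorem csum_list_sum {P ι : Type*} [AddCommMonoid P] {X Z : A.Ob} (L : List ι)
    (G : ι → ∀ Y, A.Str X Y → A.Str Y Z → P) (s : A.Str X Z) :
    (s.csum fun Y u v => (L.map fun c => G c Y u v).sum) = (L.map fun c => s.csum (G c)).sum := by
  induction L with
  | nil => simp [Str.csum_zero]
  | cons c L ih => simp only [List.map_cons, List.sum_cons, Str.csum_add, ih]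

/-- A cut of a value of F ⋆ r ⋆ Ψ falls before the entry produced by r, where grouplikeness splits
off a copy of F, or after it, where it is a cut of Ψ. -/
theorem Splits.conv {F : LMap A C f f} (hF : Grouplike F) (r : Comp A C f g) {Ψ : LMap A C g h}
    {L : List (Σ h', LMap A C g h' × LMap A C h' h)} (hΨ : Splits Ψ L) :
    Splits (F ⋆ r.up ⋆ Ψ)
      (⟨f, F, F ⋆ r.up ⋆ Ψ⟩ :: L.map fun c => ⟨c.1, F ⋆ r.up ⋆ c.2.1, c.2.2⟩) := by
  intro P _ _ X Z B s
  simp only [conv_cl, Comp.up_apply, Str.map_csum, cutSum_app_emb_app, hF _ _, hΨ _ _, Str.csum_add,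
    List.map_cons, List.map_nil, List.map_map, List.sum_cons, List.sum_nil, add_zero]
  congr 1
  · simp only [LinearMap.compl₂_apply, LinearMap.flip_apply]
    rw [Str.csum_assoc s fun Y Y₁ u u₁ v => Str.csum (fun Y₂ u₂ v =>
      B (f Y) (F X Y u.cl) (T.app _ _ _ (F Y Y₁ u₁.cl)
        (T.app _ _ _ (T.emb _ _ (r Y₁ Y₂ u₂.cl)) (Ψ Y₂ Z v.cl)))) v]
    exact Str.csum_congr fun Y u v _ => Str.csum_comm _ _ _
  · simp only [LinearMap.comp_apply, Function.comp_def]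
    have key : ∀ c ∈ L, (s.csum fun Y u v => v.csum fun Y₁ u₁ v₁ => v₁.csum fun Y₂ u₂ v₂ =>
        B (c.1 Y₂) (T.app _ _ _ (F X Y u.cl) (T.app _ _ _ (T.emb _ _ (r Y Y₁ u₁.cl))
          (c.2.1 Y₁ Y₂ u₂.cl))) (c.2.2 Y₂ Z v₂.cl)) =
        s.csum fun Y u v => B (c.1 Y) ((F ⋆ r.up ⋆ c.2.1) X Y u.cl) (c.2.2 Y Z v.cl) := by
      intro c _
      simp only [conv_cl, Str.map_csum, Str.csum_linear_apply, Comp.up_apply]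
      rw [← Str.csum_assoc s fun Y Y₂ u w v₂ => w.csum fun Y₁ u₁ u₂ =>
        B (c.1 Y₂) (T.app _ _ _ (F X Y u.cl) (T.app _ _ _ (T.emb _ _ (r Y Y₁ u₁.cl))
          (c.2.1 Y₁ Y₂ u₂.cl))) (c.2.2 Y₂ Z v₂.cl)]
      exact Str.csum_congr fun Y u v _ => Str.csum_assoc _ _
    rw [← List.map_congr_left key, ← csum_list_sum]
    refine Str.csum_congr fun Y u v _ => ?_
    rw [← csum_list_sum]

/-! ### Composition with endomorphisms of the tensor module -/

/-- Families of endomorphisms of `TsA(X,Y)`. -/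
abbrev TEnd (A : GrQuiver k) : Type u := ∀ X Y, A.T X Y →ₗ[k] A.T X Y

/-- First an endomorphism of `TsA`, then `Φ`. -/
noncomputable def LMap.pre (c : TEnd A) (Φ : LMap A C f g) : LMap A C f g := fun X Y => Φ X Y ∘ₗ c X Y

/-- First `Φ`, then an endomorphism of `TsC`. -/
noncomputable def LMap.post (c : TEnd C) (Φ : LMap A C f g) : LMap A C f g := fun X Y => c _ _ ∘ₗ Φ X Y

/-- First an endomorphism of `TsA`, then `r`. -/
noncomputable def Comp.pre (c : TEnd A) (r : Comp A C f g) : Comp A C f g := fun X Y => r X Y ∘ₗ c X Y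

/-- First `Φ`, then a map `TsC → sC`. -/
noncomputable def LMap.toComp (c : ∀ X Y, C.T X Y →ₗ[k] C.hom X Y) (Φ : LMap A C f g) : Comp A C f g :=
  fun X Y => c _ _ ∘ₗ Φ X Y

theorem LMap.pre_apply (c : TEnd A) (Φ : LMap A C f g) {X Y : A.Ob} (z : A.T X Y) :
    Φ.pre c X Y z = Φ X Y (c X Y z) := rfl

theorem LMap.post_apply (c : TEnd C) (Φ : LMap A C f g) {X Y : A.Ob} (z : A.T X Y) :
    Φ.post c X Y z = c _ _ (Φ X Y z) := rfl

theorem Comp.pre_apply (c : TEnd A) (r : Comp A C f g) {X Y : A.Ob} (z : A.T X Y) :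
    r.pre c X Y z = r X Y (c X Y z) := rfl

theorem LMap.toComp_apply (c : ∀ X Y, C.T X Y →ₗ[k] C.hom X Y) (Φ : LMap A C f g) {X Y : A.Ob}
    (z : A.T X Y) : Φ.toComp c X Y z = c _ _ (Φ X Y z) := rfl

theorem Comp.up_pre (c : TEnd A) (r : Comp A C f g) : (r.pre c).up = r.up.pre c := rfl

/-- The Koszul sign operator on the tensor module. -/
noncomputable def K (A : GrQuiver k) : LMap A A (fun X => X) (fun X => X) := fun X Y =>
  T.lift (fun s => (s.twist 1).cl) fun U V u w =>
    ⟨fun x y => by simp only [Str.twist_append, Str.twist_cons, map_add, Str.isMulti_cl.add],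
     fun c x => by simp only [Str.twist_append, Str.twist_cons, map_smul, Str.isMulti_cl.smul]⟩

@[simp] theorem K_cl {X Y : A.Ob} (s : A.Str X Y) : K A X Y s.cl = (s.twist 1).cl :=
  T.lift_cl _ _ _

theorem grouplike_K : Grouplike (K A) := by
  intro P _ _ X Z B s
  simp [Str.csum_twist]

theorem K_K {X Y : A.Ob} (z : A.T X Y) : K A X Y (K A X Y z) = z := by
  have : K A X Y ∘ₗ K A X Y = LinearMap.id := T.hom_ext fun s => by simp [Str.twist_twist]
  exact LinearMap.congr_fun this z

/-- The identity map of the tensor module. -/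
noncomputable def E (A : GrQuiver k) : LMap A A (fun X => X) (fun X => X) := fun _ _ => LinearMap.id

theorem grouplike_E : Grouplike (E A) := by
  intro P _ _ X Z B s
  simp [E]

/-- The coderivation of `TsA` of odd degree with components `c`. -/
noncomputable def hat (c : Comp A A (fun X => X) (fun X => X)) : LMap A A (fun X => X) (fun X => X) :=
  E A ⋆ c.up ⋆ K A

theorem splits_hat (c : Comp A A (fun X => X) (fun X => X)) :
    Splits (hat c) [⟨_, E A, hat c⟩, ⟨_, hat c, K A⟩] :=
  Splits.conv grouplike_E c grouplike_K

/-- The graded Leibniz rule for an odd coderivation. As maps act on the right, acting on the left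
factor means passing the right one, which therefore acquires the sign `K`. -/
theorem conv_pre_hat (c : Comp A A (fun X => X) (fun X => X)) (Φ : LMap A C f g) (Ψ : LMap A C g h) :
    (Φ ⋆ Ψ).pre (hat c) = Φ ⋆ Ψ.pre (hat c) + Φ.pre (hat c) ⋆ Ψ.pre (K A) :=
  LMap.ext_cl fun X Z s => by
    refine (splits_hat c (fun Y => (T.app (f X) (g Y) (h Z)).compl₁₂ (Φ X Y) (Ψ Y Z)) s).trans ?_
    simp only [Pi.add_apply, LinearMap.add_apply, conv_cl, List.map_cons, List.map_nil, List.sum_cons,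
      List.sum_nil, add_zero, LinearMap.compl₁₂_apply, LMap.pre_apply]
    rfl

theorem conv_pre_K (Φ : LMap A C f g) (Ψ : LMap A C g h) :
    (Φ ⋆ Ψ).pre (K A) = Φ.pre (K A) ⋆ Ψ.pre (K A) :=
  LMap.ext_cl fun X Z s => by
    simp [LMap.pre_apply, conv_cl, Str.csum_twist]

theorem T.K_app {X Y Z : A.Ob} (a : A.T X Y) (b : A.T Y Z) :
    K A X Z (T.app X Y Z a b) = T.app X Y Z (K A X Y a) (K A Y Z b) := by
  have : (T.app X Y Z).compr₂ (K A X Z) = (T.app X Y Z).compl₁₂ (K A X Y) (K A Y Z) :=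
    T.hom_ext fun s => T.hom_ext fun t => by simp
  exact LinearMap.congr_fun₂ this a b

theorem conv_post_K (Φ : LMap A C f g) (Ψ : LMap A C g h) :
    (Φ ⋆ Ψ).post (K C) = Φ.post (K C) ⋆ Ψ.post (K C) :=
  LMap.ext_cl fun X Z s => by
    simp only [LMap.post_apply, conv_cl, Str.map_csum]
    simp only [T.K_app]

/-- Evaluating α ⋆ β after R cuts a value of R, and the splitting of R converts this into cuts of
the argument. -/
theorem LMap.post_conv {R : LMap A C f g} {L : List (Σ h, LMap A C f h × LMap A C h g)}
    (hR : Splits R L) (α β : LMap C C (fun X => X) (fun X => X)) :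
    R.post (α ⋆ β) = (L.map fun c => c.2.1.post α ⋆ c.2.2.post β).sum :=
  LMap.ext_cl fun X Z s => by
    refine (hR (fun Y => (T.app _ _ _).compl₁₂ (α _ _) (β _ _)) s).trans ?_
    have (L' : List (LMap A C f g)) : L'.sum X Z = (L'.map fun Φ => Φ X Z).sum := by
      induction L' with
      | nil => rfl
      | cons a L' ih => simp [ih]
    have h' (L' : List (A.T X Z →ₗ[k] C.T (f X) (g Z))) (z) : L'.sum z = (L'.map fun Φ => Φ z).sum := by
      induction L' with
      | nil => rfl
      | cons a L' ih => simp [ih]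
    rw [this, h', List.map_map, List.map_map]
    simp only [Function.comp_def, conv_cl, LinearMap.compl₁₂_apply, LMap.post_apply]

end GrQuiver

end AInf

namespace AInf

namespace GrQuiver

variable {k : Type u} [CommRing k] {A C : GrQuiver k} {f g h l : A.Ob → C.Ob}

/-! ### Parity -/

theorem K_emb {X Y : A.Ob} (x : A.hom X Y) : K A X Y (T.emb X Y x) = T.emb X Y (A.koszul 1 X Y x) := by
  rw [T.emb_apply, K_cl, Str.twist_cons, Str.twist_nil, T.emb_apply]

/-- Components of even degree commute with the Koszul sign operators. -/
def Comp.IsEven (r : Comp A C f g) : Prop :=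
  ∀ X Y (z : A.T X Y), C.koszul 1 _ _ (r X Y z) = r X Y (K A X Y z)

/-- Components of odd degree anticommute with the Koszul sign operators. -/
def Comp.IsOdd (r : Comp A C f g) : Prop :=
  ∀ X Y (z : A.T X Y), C.koszul 1 _ _ (r X Y z) = -r X Y (K A X Y z)

theorem Comp.IsEven.post_K {r : Comp A C f g} (hr : r.IsEven) :
    r.up.post (K C) = r.up.pre (K A) :=
  LMap.ext_cl fun X Y s => by
    simp only [LMap.post_apply, LMap.pre_apply, Comp.up_apply]
    rw [K_emb, hr]

theorem Comp.IsOdd.post_K {r : Comp A C f g} (hr : r.IsOdd) :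
    r.up.post (K C) = -r.up.pre (K A) :=
  LMap.ext_cl fun X Y s => by
    simp only [LMap.post_apply, LMap.pre_apply, Comp.up_apply, Pi.neg_apply, LinearMap.neg_apply]
    rw [K_emb, hr, map_neg]

theorem LMap.pre_K_pre_K (Φ : LMap A C f g) : (Φ.pre (K A)).pre (K A) = Φ :=
  LMap.ext_cl fun X Y s => by simp only [LMap.pre_apply, K_K]

theorem LMap.pre_add (c : TEnd A) (Φ Ψ : LMap A C f g) : (Φ + Ψ).pre c = Φ.pre c + Ψ.pre c := rfl

theorem LMap.pre_sub (c : TEnd A) (Φ Ψ : LMap A C f g) : (Φ - Ψ).pre c = Φ.pre c - Ψ.pre c := rfl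

theorem LMap.pre_post (c : TEnd A) (d : TEnd C) (Φ : LMap A C f g) :
    (Φ.pre c).post d = (Φ.post d).pre c := rfl

theorem LMap.toComp_add (c : ∀ X Y, C.T X Y →ₗ[k] C.hom X Y) (Φ Ψ : LMap A C f g) :
    (Φ + Ψ).toComp c = Φ.toComp c + Ψ.toComp c :=
  Comp.ext_cl fun X Y s => by simp [LMap.toComp_apply]

theorem LMap.toComp_sub (c : ∀ X Y, C.T X Y →ₗ[k] C.hom X Y) (Φ Ψ : LMap A C f g) :
    (Φ - Ψ).toComp c = Φ.toComp c - Ψ.toComp c :=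
  Comp.ext_cl fun X Y s => by simp [LMap.toComp_apply]

theorem LMap.toComp_neg (c : ∀ X Y, C.T X Y →ₗ[k] C.hom X Y) (Φ : LMap A C f g) :
    (-Φ).toComp c = -Φ.toComp c :=
  Comp.ext_cl fun X Y s => by simp [LMap.toComp_apply]

theorem LMap.toComp_pre (c : ∀ X Y, C.T X Y →ₗ[k] C.hom X Y) (d : TEnd A) (Φ : LMap A C f g) :
    (Φ.pre d).toComp c = (Φ.toComp c).pre d := rfl

theorem Splits.pre_K {Φ : LMap A C f g} {L : List (Σ h, LMap A C f h × LMap A C h g)}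
    (hΦ : Splits Φ L) :
    Splits (Φ.pre (K A)) (L.map fun c => ⟨c.1, c.2.1.pre (K A), c.2.2.pre (K A)⟩) := by
  intro P _ _ X Z B s
  rw [LMap.pre_apply, K_cl]
  refine (hΦ B _).trans ?_
  rw [List.map_map]
  simp only [Str.csum_twist, Function.comp_def, LMap.pre_apply, K_cl]

/-! ### Odd coderivations of one tensor cocategory -/

theorem K_post_K : (K A).post (K A) = E A :=
  LMap.ext_cl fun X Y s => by rw [LMap.post_apply, K_K]; rfl

theorem E_post_K : (E A).post (K A) = K A := rfl

theorem E_pre_K : (E A).pre (K A) = K A := rfl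

theorem K_pre_K : (K A).pre (K A) = E A := K_post_K

theorem hat_post_K {c : Comp A A (fun X => X) (fun X => X)} (hc : c.IsOdd) :
    (hat c).post (K A) = -(hat c).pre (K A) := by
  simp only [hat, conv_post_K, conv_pre_K, hc.post_K, E_post_K, E_pre_K, K_pre_K, K_post_K, neg_conv,
    conv_neg]

/-- An odd coderivation anticommutes with the sign operator; this is the source of the cancelling
signs in the identities below. -/
theorem K_pre_hat {c : Comp A A (fun X => X) (fun X => X)} (hc : c.IsOdd) (Φ : LMap A C f g) :
    (Φ.pre (K A)).pre (hat c) = -(Φ.pre (hat c)).pre (K A) :=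
  LMap.ext_cl fun X Y s => by
    have := congrFun (congrFun (hat_post_K hc) X) Y
    have := LinearMap.congr_fun this s.cl
    simp only [LMap.pre_apply, LMap.post_apply, Pi.neg_apply, LinearMap.neg_apply] at this ⊢
    rw [this, map_neg]

/-- The value of an odd coderivation of `TsC` after an `(F,G)`-coderivation. -/
theorem cod_post_hat {F : LMap A C f f} (hF : Grouplike F) {G : LMap A C g g} (hG : Grouplike G)
    (r : Comp A C f g) (c : Comp C C (fun X => X) (fun X => X)) :
    -- The component c consumes the middle one of three consecutive pieces; the three terms have r
    -- in the right, the middle and the left piece.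
    (F ⋆ r.up ⋆ G).post (hat c) =
      F ⋆ (F.toComp c).up ⋆ (F ⋆ r.up ⋆ G).post (K C) +
      F ⋆ ((F ⋆ r.up ⋆ G).toComp c).up ⋆ G.post (K C) +
      (F ⋆ r.up ⋆ G) ⋆ (G.toComp c).up ⋆ G.post (K C) := by
  have hR := Splits.conv hF r hG
  rw [hat, LMap.post_conv hR]
  simp only [List.map_cons, List.map_nil, List.sum_cons, List.sum_nil, add_zero]
  rw [LMap.post_conv hR, LMap.post_conv hG]
  simp only [List.map_cons, List.map_nil, List.sum_cons, List.sum_nil, add_zero, conv_add]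
  rfl

/-- Two successive cuts yield three pieces, the middle one being consumed by c. The six terms are
the ways to place r and then the odd or even entry of P weakly to its right among these pieces. -/
theorem cod₂_post_hat {F : LMap A C f f} (hF : Grouplike F) {G : LMap A C g g}
    {H : LMap A C h h} (hH : Grouplike H)
    (r : Comp A C f g) {P : LMap A C g h} (hP : Splits P [⟨_, G, P⟩, ⟨_, P, H⟩])
    (c : Comp C C (fun X => X) (fun X => X)) :
    (F ⋆ r.up ⋆ P).post (hat c) =
      F ⋆ (F.toComp c).up ⋆ (F ⋆ r.up ⋆ P).post (K C) +
      F ⋆ ((F ⋆ r.up ⋆ G).toComp c).up ⋆ P.post (K C) +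
      F ⋆ ((F ⋆ r.up ⋆ P).toComp c).up ⋆ H.post (K C) +
      (F ⋆ r.up ⋆ G) ⋆ (G.toComp c).up ⋆ P.post (K C) +
      (F ⋆ r.up ⋆ G) ⋆ (P.toComp c).up ⋆ H.post (K C) +
      (F ⋆ r.up ⋆ P) ⋆ (H.toComp c).up ⋆ H.post (K C) := by
  have hR := Splits.conv hF r hP
  rw [hat, LMap.post_conv hR]
  simp only [List.map_cons, List.map_nil, List.sum_cons, List.sum_nil, add_zero]
  rw [LMap.post_conv hR, LMap.post_conv hP, LMap.post_conv hH]
  simp only [List.map_cons, List.map_nil, List.sum_cons, List.sum_nil, add_zero, conv_add]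
  simp only [← add_assoc]
  rfl

/-- `b² = 0`. -/
theorem hat_post_hat {b : Comp A A (fun X => X) (fun X => X)} (hb : b.IsOdd)
    (hbb : (hat b).toComp b = 0) : (hat b).post (hat b) = 0 := by
  have := cod_post_hat grouplike_E grouplike_K b b
  rw [← hat, hbb, Comp.up_zero] at this
  rw [this]
  have hE : ((E A).toComp b).up = b.up := rfl
  have hK : ((K A).toComp b).up = b.up.pre (K A) := rfl
  -- What remains are the terms in which the two copies of b act on disjoint blocks. They occur in
  -- both orders with opposite signs, because b is odd.
  rw [hE, hK, hat_post_K hb, K_post_K]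
  simp only [hat, conv_pre_K, E_pre_K, K_pre_K, conv_neg, zero_conv, conv_zero, add_zero, conv_assoc]
  simp

/-- `b î + î b = 0`, if this holds for the components. -/
theorem hat_post_hat_add {b i : Comp A A (fun X => X) (fun X => X)} (hb : b.IsOdd) (hi : i.IsOdd)
    (h : (hat i).toComp b + (hat b).toComp i = 0) :
    (hat i).post (hat b) + (hat b).post (hat i) = 0 := by
  have h₁ := cod_post_hat grouplike_E grouplike_K i b
  have h₂ := cod_post_hat grouplike_E grouplike_K b i
  have hE (c : Comp A A (fun X => X) (fun X => X)) : ((E A).toComp c).up = c.up := rfl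
  have hK (c : Comp A A (fun X => X) (fun X => X)) : ((K A).toComp c).up = c.up.pre (K A) := rfl
  rw [← hat, eq_neg_of_add_eq_zero_left h, Comp.up_neg] at h₁
  rw [← hat] at h₂
  rw [h₁, h₂, hE, hE, hK, hK, hat_post_K hb, hat_post_K hi, K_post_K]
  simp only [hat, conv_pre_K, E_pre_K, K_pre_K, conv_neg, neg_conv, conv_assoc]
  abel

/-! ### Cocategory homomorphisms that commute with the differentials -/

/-- A differential on the tensor cocategory, given by its components. -/
structure IsDiff (b : Comp A A (fun X => X) (fun X => X)) : Prop where
  odd : b.IsOdd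
  sq : (hat b).toComp b = 0

/-- A homomorphism of differential cocategories. -/
structure IsHom (a : Comp A A (fun X => X) (fun X => X)) (b : Comp C C (fun X => X) (fun X => X))
    (F : LMap A C f f) : Prop where
  grouplike : Grouplike F
  even : F.post (K C) = F.pre (K A)
  comm : F.pre (hat a) = F ⋆ (F.toComp b).up ⋆ F.pre (K A)

/-! ### The commutator with the differentials, and B₁² = 0 -/

section Identities

variable {a : Comp A A (fun X => X) (fun X => X)} {b : Comp C C (fun X => X) (fun X => X)}
  {F : LMap A C f f} {G : LMap A C g g} {H : LMap A C h h}

/-- `rB₁` for `r` of even degree. -/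
noncomputable def B₁e (a : Comp A A (fun X => X) (fun X => X)) (b : Comp C C (fun X => X) (fun X => X))
    (F : LMap A C f f) (r : Comp A C f g) (G : LMap A C g g) : Comp A C f g :=
  (F ⋆ r.up ⋆ G).toComp b - r.pre (hat a)

/-- `rB₁` for `r` of odd degree. -/
noncomputable def B₁o (a : Comp A A (fun X => X) (fun X => X)) (b : Comp C C (fun X => X) (fun X => X))
    (F : LMap A C f f) (r : Comp A C f g) (G : LMap A C g g) : Comp A C f g :=
  (F ⋆ r.up ⋆ G.pre (K A)).toComp b + r.pre (hat a)

/-- `(r ⊗ p)B₂` for `r` of odd degree and `p` of odd degree. -/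
noncomputable def B₂oo (b : Comp C C (fun X => X) (fun X => X)) (F : LMap A C f f) (r : Comp A C f g)
    (G : LMap A C g g) (p : Comp A C g h) (H : LMap A C h h) : Comp A C f h :=
  (F ⋆ r.up ⋆ (G ⋆ p.up ⋆ H.pre (K A)).pre (K A)).toComp b

/-- `(r ⊗ p)B₂` for `r` of odd degree and `p` of even degree. -/
noncomputable def B₂oe (b : Comp C C (fun X => X) (fun X => X)) (F : LMap A C f f) (r : Comp A C f g)
    (G : LMap A C g g) (p : Comp A C g h) (H : LMap A C h h) : Comp A C f h :=
  (F ⋆ r.up ⋆ (G ⋆ p.up ⋆ H).pre (K A)).toComp b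

/-- `(r ⊗ p)B₂` for `r` of even degree and `p` of odd degree. -/
noncomputable def B₂eo (b : Comp C C (fun X => X) (fun X => X)) (F : LMap A C f f) (r : Comp A C f g)
    (G : LMap A C g g) (p : Comp A C g h) (H : LMap A C h h) : Comp A C f h :=
  (F ⋆ r.up ⋆ G ⋆ p.up ⋆ H.pre (K A)).toComp b

/-- Terms in which b consumes only values of F or only values of G cancel against those in which the
differential of the source acts under F or G. What survives is b consuming a block that contains r,
and the source differential acting under r. -/
theorem cod_even (hF : IsHom a b F) (hG : IsHom a b G) {r : Comp A C f g}
    (hr : r.IsEven) :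
    (F ⋆ r.up ⋆ G).post (hat b) - (F ⋆ r.up ⋆ G).pre (hat a) =
      F ⋆ (B₁e a b F r G).up ⋆ G.pre (K A) := by
  rw [cod_post_hat hF.grouplike hG.grouplike]
  simp only [conv_pre_hat, conv_pre_K, conv_post_K, hF.even, hG.even, hr.post_K, hF.comm, hG.comm,
    B₁e, Comp.up_sub, Comp.up_pre, conv_add, conv_sub, sub_conv, conv_assoc]
  abel

theorem cod_odd (hF : IsHom a b F) (hG : IsHom a b G) (ha : IsDiff a) {r : Comp A C f g}
    (hr : r.IsOdd) :
    (F ⋆ r.up ⋆ G.pre (K A)).post (hat b) + (F ⋆ r.up ⋆ G.pre (K A)).pre (hat a) =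
      F ⋆ (B₁o a b F r G).up ⋆ G := by
  rw [cod_post_hat hF.grouplike hG.grouplike.pre_K]
  simp only [conv_pre_hat, conv_pre_K, conv_post_K, LMap.pre_post, hF.even, hG.even, hr.post_K,
    hF.comm, hG.comm, K_pre_hat ha.odd, LMap.pre_K_pre_K, LMap.toComp_pre,
    B₁o, Comp.up_add, Comp.up_pre, conv_add, add_conv, conv_neg, neg_conv, conv_assoc]
  abel

theorem LMap.post_toComp (hb : IsDiff b) (Φ : LMap A C f g) :
    (Φ.post (hat b)).toComp b = 0 :=
  Comp.ext_cl fun X Y s => LinearMap.congr_fun (congrFun (congrFun hb.sq _) _) (Φ X Y s.cl)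

theorem Comp.pre_pre (ha : IsDiff a) (r : Comp A C f g) : (r.pre (hat a)).pre (hat a) = 0 :=
  Comp.ext_cl fun X Y s => by
    have := LinearMap.congr_fun (congrFun (congrFun (hat_post_hat ha.odd ha.sq) X) Y) s.cl
    simp only [Comp.pre_apply]
    exact (congrArg (r X Y) this).trans (map_zero _)

theorem Comp.pre_add (c : TEnd A) (r p : Comp A C f g) : (r + p).pre c = r.pre c + p.pre c := rfl

theorem Comp.pre_sub (c : TEnd A) (r p : Comp A C f g) : (r - p).pre c = r.pre c - p.pre c := rfl

theorem Comp.pre_neg (c : TEnd A) (r : Comp A C f g) : (-r).pre c = -r.pre c := rfl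

/-- By `cod_even` the coderivation generated by rB₁ is the full commutator with b, so b² = 0 on both
sides kills the second commutator. -/
theorem B₁o_B₁e (hF : IsHom a b F) (hG : IsHom a b G) (ha : IsDiff a) (hb : IsDiff b)
    {r : Comp A C f g} (hr : r.IsEven) : B₁o a b F (B₁e a b F r G) G = 0 := by
  rw [B₁o, ← cod_even hF hG hr, LMap.toComp_sub, LMap.post_toComp hb, LMap.toComp_pre, B₁e,
    Comp.pre_sub, Comp.pre_pre ha]
  abel

theorem B₁e_B₁o (hF : IsHom a b F) (hG : IsHom a b G) (ha : IsDiff a) (hb : IsDiff b)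
    {r : Comp A C f g} (hr : r.IsOdd) : B₁e a b F (B₁o a b F r G) G = 0 := by
  rw [B₁e, ← cod_odd hF hG ha hr, LMap.toComp_add, LMap.post_toComp hb, LMap.toComp_pre, B₁o,
    Comp.pre_add, Comp.pre_pre ha]
  abel

end Identities

end GrQuiver

end AInf

/-! ### Products with a natural transformation; naturality homotopies for unit transformations -/

namespace AInf

namespace GrQuiver

variable {k : Type u} [CommRing k] {A C : GrQuiver k} {f g h l : A.Ob → C.Ob}
  {a : Comp A A (fun X => X) (fun X => X)} {b : Comp C C (fun X => X) (fun X => X)}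
  {F : LMap A C f f} {G : LMap A C g g} {H : LMap A C h h}

theorem LMap.up_toComp_pre (c : ∀ X Y, C.T X Y →ₗ[k] C.hom X Y) (d : TEnd A) (Φ : LMap A C f g) :
    (Φ.toComp c).up.pre d = ((Φ.pre d).toComp c).up := rfl

/-- `[r ⊗ p, b]` for an odd `r` with `rB₁ = 0` and an even `p`. -/
theorem cod₂_odd_even (hF : IsHom a b F) (hG : IsHom a b G) (hH : IsHom a b H) (ha : IsDiff a)
    {r : Comp A C f g} (hr : r.IsOdd) (hr' : B₁o a b F r G = 0) {p : Comp A C g h} (hp : p.IsEven) :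
    (F ⋆ r.up ⋆ (G ⋆ p.up ⋆ H).pre (K A)).post (hat b) +
        (F ⋆ r.up ⋆ (G ⋆ p.up ⋆ H).pre (K A)).pre (hat a) =
      F ⋆ (B₂oe b F r G p H).up ⋆ H + F ⋆ r.up ⋆ (G ⋆ (B₁e a b G p H).up ⋆ H.pre (K A)).pre (K A) := by
  have hP := (Splits.conv hG.grouplike p hH.grouplike).pre_K
  -- Naturality of r trades the source differential under r for b consuming the block of r, so these
  -- two kinds of terms cancel in the commutator.
  have hra : r.up.pre (hat a) = -((F ⋆ r.up ⋆ G.pre (K A)).toComp b).up := by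
    rw [eq_neg_iff_add_eq_zero, add_comm, ← Comp.up_pre, ← Comp.up_add, ← B₁o, hr', Comp.up_zero]
  rw [cod₂_post_hat hF.grouplike hH.grouplike.pre_K r hP]
  simp only [conv_pre_hat, conv_pre_K, conv_post_K, LMap.pre_post, hF.even, hG.even, hH.even,
    hr.post_K, hp.post_K,
    hF.comm, hG.comm, hH.comm, K_pre_hat ha.odd, LMap.pre_K_pre_K,
    LMap.up_toComp_pre, B₂oe, B₁e, Comp.up_pre, hra,
    Comp.up_sub, LMap.pre_sub, conv_sub, sub_conv, conv_add, conv_neg,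
    neg_conv, conv_assoc]
  abel

/-- `[p ⊗ r, b]` for an even `p` and an odd `r` with `rB₁ = 0`. -/
theorem cod₂_even_odd (hF : IsHom a b F) (hG : IsHom a b G) (hH : IsHom a b H) (ha : IsDiff a)
    {p : Comp A C f g} (hp : p.IsEven) {r : Comp A C g h} (hr : r.IsOdd) (hr' : B₁o a b G r H = 0) :
    (F ⋆ p.up ⋆ G ⋆ r.up ⋆ H.pre (K A)).post (hat b) +
        (F ⋆ p.up ⋆ G ⋆ r.up ⋆ H.pre (K A)).pre (hat a) =
      F ⋆ (B₂eo b F p G r H).up ⋆ H -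
        F ⋆ (B₁e a b F p G).up ⋆ (G ⋆ r.up ⋆ H.pre (K A)).pre (K A) := by
  have hP := Splits.conv hG.grouplike r hH.grouplike.pre_K
  have hra : r.up.pre (hat a) = -((G ⋆ r.up ⋆ H.pre (K A)).toComp b).up := by
    rw [eq_neg_iff_add_eq_zero, add_comm, ← Comp.up_pre, ← Comp.up_add, ← B₁o, hr', Comp.up_zero]
  rw [cod₂_post_hat hF.grouplike hH.grouplike.pre_K p hP]
  simp only [conv_pre_hat, conv_pre_K, conv_post_K, LMap.pre_post, hF.even, hG.even, hH.even,
    hr.post_K, hp.post_K,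
    hF.comm, hG.comm, hH.comm, K_pre_hat ha.odd, LMap.pre_K_pre_K,
    LMap.toComp_pre, B₂eo, B₁e, Comp.up_pre, hra,
    Comp.up_sub, conv_sub, sub_conv, conv_add,
    conv_neg, neg_conv, conv_assoc]
  abel

/-- Taking components under b of `cod₂_odd_even` and using b² = 0. Since rB₁ = 0, only the
derivative of p survives, and the sign comes from r being odd. -/
theorem B₁e_B₂oe (hF : IsHom a b F) (hG : IsHom a b G) (hH : IsHom a b H) (ha : IsDiff a)
    (hb : IsDiff b) {r : Comp A C f g} (hr : r.IsOdd) (hr' : B₁o a b F r G = 0) {p : Comp A C g h}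
    (hp : p.IsEven) :
    B₁e a b F (B₂oe b F r G p H) H = -B₂oo b F r G (B₁e a b G p H) H := by
  have := congrArg (LMap.toComp b) (cod₂_odd_even hF hG hH ha hr hr' hp)
  rw [LMap.toComp_add, LMap.toComp_add, LMap.post_toComp hb, zero_add, LMap.toComp_pre,
    ← B₂oe, ← B₂oo] at this
  rw [B₁e, this]
  abel

theorem B₁e_B₂eo (hF : IsHom a b F) (hG : IsHom a b G) (hH : IsHom a b H) (ha : IsDiff a)
    (hb : IsDiff b) {p : Comp A C f g} (hp : p.IsEven) {r : Comp A C g h} (hr : r.IsOdd)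
    (hr' : B₁o a b G r H = 0) :
    B₁e a b F (B₂eo b F p G r H) H = B₂oo b F (B₁e a b F p G) G r H := by
  have := congrArg (LMap.toComp b) (cod₂_even_odd hF hG hH ha hp hr hr')
  rw [LMap.toComp_add, LMap.toComp_sub, LMap.post_toComp hb, zero_add, LMap.toComp_pre,
    ← B₂eo, ← B₂oo] at this
  rw [B₁e, this]
  abel

/-- The naturality homotopy between `Fi · r` and `r · Gi`, for an odd natural endotransformation `i`
of the identity of the target. -/
theorem B₁e_toComp (hF : IsHom a b F) (hG : IsHom a b G)
    {r : Comp A C f g} (hr : r.IsOdd) (hr' : B₁o a b F r G = 0) (ha : IsDiff a)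
    {i : Comp C C (fun X => X) (fun X => X)} (h : (hat i).toComp b + (hat b).toComp i = 0) :
    B₁e a b F ((F ⋆ r.up ⋆ G.pre (K A)).toComp i) G =
      B₂oo b F (F.toComp i) F r G - B₂oo b F r G (G.toComp i) G := by
  have h₁ : (F ⋆ r.up ⋆ G.pre (K A)).pre (hat a) = -(F ⋆ r.up ⋆ G.pre (K A)).post (hat b) := by
    rw [eq_neg_iff_add_eq_zero, add_comm, cod_odd hF hG ha hr, hr', Comp.up_zero, zero_conv,
      conv_zero]
  have h₂ : ((F ⋆ r.up ⋆ G.pre (K A)).post (hat b)).toComp i =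
      -((F ⋆ r.up ⋆ G.pre (K A)).post (hat i)).toComp b :=
    Comp.ext_cl fun X Y s => eq_neg_of_add_eq_zero_right
      (LinearMap.congr_fun (congrFun (congrFun h _) _) ((F ⋆ r.up ⋆ G.pre (K A)) X Y s.cl))
  -- The expression is now F ⋆ (Ri) ⋆ G minus R followed by the coderivation of i, both followed by
  -- b, where R is the coderivation of r. In the second expansion the term with i consuming r
  -- cancels the first expression; the other two terms are the two products.
  rw [B₁e, ← LMap.toComp_pre, h₁, LMap.toComp_neg, h₂, neg_neg,
    cod_post_hat hF.grouplike hG.grouplike.pre_K]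
  simp only [B₂oo, conv_pre_K, conv_post_K, LMap.pre_post, hF.even, hG.even, hr.post_K,
    LMap.pre_K_pre_K, LMap.toComp_pre, Comp.up_pre, conv_neg, neg_conv, conv_assoc,
    LMap.toComp_add, LMap.toComp_neg]
  abel

/-- Naturality of i is known only on components; `hat_post_hat_add` extends it to anticommutation of
the full coderivations. -/
theorem pre_hat_pre_hat {i : Comp A A (fun X => X) (fun X => X)} (ha : IsDiff a) (hi : i.IsOdd)
    (h : (hat i).toComp a + (hat a).toComp i = 0) (r : Comp A C f g) :
    (r.pre (hat i)).pre (hat a) = -(r.pre (hat a)).pre (hat i) :=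
  Comp.ext_cl fun X Y s => by
    have := congrArg (r X Y)
      (LinearMap.congr_fun (congrFun (congrFun (hat_post_hat_add ha.odd hi h) X) Y) s.cl)
    refine eq_neg_of_add_eq_zero_right (Eq.trans ?_ (this.trans (map_zero _)))
    exact (map_add (r X Y) _ _).symm

/-- The naturality homotopy between `iF · r` and `r · iG`, for an odd natural endotransformation `i`
of the identity of the source. -/
theorem B₁e_pre
    {r : Comp A C f g} (hr' : B₁o a b F r G = 0) (ha : IsDiff a)
    {i : Comp A A (fun X => X) (fun X => X)} (hi : i.IsOdd)
    (h : (hat i).toComp a + (hat a).toComp i = 0) {φ : Comp A C f f} {γ : Comp A C g g}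
    (hφ : F.pre (hat i) = F ⋆ φ.up ⋆ F.pre (K A)) (hγ : G.pre (hat i) = G ⋆ γ.up ⋆ G.pre (K A)) :
    B₁e a b F (r.pre (hat i)) G = B₂oo b F r G γ G - B₂oo b F φ F r G := by
  have hra : r.pre (hat a) = -(F ⋆ r.up ⋆ G.pre (K A)).toComp b := by
    rw [eq_neg_iff_add_eq_zero, add_comm]; exact hr'
  rw [B₁e, pre_hat_pre_hat ha hi h, hra, Comp.pre_neg, neg_neg, ← LMap.toComp_pre]
  simp only [B₂oo, conv_pre_hat, conv_pre_K, K_pre_hat hi, hφ, hγ, LMap.pre_K_pre_K,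
    conv_neg, conv_add, conv_assoc, Comp.up_pre,
    LMap.toComp_add, LMap.toComp_neg]
  abel

/-- Grouplikeness of F applied to the two cuts around the block consumed by c. -/
theorem IsHom.post_hat (hF : IsHom a b F) (c : Comp C C (fun X => X) (fun X => X)) :
    F.post (hat c) = F ⋆ (F.toComp c).up ⋆ F.pre (K A) := by
  rw [hat, LMap.post_conv hF.grouplike]
  simp only [List.map_cons, List.map_nil, List.sum_cons, List.sum_nil, add_zero]
  rw [LMap.post_conv hF.grouplike]
  simp only [List.map_cons, List.map_nil, List.sum_cons, List.sum_nil, add_zero]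
  rw [hF.even]
  rfl

/-- `Fi` is natural. -/
theorem B₁o_toComp (hF : IsHom a b F) {i : Comp C C (fun X => X) (fun X => X)}
    (h : (hat i).toComp b + (hat b).toComp i = 0) : B₁o a b F (F.toComp i) F = 0 := by
  rw [B₁o, ← hF.post_hat, ← LMap.toComp_pre, hF.comm, ← hF.post_hat]
  exact Comp.ext_cl fun X Y s => LinearMap.congr_fun (congrFun (congrFun h _) _) (F X Y s.cl)

/-- `iF` is natural. -/
theorem B₁o_pre {i : Comp A A (fun X => X) (fun X => X)} (ha : IsDiff a) (hi : i.IsOdd)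
    (h : (hat i).toComp a + (hat a).toComp i = 0) {φ : Comp A C f f}
    (hφ : F.pre (hat i) = F ⋆ (φ.pre (hat i)).up ⋆ F.pre (K A))
    (hφ' : φ.pre (hat a) = F.toComp b) : B₁o a b F (φ.pre (hat i)) F = 0 := by
  rw [B₁o, ← hφ, LMap.toComp_pre, pre_hat_pre_hat ha hi h, hφ', add_neg_cancel]

end GrQuiver

end AInf

namespace AInf

namespace GrQuiver

variable {k : Type u} [CommRing k] {A C : GrQuiver k} {f g h l : A.Ob → C.Ob}

/-! ### Degrees -/

/-- Strings of homogeneous elements with sum of degrees `d`. -/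
inductive Str.IsHomog : ∀ {X Y : A.Ob}, A.Str X Y → ℤ → Prop
  | nil (X : A.Ob) : IsHomog (Str.nil X) 0
  | cons {X Y Z : A.Ob} {x : A.hom X Y} {s : A.Str Y Z} {i d : ℤ} (hx : x ∈ A.sgr X Y i)
      (hs : IsHomog s d) : IsHomog (Str.cons x s) (i + d)

theorem koszul_one_sgr {X Y : A.Ob} {x : A.hom X Y} {i : ℤ} (hx : x ∈ A.sgr X Y i) :
    A.koszul 1 X Y x = i.negOnePow • x := by
  rw [koszul_apply 1 hx, one_mul, add_sub_cancel_right]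

theorem Str.IsHomog.cl_twist {X Y : A.Ob} {s : A.Str X Y} {d : ℤ} (hs : s.IsHomog d) :
    (s.twist 1).cl = d.negOnePow • s.cl := by
  induction hs with
  | nil X => simp
  | cons hx hs ih =>
    rw [twist_cons, ← T.app_emb_cl, ih, koszul_one_sgr hx, ← T.app_emb_cl, Int.negOnePow_add]
    simp only [Units.smul_def, map_zsmul, LinearMap.smul_apply, smul_smul, Units.val_mul]
    rw [mul_comm]

/-- By induction on the string, the tail may be taken homogeneous while the first entry is fixed;
with such a tail, the first entry is decomposed into homogeneous parts. -/
theorem T.hom_ext_homog {M : Type*} [AddCommGroup M] [Module k M] {X Y : A.Ob}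
    {φ ψ : A.T X Y →ₗ[k] M} (H : ∀ (s : A.Str X Y) (d : ℤ), s.IsHomog d → φ s.cl = ψ s.cl) :
    φ = ψ := by
  refine T.hom_ext fun s => ?_
  induction s with
  | nil X => exact H _ _ (.nil X)
  | @cons X Y Z x s ih =>
    have := ih (φ := φ ∘ₗ T.app X Y Z (T.emb X Y x)) (ψ := ψ ∘ₗ T.app X Y Z (T.emb X Y x))
      fun t d ht => by
        have h₁ : φ ∘ₗ (T.app X Y Z).flip t.cl ∘ₗ T.emb X Y =
            ψ ∘ₗ (T.app X Y Z).flip t.cl ∘ₗ T.emb X Y :=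
          hom_linearMap_ext fun i y hy => by
            simp only [LinearMap.comp_apply, LinearMap.flip_apply, T.app_emb_cl]
            -- Degree i in A is degree i - 1 in sA.
            refine H _ (i - 1 + d) (.cons ?_ ht)
            rwa [sgr, sub_add_cancel]
        exact LinearMap.congr_fun h₁ x
    simpa using this

/-- The components `r` have degree `e`. -/
def Comp.HasDeg (r : Comp A C f g) (e : ℤ) : Prop :=
  ∀ ⦃X Y : A.Ob⦄ (s : A.Str X Y) (d : ℤ), s.IsHomog d → r X Y s.cl ∈ C.sgr (f X) (g Y) (d + e)

variable (A) in
/-- The homogeneous components of the tensor module. -/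
noncomputable def T.gr (X Y : A.Ob) (d : ℤ) : Submodule k (A.T X Y) :=
  Submodule.span k {z | ∃ s : A.Str X Y, s.IsHomog d ∧ s.cl = z}

theorem Str.IsHomog.cl_mem {X Y : A.Ob} {s : A.Str X Y} {d : ℤ} (hs : s.IsHomog d) :
    s.cl ∈ T.gr A X Y d := Submodule.subset_span ⟨s, hs, rfl⟩

/-- `Φ` has degree `e`. -/
def LMap.HasDeg (Φ : LMap A C f g) (e : ℤ) : Prop :=
  ∀ ⦃X Y : A.Ob⦄ (s : A.Str X Y) (d : ℤ), s.IsHomog d → Φ X Y s.cl ∈ T.gr C (f X) (g Y) (d + e)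

theorem Comp.HasDeg.mem {r : Comp A C f g} {e : ℤ} (hr : r.HasDeg e) {X Y : A.Ob} {d d' : ℤ}
    {z : A.T X Y} (hz : z ∈ T.gr A X Y d) (hd : d + e = d') : r X Y z ∈ C.sgr (f X) (g Y) d' := by
  subst hd
  have : T.gr A X Y d ≤ (C.sgr (f X) (g Y) (d + e)).comap (r X Y) := by
    rw [T.gr, Submodule.span_le]
    rintro _ ⟨s, hs, rfl⟩
    exact hr s d hs
  exact this hz

theorem T.emb_mem {X Y : A.Ob} {x : A.hom X Y} {i : ℤ} (hx : x ∈ A.sgr X Y i) :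
    T.emb X Y x ∈ T.gr A X Y i := by
  simpa [T.emb_apply] using (Str.IsHomog.cons hx (.nil Y)).cl_mem

theorem Str.IsHomog.append {X Y Z : A.Ob} {s : A.Str X Y} {t : A.Str Y Z} {d d' : ℤ}
    (hs : s.IsHomog d) (ht : t.IsHomog d') : (s.append t).IsHomog (d + d') := by
  induction hs with
  | nil X => simpa using ht
  | cons hx hs ih => rw [cons_append, add_assoc]; exact .cons hx (ih ht)

theorem T.app_mem {X Y Z : A.Ob} {a : A.T X Y} {b : A.T Y Z} {d d' : ℤ} (ha : a ∈ T.gr A X Y d)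
    (hb : b ∈ T.gr A Y Z d') : T.app X Y Z a b ∈ T.gr A X Z (d + d') := by
  have : Submodule.map₂ (T.app X Y Z) (T.gr A X Y d) (T.gr A Y Z d') ≤ T.gr A X Z (d + d') := by
    rw [T.gr, T.gr, Submodule.map₂_span_span, Submodule.span_le]
    rintro _ ⟨_, ⟨s, hs, rfl⟩, _, ⟨t, ht, rfl⟩, rfl⟩
    simpa using (hs.append ht).cl_mem
  exact this (Submodule.apply_mem_map₂ _ ha hb)

theorem Comp.HasDeg.up {r : Comp A C f g} {e : ℤ} (hr : r.HasDeg e) : r.up.HasDeg e :=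
  fun _ _ s d hs => T.emb_mem (hr s d hs)

theorem Comp.HasDeg.comp {r : Comp A C f g} {e e' d : ℤ} (hr : r.HasDeg e) {c : LMap A A (fun X => X) (fun X => X)}
    (hc : c.HasDeg e') (hd : e' + e = d) : (r.pre c).HasDeg d :=
  fun _ _ s _ hs => hr.mem (hc s _ hs) (by omega)

theorem LMap.HasDeg.toComp {Φ : LMap A C f g} {e e' d : ℤ} (hΦ : Φ.HasDeg e)
    {c : Comp C C (fun X => X) (fun X => X)} (hc : c.HasDeg e') (hd : e + e' = d) :
    (Φ.toComp c).HasDeg d :=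
  fun _ _ s _ hs => hc.mem (hΦ s _ hs) (by omega)

theorem Str.IsHomog.csum_mem {P : Type*} [AddCommGroup P] [Module k P] (S : Submodule k P)
    {X Z : A.Ob} {s : A.Str X Z} {d : ℤ} (hs : s.IsHomog d) {G : ∀ Y, A.Str X Y → A.Str Y Z → P}
    (hG : ∀ Y u v i j, u.IsHomog i → v.IsHomog j → i + j = d → G Y u v ∈ S) : s.csum G ∈ S := by
  induction hs with
  | nil X => simpa using hG _ _ _ 0 0 (.nil X) (.nil X) rfl
  | cons hx hs ih =>
    rw [csum_cons]
    refine S.add_mem (hG _ _ _ 0 _ (.nil _) (.cons hx hs) (zero_add _)) (ih ?_)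
    intro Y u v i j hu hv hij
    exact hG _ _ _ _ j (.cons hx hu) hv (by omega)

theorem LMap.HasDeg.conv {Φ : LMap A C f g} {Ψ : LMap A C g h} {e e' d : ℤ} (hΦ : Φ.HasDeg e)
    (hΨ : Ψ.HasDeg e') (hd : e + e' = d) : (Φ ⋆ Ψ).HasDeg d := by
  intro X Z s n hs
  rw [conv_cl]
  refine hs.csum_mem _ fun Y u v i j hu hv hij => ?_
  have : n + d = (i + e) + (j + e') := by omega
  rw [this]
  exact T.app_mem (hΦ u i hu) (hΨ v j hv)

theorem LMap.HasDeg.pre_K {Φ : LMap A C f g} {e : ℤ} (hΦ : Φ.HasDeg e) :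
    (Φ.pre (K A)).HasDeg e := by
  intro X Z s n hs
  rw [LMap.pre_apply, K_cl, hs.cl_twist, Units.smul_def, map_zsmul]
  exact zsmul_mem (hΦ s n hs) _

theorem LMap.hasDeg_E : (E A).HasDeg 0 := fun _ _ s d hs => by
  rw [add_zero]; exact hs.cl_mem

theorem LMap.hasDeg_K : (K A).HasDeg 0 := LMap.hasDeg_E.pre_K

theorem Comp.HasDeg.hat {c : Comp A A (fun X => X) (fun X => X)} {e : ℤ} (hc : c.HasDeg e) :
    (hat c).HasDeg e :=
  LMap.hasDeg_E.conv (hc.up.conv LMap.hasDeg_K (add_zero _)) (zero_add _)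

theorem Comp.HasDeg.add {r p : Comp A C f g} {e : ℤ} (hr : r.HasDeg e) (hp : p.HasDeg e) :
    (r + p).HasDeg e := fun _ _ s d hs => Submodule.add_mem _ (hr s d hs) (hp s d hs)

theorem Comp.HasDeg.sub {r p : Comp A C f g} {e : ℤ} (hr : r.HasDeg e) (hp : p.HasDeg e) :
    (r - p).HasDeg e := fun _ _ s d hs => Submodule.sub_mem _ (hr s d hs) (hp s d hs)

theorem Comp.HasDeg.isEven {r : Comp A C f g} {e : ℤ} (hr : r.HasDeg e) (he : Even e) :
    r.IsEven := fun X Y z => by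
  have : C.koszul 1 _ _ ∘ₗ r X Y = r X Y ∘ₗ K A X Y := T.hom_ext_homog fun s d hs => by
    rw [LinearMap.comp_apply, LinearMap.comp_apply, K_cl, hs.cl_twist, koszul_one_sgr (hr s d hs),
      Int.negOnePow_add, Int.negOnePow_even e he, mul_one]
    simp only [Units.smul_def, map_zsmul]
  exact LinearMap.congr_fun this z

theorem Comp.HasDeg.isOdd {r : Comp A C f g} {e : ℤ} (hr : r.HasDeg e) (he : Odd e) :
    r.IsOdd := fun X Y z => by
  have : C.koszul 1 _ _ ∘ₗ r X Y = -(r X Y ∘ₗ K A X Y) := T.hom_ext_homog fun s d hs => by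
    rw [LinearMap.neg_apply, LinearMap.comp_apply, LinearMap.comp_apply, K_cl, hs.cl_twist,
      koszul_one_sgr (hr s d hs),
      Int.negOnePow_add, Int.negOnePow_odd e he, mul_neg, mul_one]
    simp only [Units.smul_def, map_zsmul, Units.val_neg, neg_smul]
  exact LinearMap.congr_fun this z

/-! ### Cocategory homomorphisms with given components -/

/-- Since φ vanishes on empty strings, each use of the equation passes to strictly shorter strings.
This serves as the uniqueness principle for the recursion defining a cocategory homomorphism. -/
theorem eq_zero_of_eq_conv {φ : Comp A C f f} (hφ : ∀ X, φ X X (Str.nil X).cl = 0)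
    {Z : LMap A C f g} (hZ : Z = φ.up ⋆ Z) : Z = 0 := by
  have key : ∀ n X Y (s : A.Str X Y), s.length < n → Z X Y s.cl = 0 := by
    intro n
    induction n with
    | zero => intro X Y s hs; omega
    | succ n ih =>
      intro X Y s hs
      rw [hZ, conv_cl]
      refine (Str.csum_congr (g' := fun _ _ _ => 0) fun W u v huv => ?_).trans (Str.csum_zero s)
      cases u with
      | nil => rw [Comp.up_apply, hφ, map_zero, map_zero, LinearMap.zero_apply]
      | cons x u =>
        rw [ih _ _ v (by simp only [Str.length_cons] at huv; omega), map_zero]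
  exact LMap.ext_cl fun X Y s => key _ X Y s (Nat.lt_succ_self _)

/-- `F = 1 + φ + φ ⋆ φ + …`. -/
def IsGeom (φ : Comp A C f f) (F : LMap A C f f) : Prop := F = LMap.one f + φ.up ⋆ F

section Geom

variable {φ : Comp A C f f} {F : LMap A C f f}

theorem IsGeom.apply_nil (hF : IsGeom φ F) (hφ : ∀ X, φ X X (Str.nil X).cl = 0) (X : A.Ob) :
    F X X (Str.nil X).cl = (Str.nil (f X)).cl := by
  have := LinearMap.congr_fun (congrFun (congrFun hF X) X) (Str.nil X).cl
  simpa [conv_cl, Comp.up_apply, hφ] using this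

/-- Strong induction on length through F = 1 + φ ⋆ F: a cut falls before the first block, or after
it inside the value of F on a strictly shorter string. -/
theorem IsGeom.grouplike (hF : IsGeom φ F) (hφ : ∀ X, φ X X (Str.nil X).cl = 0) :
    Grouplike F := by
  intro P _ _ X Z B s
  simp only [List.map_cons, List.map_nil, List.sum_cons, List.sum_nil, add_zero]
  induction hn : s.length using Nat.strong_induction_on generalizing X Z s with
  | _ n ih =>
  subst hn
  have hs (X Z : A.Ob) (s : A.Str X Z) : F X Z s.cl = LMap.one f X Z s.cl + (φ.up ⋆ F) X Z s.cl :=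
    LinearMap.congr_fun (congrFun (congrFun hF X) Z) s.cl
  cases s with
  | nil => simp [hF.apply_nil hφ]
  | @cons X Y Z x s =>
    have h₁ : ∀ Y' (u : A.Str Y Y') (v : A.Str Y' Z), u.length + v.length = s.length →
        cutSum B (T.app _ _ _ (φ.up X Y' (Str.cons x u).cl) (F Y' Z v.cl)) =
          B (f X) (Str.nil (f X)).cl (T.app _ _ _ (φ.up X Y' (Str.cons x u).cl) (F Y' Z v.cl)) +
          v.csum fun W v₁ v₂ => B (f W) (T.app _ _ _ (φ.up X Y' (Str.cons x u).cl) (F Y' W v₁.cl))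
            (F W Z v₂.cl) := by
      intro Y' u v huv
      have := cutSum_app_emb_app B (Str.nil (f X)).cl (φ X Y' (Str.cons x u).cl) (F Y' Z v.cl)
      rw [ih _ (by simp only [Str.length_cons]; omega) _ v rfl] at this
      simpa [Comp.up_apply] using this
    have h₂ : F X Z (Str.cons x s).cl =
        s.csum fun Y' u v => T.app _ _ _ (φ.up X Y' (Str.cons x u).cl) (F Y' Z v.cl) := by
      rw [hs, LMap.one_cons, zero_add, conv_cl, Str.csum_cons]
      simp [Comp.up_apply, hφ]
    rw [h₂, Str.map_csum, Str.csum_congr h₁, Str.csum_add, Str.csum_cons, hF.apply_nil hφ, h₂,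
      Str.map_csum]
    congr 1
    rw [Str.csum_assoc s fun Y' W u v₁ v₂ =>
      B (f W) (T.app _ _ _ (φ.up X Y' (Str.cons x u).cl) (F Y' W v₁.cl)) (F W Z v₂.cl)]
    refine Str.csum_congr fun W u v _ => ?_
    rw [hs X W, LMap.one_cons, zero_add, conv_cl, Str.csum_cons]
    simp [Comp.up_apply, hφ, Str.map_csum, Str.csum_linear_apply]

theorem one_post_K : (LMap.one f : LMap A C f f).post (K C) = (LMap.one f).pre (K A) :=
  LMap.ext_cl fun X Y s => by
    cases s <;> simp [LMap.post_apply, LMap.pre_apply]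

theorem one_pre_K : (LMap.one f : LMap A C f f).pre (K A) = LMap.one f :=
  LMap.ext_cl fun X Y s => by
    cases s <;> simp [LMap.pre_apply]

/-- Both sides solve the equation Z = 1 + (φK) ⋆ Z, so uniqueness applies to their difference. -/
theorem IsGeom.even (hF : IsGeom φ F) (hφ : ∀ X, φ X X (Str.nil X).cl = 0) (hφ' : φ.IsEven) :
    F.post (K C) = F.pre (K A) := by
  have h₁ : F.post (K C) = LMap.one f + (φ.pre (K A)).up ⋆ F.post (K C) := by
    conv_lhs => rw [hF]
    have (Φ Ψ : LMap A C f f) : (Φ + Ψ).post (K C) = Φ.post (K C) + Ψ.post (K C) :=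
      LMap.ext_cl fun X Y s => by simp [LMap.post_apply]
    rw [this, conv_post_K, hφ'.post_K, one_post_K, one_pre_K, Comp.up_pre]
  have h₂ : F.pre (K A) = LMap.one f + (φ.pre (K A)).up ⋆ F.pre (K A) := by
    conv_lhs => rw [hF]
    rw [LMap.pre_add, conv_pre_K, one_pre_K, Comp.up_pre]
  refine sub_eq_zero.1 (eq_zero_of_eq_conv (φ := φ.pre (K A)) (fun X => ?_) ?_)
  · simp [Comp.pre_apply, hφ]
  · conv_lhs => rw [h₁, h₂]
    rw [conv_sub]
    abel

theorem T.one_app_emb {X U V Y : A.Ob} (a : A.T X U) (x : A.hom U V) (c : A.T V Y) :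
    (LMap.one f : LMap A C f f) X Y (T.app _ _ _ a (T.app _ _ _ (T.emb _ _ x) c)) = 0 := by
  have h : ((T.app X U Y).compr₂ (LMap.one f X Y : _ →ₗ[k] C.T (f X) (f Y))).compl₂
      (T.app U V Y (T.emb U V x)) = 0 :=
    T.hom_ext fun s => T.hom_ext fun t => by
      cases s <;> simp
  exact LinearMap.congr_fun₂ h a c

theorem one_pre_hat (c : Comp A A (fun X => X) (fun X => X)) :
    (LMap.one f : LMap A C f f).pre (hat c) = 0 :=
  LMap.ext_cl fun X Y s => by
    simp only [LMap.pre_apply, hat, conv_cl, Str.map_csum, Comp.up_apply, T.one_app_emb,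
      Str.csum_zero, Pi.zero_apply, LinearMap.zero_apply]

/-- Both sides solve the same equation, Z equal to φ ⋆ Z plus a fixed term, hence agree. No
compatibility with differentials is needed, so the result covers both the differential and the unit
transformation of the source. -/
theorem IsGeom.pre_hat (hF : IsGeom φ F) (hφ : ∀ X, φ X X (Str.nil X).cl = 0)
    (c : Comp A A (fun X => X) (fun X => X)) :
    F.pre (hat c) = F ⋆ (φ.pre (hat c)).up ⋆ F.pre (K A) := by
  have h₁ : F.pre (hat c) = φ.up ⋆ F.pre (hat c) + (φ.pre (hat c)).up ⋆ F.pre (K A) := by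
    conv_lhs => rw [hF]
    rw [LMap.pre_add, conv_pre_hat, one_pre_hat, zero_add, Comp.up_pre]
  refine sub_eq_zero.1 (eq_zero_of_eq_conv hφ ?_)
  have h₂ : ∀ Ξ : LMap A C f f, F ⋆ Ξ = Ξ + φ.up ⋆ F ⋆ Ξ := fun Ξ => by
    conv_lhs => rw [hF]
    rw [add_conv, one_conv, conv_assoc]
  conv_lhs => rw [h₁, h₂]
  rw [conv_sub]
  abel

theorem LMap.hasDeg_one : (LMap.one f : LMap A C f f).HasDeg 0 := by
  intro X Y s d hs
  cases hs with
  | nil => simpa using (Str.IsHomog.nil (f X)).cl_mem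
  | cons => rw [LMap.one_cons]; exact Submodule.zero_mem _

theorem IsGeom.hasDeg (hF : IsGeom φ F) (hφ : ∀ X, φ X X (Str.nil X).cl = 0)
    (hφ' : φ.HasDeg 0) : F.HasDeg 0 := by
  intro X Y s d hs
  induction hn : s.length using Nat.strong_induction_on generalizing X Y s d with
  | _ n ih =>
  subst hn
  have h := LinearMap.congr_fun (congrFun (congrFun hF X) Y) s.cl
  rw [h]
  refine Submodule.add_mem _ (LMap.hasDeg_one s d hs) ?_
  cases hs with
  | nil => simp [conv_cl, Comp.up_apply, hφ]
  | @cons X _ Z x s i d hx hs =>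
    rw [conv_cl, Str.csum_cons, Comp.up_apply, hφ, map_zero, map_zero, LinearMap.zero_apply, zero_add]
    -- The guard records that the second piece is shorter than the whole string, information that
    -- `Str.IsHomog.csum_mem` does not pass on and the induction hypothesis requires.
    rw [Str.csum_congr (g' := fun W u v => if v.length < s.length + 1 then
      T.app _ _ _ (φ.up X W (Str.cons x u).cl) (F W _ v.cl) else 0) (by
        intro W u v huv; rw [if_pos (by omega)])]
    refine hs.csum_mem _ fun W u v p q hu hv hpq => ?_
    split_ifs with hlt
    · have h₁ := hφ'.up _ _ (Str.IsHomog.cons hx hu)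
      have h₂ := ih v.length (by simpa using hlt) v q hv rfl
      have : i + d + 0 = i + p + 0 + (q + 0) := by omega
      rw [this]
      exact T.app_mem h₁ h₂
    · exact Submodule.zero_mem _

end Geom

end GrQuiver

end AInf

namespace AInf

open GrQuiver

section Bridge

variable {k : Type u} [CommRing k] {A C : GrQuiver k} {f g h l : A.Ob → C.Ob}

/-! ### Families and components -/

/-- The sequence of objects is independent of the varied entry only after the prefix has been
unfolded; taking ψ on all sequences at once is what makes the induction on the prefix possible. -/
theorem isMulti_ten {X Y : A.Ob} {M : Type*} [AddCommGroup M] [Module k M]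
    (ψ : ∀ p : A.Seq X Y, Ten p →ₗ[k] M) : IsMulti fun s : A.Str X Y => ψ s.seq s.ten := by
  intro U V u w
  induction u with
  | nil X =>
    let ψ' : A.hom X V ⊗[k] Ten w.seq →ₗ[k] M := ψ (.cons X w.seq)
    have h (x : A.hom X V) : ψ (((Str.nil X).append (.cons x w)).seq)
        ((Str.nil X).append (.cons x w)).ten = ψ' (x ⊗ₜ w.ten) := rfl
    exact ⟨fun x y => by simp only [h, TensorProduct.add_tmul, map_add],
      fun c x => by simp only [h, ← TensorProduct.smul_tmul', map_smul]⟩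
  | @cons _ W _ y u ih =>
    let ψ' (p : A.Seq W Y) : Ten p →ₗ[k] M :=
      (ψ (.cons _ p) : A.hom _ W ⊗[k] Ten p →ₗ[k] M) ∘ₗ TensorProduct.mk k _ (Ten p) y
    exact ih ψ'

/-- The components given by a family. -/
noncomputable def Family.lin (φ : Family A C f g) : Comp A C f g :=
  fun _ _ => T.lift (fun s => φ.val s) (isMulti_ten fun p => φ p)

@[simp] theorem Family.lin_cl (φ : Family A C f g) {X Y : A.Ob} (s : A.Str X Y) :
    φ.lin X Y s.cl = φ.val s := T.lift_cl _ _ _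

/-- The inclusion of `sA(X₀,X₁) ⊗ … ⊗ sA(Xₙ₋₁,Xₙ)` into the tensor module. -/
noncomputable def tenIncl : ∀ {X Y : A.Ob} (p : A.Seq X Y), Ten p →ₗ[k] A.T X Y
  | _, _, Seq.nil X => (LinearMap.toSpanSingleton k (A.T X X) (Str.nil X).cl : k →ₗ[k] A.T X X)
  | _, _, @Seq.cons _ _ _ X Y Z p =>
      (TensorProduct.lift ((T.app X Y Z).compl₁₂ (T.emb X Y) (tenIncl p)) :
        A.hom X Y ⊗[k] Ten p →ₗ[k] A.T X Z)

theorem tenIncl_tmul {X Y Z : A.Ob} (p : A.Seq Y Z) (x : A.hom X Y) (z : Ten p) :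
    tenIncl (.cons X p) (x ⊗ₜ[k] z : A.hom X Y ⊗[k] Ten p) =
      T.app X Y Z (T.emb X Y x) (tenIncl p z) := rfl

@[simp] theorem tenIncl_ten {X Y : A.Ob} (s : A.Str X Y) : tenIncl s.seq s.ten = s.cl := by
  induction s with
  | nil X => exact one_smul k _
  | cons x s ih => exact (tenIncl_tmul _ _ _).trans (by rw [ih, T.app_emb_cl])

/-- The family given by components. -/
noncomputable def GrQuiver.Comp.fam (r : Comp A C f g) : Family A C f g :=
  fun X Y p => r X Y ∘ₗ tenIncl p

theorem GrQuiver.Comp.fam_val (r : Comp A C f g) {X Y : A.Ob} (s : A.Str X Y) :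
    r.fam.val s = r X Y s.cl := by
  rw [Family.val, Comp.fam, LinearMap.comp_apply, tenIncl_ten]

theorem GrQuiver.Comp.lin_fam (r : Comp A C f g) : r.fam.lin = r :=
  Comp.ext_cl fun X Y s => by rw [Family.lin_cl, Comp.fam_val]

theorem tenGr_le {X Y : A.Ob} (p : A.Seq X Y) (d : ℤ) :
    tenGr p d ≤ (T.gr A X Y d).comap (tenIncl p) := by
  induction p generalizing d with
  | nil X =>
    intro (z : k) hz
    change z • (Str.nil X).cl ∈ T.gr A X X d
    change z ∈ (if d = 0 then (⊤ : Submodule k k) else (⊥ : Submodule k k)) at hz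
    split_ifs at hz with hd
    · subst hd
      exact Submodule.smul_mem _ _ (Str.IsHomog.nil X).cl_mem
    · rw [(Submodule.mem_bot k).1 hz, zero_smul]
      exact Submodule.zero_mem _
  | cons X p ih =>
    refine iSup_le fun i => Submodule.map₂_le.2 fun x hx z hz => ?_
    have := T.app_mem (T.emb_mem hx) (ih (d - i) hz)
    rw [add_sub_cancel] at this
    exact this

theorem GrQuiver.Str.IsHomog.ten_mem {X Y : A.Ob} {s : A.Str X Y} {d : ℤ} (hs : s.IsHomog d) :
    s.ten ∈ tenGr s.seq d := by
  induction hs with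
  | nil X =>
    change (1 : k) ∈ (if (0 : ℤ) = 0 then (⊤ : Submodule k k) else (⊥ : Submodule k k))
    simp
  | @cons X Y Z x s i d hx hs ih =>
    have h : s.ten ∈ tenGr s.seq (i + d - i) := by rwa [add_sub_cancel_left]
    have := Submodule.mem_iSup_of_mem (p := fun i' : ℤ =>
      Submodule.map₂ (TensorProduct.mk k (A.hom X Y) (Ten s.seq)) (A.sgr X Y i')
        (tenGr s.seq (i + d - i'))) i (Submodule.apply_mem_map₂ _ hx h)
    exact this

theorem GrQuiver.Comp.HasDeg.fam {r : Comp A C f g} {e : ℤ} (hr : r.HasDeg e) : r.fam.HasDegree e :=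
  fun _ _ p d _ hz => hr.mem (tenGr_le p d hz) rfl

theorem Family.HasDegree.lin {φ : Family A C f g} {e : ℤ} (hφ : φ.HasDegree e) : φ.lin.HasDeg e :=
  fun _ _ s d hs => by rw [Family.lin_cl]; exact hφ s.seq d s.ten hs.ten_mem

/-! ### Formal sums of strings -/

/-- The class of a formal sum of strings in the tensor module. -/
noncomputable def lcl {X Y : A.Ob} (L : List (A.Str X Y)) : A.T X Y := (L.map Str.cl).sum

theorem lcl_cons {X Y : A.Ob} (s : A.Str X Y) (L : List (A.Str X Y)) :
    lcl (s :: L) = s.cl + lcl L := by simp [lcl]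

theorem lcl_append {X Y : A.Ob} (L L' : List (A.Str X Y)) : lcl (L ++ L') = lcl L + lcl L' := by
  simp [lcl]

theorem lcl_flatMap {X Y : A.Ob} {ι : Type*} (L : List ι) (G : ι → List (A.Str X Y)) :
    lcl (L.flatMap G) = (L.map fun c => lcl (G c)).sum := by
  induction L with
  | nil => rfl
  | cons c L ih => rw [List.flatMap_cons, lcl_append, ih, List.map_cons, List.sum_cons]

theorem lcl_map_cons {X Y Z : A.Ob} (x : A.hom X Y) (L : List (A.Str Y Z)) :
    lcl (L.map fun t => Str.cons x t) = T.app X Y Z (T.emb X Y x) (lcl L) := by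
  induction L with
  | nil => simp [lcl]
  | cons c L ih => rw [List.map_cons, lcl_cons, ih, lcl_cons, map_add, T.app_emb_cl]

theorem lcl_append_cons {X U V Y : A.Ob} (L : List (A.Str X U)) (x : A.hom U V)
    (L' : List (A.Str V Y)) :
    lcl (L.flatMap fun u => L'.map fun w => u.append (.cons x w)) =
      T.app X U Y (lcl L) (T.app U V Y (T.emb U V x) (lcl L')) := by
  have h (u : A.Str X U) : lcl (L'.map fun w => u.append (.cons x w)) =
      T.app X U Y u.cl (T.app U V Y (T.emb U V x) (lcl L')) := by
    induction L' with
    | nil => simp [lcl]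
    | cons c L' ih =>
      rw [List.map_cons, lcl_cons, ih, lcl_cons, map_add, map_add, T.app_emb_cl, T.app_cl]
  induction L with
  | nil => simp [lcl]
  | cons u L ih => rw [List.flatMap_cons, lcl_append, ih, h, lcl_cons, map_add, LinearMap.add_apply]

/-- The dictionary between formal sums and ⋆-words: the Koszul twist on the right part is absorbed
into Ψ'. -/
theorem lcl_sandwich {f' g' : A.Ob → C.Ob} {Φ : StrMap A C f f'} {Φ' : LMap A C f f'}
    (hΦ : ∀ X Y (s : A.Str X Y), lcl (Φ s) = Φ' X Y s.cl) (e : ℤ) {φ : StrFun A C f' g'}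
    {φ' : Comp A C f' g'} (hφ : ∀ X Y (s : A.Str X Y), φ s = φ' X Y s.cl) {Ψ : StrMap A C g' g}
    {Ψ' : LMap A C g' g} (hΨ : ∀ X Y (s : A.Str X Y), lcl (Ψ (s.twist e)) = Ψ' X Y s.cl)
    {X Y : A.Ob} (s : A.Str X Y) :
    lcl (sandwich Φ e φ Ψ s) = (Φ' ⋆ φ'.up ⋆ Ψ') X Y s.cl := by
  rw [sandwich, lcl_flatMap]
  simp only [conv_cl, Comp.up_apply, Str.csum]
  congr 1
  refine List.map_congr_left fun c _ => ?_
  rw [lcl_flatMap, map_list_sum, List.map_map]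
  congr 1
  refine List.map_congr_left fun c' _ => ?_
  rw [Function.comp_apply]
  rw [lcl_append_cons, hΦ, hφ, hΨ]

theorem StrMap.then_eq {C D : GrQuiver k} {f g : A.Ob → C.Ob} {h l : C.Ob → D.Ob} (Φ : StrMap A C f g)
    (φ : Family C D h l) {X Y : A.Ob} (s : A.Str X Y) :
    Φ.then φ.val s = φ.lin _ _ (lcl (Φ s)) := by
  rw [StrMap.then, lcl, map_list_sum, List.map_map]
  simp [Function.comp_def]

theorem lcl_idStr {X Y : A.Ob} (s : A.Str X Y) : lcl (idStr A s) = E A X Y s.cl := by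
  simp [lcl, idStr, E]

theorem lcl_idStr_twist {e : ℤ} (he : Odd e) {X Y : A.Ob} (s : A.Str X Y) :
    lcl (idStr A (s.twist e)) = K A X Y s.cl := by
  simp [lcl, idStr, Str.twist_odd he]

/-- The first block consists of u and a prefix of s; the rest is decomposed independently. -/
theorem lcl_functorStrAux {φ : StrFun A C f f} {X Y Z : A.Ob} (u : A.Str X Y) (s : A.Str Y Z) :
    lcl (functorStrAux φ u s) = s.csum fun W s₁ s₂ =>
      T.app (f X) (f W) (f Z) (T.emb _ _ (φ (u.append s₁))) (lcl (functorStr φ s₂)) := by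
  induction s with
  | nil Y => simp [functorStrAux, functorStr, lcl, T.emb_apply]
  | cons x s ih =>
    rw [functorStrAux, lcl_append, lcl_map_cons, ih (u.append (.cons x (.nil _))), Str.csum_cons,
      Str.append_nil]
    simp only [Str.append_assoc, Str.cons_append, Str.nil_append]
    rfl

theorem lcl_functorStr {φ : Comp A C f f} {φ' : StrFun A C f f}
    (hφ' : ∀ X Y (s : A.Str X Y), φ' s = φ X Y s.cl)
    (hφ : ∀ X, φ X X (Str.nil X).cl = 0) {X Y : A.Ob} (s : A.Str X Y) :
    lcl (functorStr φ' s) = LMap.one f X Y s.cl + s.csum fun W u v =>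
      T.app (f X) (f W) (f Y) (φ.up X W u.cl) (lcl (functorStr φ' v)) := by
  cases s with
  | nil X => simp [functorStr, lcl, Comp.up_apply, hφ]
  | cons x s =>
    rw [functorStr, lcl_functorStrAux, Str.csum_cons, LMap.one_cons, zero_add, Comp.up_apply, hφ]
    simp [hφ', Comp.up_apply]

/-- Partial sums of the geometric series. -/
noncomputable def geomTrunc (φ : Comp A C f f) : ℕ → LMap A C f f
  | 0 => 0
  | n + 1 => LMap.one f + φ.up ⋆ geomTrunc φ n

/-- Each further factor φ needs a non-empty block, so on strings of length less than n the truncated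
series is already complete. -/
theorem geomTrunc_cl {φ : Comp A C f f} {φ' : StrFun A C f f}
    (hφ' : ∀ X Y (s : A.Str X Y), φ' s = φ X Y s.cl)
    (hφ : ∀ X, φ X X (Str.nil X).cl = 0) (n : ℕ) {X Y : A.Ob} (s : A.Str X Y) (hs : s.length < n) :
    geomTrunc φ n X Y s.cl = lcl (functorStr φ' s) := by
  induction n generalizing X Y s with
  | zero => omega
  | succ n ih =>
    rw [lcl_functorStr hφ' hφ, geomTrunc, Pi.add_apply, Pi.add_apply, LinearMap.add_apply, conv_cl]
    congr 1
    refine Str.csum_congr fun W u v huv => ?_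
    cases u with
    | nil => simp [Comp.up_apply, hφ]
    | cons x u => rw [ih v (by simp only [Str.length_cons] at huv; omega)]

/-- The truncations are linear by construction, and all strings in one multilinearity relation have
the same length, so one truncation computes them all. -/
theorem isMulti_functorStr {φ : Comp A C f f} {φ' : StrFun A C f f}
    (hφ' : ∀ X Y (s : A.Str X Y), φ' s = φ X Y s.cl)
    (hφ : ∀ X, φ X X (Str.nil X).cl = 0) {X Y : A.Ob} :
    IsMulti fun s : A.Str X Y => lcl (functorStr φ' s) := by
  intro U V u w
  have h (x : A.hom U V) : lcl (functorStr φ' (u.append (.cons x w))) =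
      geomTrunc φ (u.length + (w.length + 1) + 1) X Y (u.append (.cons x w)).cl :=
    (geomTrunc_cl hφ' hφ _ _ (by simp)).symm
  simp only [h]
  exact IsMulti.of_linear (geomTrunc φ (u.length + (w.length + 1) + 1) X Y) u w

end Bridge

/-! ### Translation of A∞-categories, functors and coderivations into linear maps -/

section Cat

variable {k : Type u} [CommRing k] {A C : AInfCat k} {f g h : A.Ob → C.Ob}

/-- The components of the differential of an `A∞`-category. -/
noncomputable def AInfCat.bc (A : AInfCat k) :
    Comp A.toGrQuiver A.toGrQuiver (fun X => X) (fun X => X) := A.b.lin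

theorem lcl_sandwich_id {e : ℤ} (he : Odd e)
    (φ : Family A.toGrQuiver A.toGrQuiver (fun X => X) (fun X => X)) {X Y : A.Ob} (s : A.Str X Y) :
    lcl (sandwich (idStr A.toGrQuiver) e φ.val (idStr A.toGrQuiver) s) = hat φ.lin X Y s.cl :=
  lcl_sandwich (fun _ _ s => lcl_idStr s) e (fun _ _ s => (φ.lin_cl s).symm)
    (fun _ _ s => lcl_idStr_twist he s) s

theorem AInfCat.lcl_bStr (A : AInfCat k) {X Y : A.Ob} (s : A.Str X Y) :
    lcl (A.bStr s) = hat A.bc X Y s.cl :=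
  lcl_sandwich_id odd_one A.b s

theorem AInfCat.hasDeg_bc (A : AInfCat k) : A.bc.HasDeg 1 := A.b_degree.lin

theorem AInfCat.isDiff_bc (A : AInfCat k) : IsDiff A.bc where
  odd := A.hasDeg_bc.isOdd odd_one
  sq := Comp.ext_cl fun X Y s => by
    have := A.b_b s
    rw [StrMap.then_eq, lcl_sandwich_id odd_one] at this
    exact this

theorem AInfCat.bc_nil (A : AInfCat k) (X : A.Ob) : A.bc X X (Str.nil X).cl = 0 := by
  rw [AInfCat.bc, Family.lin_cl]
  exact LinearMap.congr_fun (A.b_zero X) _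

/-- The components of an `A∞`-functor. -/
noncomputable def AInfFunctor.cp (F : AInfFunctor A C) :
    Comp A.toGrQuiver C.toGrQuiver F.obj F.obj := F.comp.lin

theorem AInfFunctor.cp_nil (F : AInfFunctor A C) (X : A.Ob) :
    F.cp X X (Str.nil X).cl = 0 := by
  rw [AInfFunctor.cp, Family.lin_cl]
  exact LinearMap.congr_fun (F.comp_zero X) _

theorem AInfFunctor.isMulti_str (F : AInfFunctor A C) {X Y : A.Ob} :
    IsMulti fun s : A.Str X Y => lcl (F.str s) :=
  isMulti_functorStr (φ := F.cp) (fun _ _ s => (F.comp.lin_cl s).symm) F.cp_nil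

/-- The linear map `TsA → TsC` of an `A∞`-functor. -/
noncomputable def AInfFunctor.lm (F : AInfFunctor A C) :
    LMap A.toGrQuiver C.toGrQuiver F.obj F.obj := fun _ _ =>
  T.lift (fun s => lcl (F.str s)) F.isMulti_str

theorem AInfFunctor.lcl_str (F : AInfFunctor A C) {X Y : A.Ob} (s : A.Str X Y) :
    lcl (F.str s) = F.lm X Y s.cl := by
  rw [AInfFunctor.lm, T.lift_cl]

/-- Splitting off the first block of a decomposition gives the geometric recursion; grouplikeness,
parity and degree of the functor all follow from it. -/
theorem AInfFunctor.isGeom (F : AInfFunctor A C) : IsGeom F.cp F.lm :=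
  LMap.ext_cl fun X Y s => by
    rw [← F.lcl_str, AInfFunctor.str,
      lcl_functorStr (φ := F.cp) (fun _ _ s => (F.comp.lin_cl s).symm) F.cp_nil]
    simp only [Pi.add_apply, LinearMap.add_apply, conv_cl, ← F.lcl_str, AInfFunctor.str]

theorem AInfFunctor.cp_pre_hat (F : AInfFunctor A C) :
    F.cp.pre (hat A.bc) = F.lm.toComp C.bc := Comp.ext_cl fun X Y s => by
  have := F.comp_b s
  rw [StrMap.then_eq, StrMap.then_eq, A.lcl_bStr] at this
  rw [LMap.toComp_apply, ← F.lcl_str]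
  exact this.symm

theorem AInfFunctor.isHom (F : AInfFunctor A C) : IsHom A.bc C.bc F.lm where
  grouplike := F.isGeom.grouplike F.cp_nil
  even := F.isGeom.even F.cp_nil (F.comp_degree.lin.isEven Even.zero)
  comm := by
    rw [F.isGeom.pre_hat F.cp_nil]
    rw [F.cp_pre_hat]

theorem AInfFunctor.hasDeg (F : AInfFunctor A C) : F.lm.HasDeg 0 :=
  F.isGeom.hasDeg F.cp_nil F.comp_degree.lin

theorem lcl_coderStr_even (F : AInfFunctor A C) (G : AInfFunctor A C) {e : ℤ} (he : Even e)
    (r : Coder A C F.obj G.obj e) {X Y : A.Ob} (s : A.Str X Y) :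
    lcl (coderStr F.str r G.str s) = (F.lm ⋆ r.comp.lin.up ⋆ G.lm) X Y s.cl :=
  lcl_sandwich (fun _ _ s => F.lcl_str s) e (fun _ _ s => (r.comp.lin_cl s).symm)
    (fun _ _ s => by rw [Str.twist_even he, G.lcl_str]) s

theorem lcl_coderStr_odd (F : AInfFunctor A C) (G : AInfFunctor A C) {e : ℤ} (he : Odd e)
    (r : Coder A C F.obj G.obj e) {X Y : A.Ob} (s : A.Str X Y) :
    lcl (coderStr F.str r G.str s) = (F.lm ⋆ r.comp.lin.up ⋆ G.lm.pre (K A.toGrQuiver)) X Y s.cl :=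
  lcl_sandwich (fun _ _ s => F.lcl_str s) e (fun _ _ s => (r.comp.lin_cl s).symm)
    (fun _ _ s => by rw [Str.twist_odd he, G.lcl_str, LMap.pre_apply, K_cl]) s

theorem B₁_even (F : AInfFunctor A C) (G : AInfFunctor A C) {e : ℤ} (he : Even e)
    (r : Coder A C F.obj G.obj e) {X Y : A.Ob} (s : A.Str X Y) :
    B₁ F.str r G.str s = B₁e A.bc C.bc F.lm r.comp.lin G.lm X Y s.cl := by
  rw [B₁, StrMap.then_eq, StrMap.then_eq, lcl_coderStr_even F G he, A.lcl_bStr,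
    Int.negOnePow_even e he, one_smul]
  rfl

theorem B₁_odd (F : AInfFunctor A C) (G : AInfFunctor A C) {e : ℤ} (he : Odd e)
    (r : Coder A C F.obj G.obj e) {X Y : A.Ob} (s : A.Str X Y) :
    B₁ F.str r G.str s = B₁o A.bc C.bc F.lm r.comp.lin G.lm X Y s.cl := by
  rw [B₁, StrMap.then_eq, StrMap.then_eq, lcl_coderStr_odd F G he, A.lcl_bStr,
    Int.negOnePow_odd e he, Units.neg_smul, one_smul, sub_neg_eq_add]
  rfl

theorem functorThenUnit_eq (F : AInfFunctor A C) (i : Coder C C (fun X => X) (fun X => X) (-1))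
    {X Y : A.Ob} (s : A.Str X Y) :
    functorThenUnit F i s = F.lm.toComp i.comp.lin X Y s.cl := by
  rw [functorThenUnit, StrMap.then_eq, F.lcl_str]
  rfl

theorem unitThenFunctor_eq (F : AInfFunctor A C) (i : Coder A A (fun X => X) (fun X => X) (-1))
    {X Y : A.Ob} (s : A.Str X Y) :
    unitThenFunctor i F s = F.cp.pre (hat i.comp.lin) X Y s.cl := by
  rw [unitThenFunctor, StrMap.then_eq, coderStr, lcl_sandwich_id (by decide)]
  rfl

theorem IsNatural.hat_toComp {i : Coder A A (fun X => X) (fun X => X) (-1)}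
    (hi : IsNatural (idStr A.toGrQuiver) i (idStr A.toGrQuiver)) :
    (hat i.comp.lin).toComp A.bc + (hat A.bc).toComp i.comp.lin = 0 :=
  Comp.ext_cl fun X Y s => by
    have := hi s
    rw [B₁, StrMap.then_eq, StrMap.then_eq, coderStr, lcl_sandwich_id (by decide), A.lcl_bStr,
      Int.negOnePow_odd (-1) (by decide), Units.neg_smul, one_smul, sub_neg_eq_add] at this
    exact this

end Cat

end AInf

/-! ### The filtration by string length -/

namespace AInf

open GrQuiver

section Vanish

variable {k : Type u} [CommRing k] {A C : GrQuiver k} {f g h l : A.Ob → C.Ob}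

/-- The number of steps of a sequence of objects. -/
def GrQuiver.Seq.length : ∀ {X Y : A.Ob}, A.Seq X Y → ℕ
  | _, _, .nil _ => 0
  | _, _, .cons _ p => p.length + 1

theorem GrQuiver.Str.length_seq {X Y : A.Ob} (s : A.Str X Y) : s.seq.length = s.length := by
  induction s with
  | nil X => rfl
  | cons x s ih => simp only [Str.seq, Seq.length, ih, Str.length_cons]

/-- Pure tensors span. The maps are taken on all sequences so that a string whose sequence is p can
be substituted without transport. -/
theorem ten_hom_ext {M : Type*} [AddCommGroup M] [Module k M] {X Y : A.Ob} (p : A.Seq X Y)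
    (φ ψ : ∀ q : A.Seq X Y, Ten q →ₗ[k] M)
    (H : ∀ s : A.Str X Y, s.seq = p → φ s.seq s.ten = ψ s.seq s.ten) : φ p = ψ p := by
  induction p with
  | nil X => exact LinearMap.ext_ring (H (.nil X) rfl)
  | cons X p ih =>
    refine TensorProduct.ext' fun x z => ?_
    have := ih (fun q => (φ (.cons X q) : A.hom X _ ⊗[k] Ten q →ₗ[k] M) ∘ₗ TensorProduct.mk k _ (Ten q) x)
      (fun q => (ψ (.cons X q) : A.hom X _ ⊗[k] Ten q →ₗ[k] M) ∘ₗ TensorProduct.mk k _ (Ten q) x)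
      (fun s hs => H (.cons x s) (congrArg (Seq.cons X) hs))
    exact LinearMap.congr_fun this z

theorem Family.fam_lin (φ : Family A C f g) : φ.lin.fam = φ := by
  funext X Y p
  exact ten_hom_ext p _ _ fun s _ => by
    rw [Comp.fam, LinearMap.comp_apply, tenIncl_ten, Family.lin_cl, Family.val]

/-- The components vanish on strings of length less than `n`. -/
def GrQuiver.Comp.VanishBelow (r : Comp A C f g) (n : ℕ) : Prop :=
  ∀ ⦃X Y : A.Ob⦄ (s : A.Str X Y), s.length < n → r X Y s.cl = 0

theorem GrQuiver.Comp.VanishBelow.mono {r : Comp A C f g} {m n : ℕ} (hr : r.VanishBelow n)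
    (h : m ≤ n) : r.VanishBelow m := fun _ _ s hs => hr s (hs.trans_le h)

theorem GrQuiver.Comp.VanishBelow.add {r p : Comp A C f g} {n : ℕ} (hr : r.VanishBelow n)
    (hp : p.VanishBelow n) : (r + p).VanishBelow n := fun _ _ s hs => by
  rw [Pi.add_apply, Pi.add_apply, LinearMap.add_apply, hr s hs, hp s hs, add_zero]

theorem GrQuiver.Comp.VanishBelow.sub {r p : Comp A C f g} {n : ℕ} (hr : r.VanishBelow n)
    (hp : p.VanishBelow n) : (r - p).VanishBelow n := fun _ _ s hs => by
  rw [Pi.sub_apply, Pi.sub_apply, LinearMap.sub_apply, hr s hs, hp s hs, sub_zero]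

theorem GrQuiver.Comp.VanishBelow.fam_eq_zero {r : Comp A C f g} {n : ℕ} (hr : r.VanishBelow n)
    {X Y : A.Ob} (p : A.Seq X Y) (hp : p.length < n) : r.fam p = 0 :=
  ten_hom_ext p (fun q => r.fam q) (fun _ => 0) fun s hs => by
    subst hs
    rw [Comp.fam, LinearMap.comp_apply, tenIncl_ten, LinearMap.zero_apply]
    exact hr s (by rwa [← s.length_seq])

theorem GrQuiver.Comp.fam_ten (r : Comp A C f g) {X Y : A.Ob} (s : A.Str X Y) :
    r.fam s.seq s.ten = r X Y s.cl := by
  rw [Comp.fam, LinearMap.comp_apply, tenIncl_ten]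

theorem conv_eq_right {Φ : LMap A C f g} {Ψ : LMap A C g h} {X Y : A.Ob} (s : A.Str X Y)
    (hΨ : ∀ ⦃X Y : A.Ob⦄ (t : A.Str X Y), t.length < s.length → Ψ X Y t.cl = 0) :
    (Φ ⋆ Ψ) X Y s.cl = T.app _ _ _ (Φ X X (Str.nil X).cl) (Ψ X Y s.cl) := by
  rw [conv_cl]
  exact Str.csum_eq_right fun W u v _ hv => by rw [hΨ v hv, map_zero]

theorem conv_eq_left {Φ : LMap A C f g} {Ψ : LMap A C g h} {X Y : A.Ob} (s : A.Str X Y)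
    (hΦ : ∀ ⦃X Y : A.Ob⦄ (t : A.Str X Y), t.length < s.length → Φ X Y t.cl = 0) :
    (Φ ⋆ Ψ) X Y s.cl = T.app _ _ _ (Φ X Y s.cl) (Ψ Y Y (Str.nil Y).cl) := by
  rw [conv_cl]
  exact Str.csum_eq_left fun W u v _ hu => by rw [hΦ u hu, map_zero, LinearMap.zero_apply]

/-- Only the cut that gives r the whole string survives, and F and G send the empty remainders to
empty strings. -/
theorem cod_eq_of_vanishBelow {F : LMap A C f f} {G : LMap A C g g} (hF : ∀ X, F X X (Str.nil X).cl = (Str.nil (f X)).cl)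
    (hG : ∀ X, G X X (Str.nil X).cl = (Str.nil (g X)).cl) {r : Comp A C f g} {X Y : A.Ob}
    (s : A.Str X Y) (hr : r.VanishBelow s.length) :
    (F ⋆ r.up ⋆ G) X Y s.cl = T.emb _ _ (r X Y s.cl) := by
  have hup : ∀ ⦃X Y : A.Ob⦄ (t : A.Str X Y), t.length < s.length → r.up X Y t.cl = 0 :=
    fun X Y t ht => by rw [Comp.up_apply, hr t ht, map_zero]
  rw [conv_eq_right s, conv_eq_left s hup, hF, hG, T.nil_app, T.app_nil, Comp.up_apply]
  intro X' Y' t ht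
  rw [conv_eq_left t fun X Y t' ht' => hup t' (ht'.trans ht), hup t ht, map_zero,
    LinearMap.zero_apply]

end Vanish

/-! ### Leading components of B₁ and B₂ -/

section Lowest

variable {k : Type u} [CommRing k] {A C : AInfCat k} {f g : AInfFunctor A C}

theorem tenIncl_tenKoszul {X Y : A.Ob} (s : A.Str X Y) :
    tenIncl s.seq (tenKoszul 1 s.seq s.ten) = (s.twist 1).cl := by
  induction s with
  | nil X => exact one_smul k _
  | cons x s ih =>
    refine (tenIncl_tmul _ (A.koszul 1 _ _ x) (tenKoszul 1 s.seq s.ten)).trans ?_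
    rw [ih, T.app_emb_cl, Str.twist_cons]

theorem AInfCat.bc_emb {X Y : A.Ob} (x : A.hom X Y) : A.bc X Y (T.emb X Y x) = A.b₁ X Y x := by
  rw [T.emb_apply, AInfCat.bc, Family.lin_cl]
  rfl

theorem AInfCat.bc_emb_emb {X Y Z : A.Ob} (x : A.hom X Y) (y : A.hom Y Z) :
    A.bc X Z (T.app X Y Z (T.emb X Y x) (T.emb Y Z y)) = A.b₂ X Y Z x y := by
  rw [T.emb_apply y, T.app_emb_cl, AInfCat.bc, Family.lin_cl]
  rfl

/-- Operations of arity at least two shorten the string and are killed by ψ, and b₀ = 0. Only the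
b₁-terms are left, and they form the tensor differential. -/
theorem hat_bc_eq {M : Type*} [AddCommGroup M] [Module k M] {X Y : A.Ob} (s : A.Str X Y)
    (ψ : A.T X Y →ₗ[k] M) (hψ : ∀ t : A.Str X Y, t.length < s.length → ψ t.cl = 0) :
    ψ (hat A.bc X Y s.cl) = ψ (tenIncl s.seq (A.tenD s.seq s.ten)) := by
  induction s with
  | nil X =>
    have : tenIncl (Str.nil X).seq (A.tenD (Str.nil X).seq (Str.nil X).ten) = 0 := zero_smul k _
    rw [this, hat, conv_cl, Str.csum_nil, conv_cl, Str.csum_nil, Comp.up_apply, A.bc_nil]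
    simp
  | @cons X Y Z x s ih =>
    have h₁ : hat A.bc X Z (Str.cons x s).cl =
        (A.bc.up ⋆ K A.toGrQuiver) X Z (Str.cons x s).cl +
          T.app X Y Z (T.emb X Y x) (hat A.bc Y Z s.cl) := by
      rw [hat, conv_cl, Str.csum_cons, conv_cl (E A.toGrQuiver), Str.map_csum]
      congr 1
      · exact T.nil_app _
      · refine Str.csum_congr fun W u v _ => ?_
        simp only [E, LinearMap.id_apply]
        rw [← T.app_assoc, T.app_emb_cl]
    have h₂ : ψ ((A.bc.up ⋆ K A.toGrQuiver) X Z (Str.cons x s).cl) =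
        ψ (T.app X Y Z (T.emb X Y (A.b₁ X Y x)) (s.twist 1).cl) := by
      rw [conv_cl, Str.csum_cons, Comp.up_apply, A.bc_nil, map_zero, map_zero, LinearMap.zero_apply,
        zero_add, Str.map_csum, Str.csum_eq_right]
      · rw [K_cl, Comp.up_apply, ← AInfCat.bc_emb]; rfl
      · intro W u v _ hv
        rw [K_cl, Comp.up_apply, T.app_emb_cl]
        exact hψ _ (by simpa using hv)
    have h₃ : tenIncl (Str.cons x s).seq (A.tenD (Str.cons x s).seq (Str.cons x s).ten) =
        T.app X Y Z (T.emb X Y x) (tenIncl s.seq (A.tenD s.seq s.ten)) +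
          T.app X Y Z (T.emb X Y (A.b₁ X Y x)) (tenIncl s.seq (tenKoszul 1 s.seq s.ten)) := by
      refine Eq.trans ?_ (congrArg₂ (· + ·) (tenIncl_tmul s.seq x (A.tenD s.seq s.ten))
        (tenIncl_tmul s.seq (A.b₁ X Y x) (tenKoszul 1 s.seq s.ten)))
      exact map_add (tenIncl (Seq.cons X s.seq)) _ _
    have h₄ := ih (ψ ∘ₗ T.app X Y Z (T.emb X Y x)) fun t ht => by
      rw [LinearMap.comp_apply, T.app_emb_cl]
      exact hψ _ (by simpa using ht)
    simp only [LinearMap.comp_apply] at h₄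
    rw [h₁, h₃, map_add, map_add, h₂, h₄, tenIncl_tenKoszul, add_comm]

theorem AInfFunctor.lm_nil (f : AInfFunctor A C) (X : A.Ob) :
    f.lm X X (Str.nil X).cl = (Str.nil (f.obj X)).cl := f.isGeom.apply_nil f.cp_nil X

theorem AInfFunctor.lm_pre_K_nil (f : AInfFunctor A C) (X : A.Ob) :
    f.lm.pre (K A.toGrQuiver) X X (Str.nil X).cl = (Str.nil (f.obj X)).cl := by
  rw [LMap.pre_apply, K_cl, Str.twist_nil, f.lm_nil]

variable {r : Comp A.toGrQuiver C.toGrQuiver f.obj g.obj}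

/-- On the shortest strings where p may be non-zero, b can act on its value only by b₁ and under it
only by the tensor differential. Hence the associated graded complex is made of the complexes Hom(N,
sC). -/
theorem B₁e_lowest {p : Comp A.toGrQuiver C.toGrQuiver f.obj g.obj} {d : ℤ} (hd : Even d) {X Y : A.Ob}
    (s : A.Str X Y) (hp : p.VanishBelow s.length) :
    B₁e A.bc C.bc f.lm p g.lm X Y s.cl =
      homD s.seq C (f.obj X) (g.obj Y) d (p.fam s.seq) s.ten := by
  have h₁ : (f.lm ⋆ p.up ⋆ g.lm) X Y s.cl = T.emb _ _ (p X Y s.cl) :=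
    cod_eq_of_vanishBelow f.lm_nil g.lm_nil s hp
  have h₂ := hat_bc_eq s (p X Y) fun t ht => hp t ht
  have h₃ : homD s.seq C (f.obj X) (g.obj Y) d (p.fam s.seq) s.ten =
      C.b₁ _ _ (p.fam s.seq s.ten) - d.negOnePow • p.fam s.seq (A.tenD s.seq s.ten) := rfl
  rw [h₃, Int.negOnePow_even d hd, one_smul, Comp.fam_ten]
  simp only [B₁e, Pi.sub_apply, LinearMap.sub_apply]
  rw [LMap.toComp_apply, Comp.pre_apply, h₁, AInfCat.bc_emb, h₂]
  rfl

theorem B₁o_lowest {p : Comp A.toGrQuiver C.toGrQuiver f.obj g.obj} {d : ℤ} (hd : Odd d) {X Y : A.Ob}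
    (s : A.Str X Y) (hp : p.VanishBelow s.length) :
    B₁o A.bc C.bc f.lm p g.lm X Y s.cl =
      homD s.seq C (f.obj X) (g.obj Y) d (p.fam s.seq) s.ten := by
  have h₁ : (f.lm ⋆ p.up ⋆ g.lm.pre (K A.toGrQuiver)) X Y s.cl = T.emb _ _ (p X Y s.cl) :=
    cod_eq_of_vanishBelow f.lm_nil g.lm_pre_K_nil s hp
  have h₂ := hat_bc_eq s (p X Y) fun t ht => hp t ht
  have h₃ : homD s.seq C (f.obj X) (g.obj Y) d (p.fam s.seq) s.ten =
      C.b₁ _ _ (p.fam s.seq s.ten) - d.negOnePow • p.fam s.seq (A.tenD s.seq s.ten) := rfl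
  rw [h₃, Int.negOnePow_odd d hd, Units.neg_smul, one_smul, Comp.fam_ten, sub_neg_eq_add]
  simp only [B₁o, Pi.add_apply, LinearMap.add_apply]
  rw [LMap.toComp_apply, Comp.pre_apply, h₁, AInfCat.bc_emb, h₂]
  rfl

/-- The entry p must take the whole string, leaving the empty string to r, so only r₀ and b₂ occur.
The right factor G is general in order to serve both parities of p. -/
theorem B₂_lowest {p : Comp A.toGrQuiver C.toGrQuiver g.obj g.obj} {G : LMap A.toGrQuiver C.toGrQuiver g.obj g.obj}
    (hG : ∀ X, G X X (Str.nil X).cl = (Str.nil (g.obj X)).cl) {X Y : A.Ob}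
    (s : A.Str X Y) (hp : p.VanishBelow s.length) :
    (f.lm ⋆ r.up ⋆ (g.lm ⋆ p.up ⋆ G).pre (K A.toGrQuiver)).toComp C.bc X Y s.cl =
      C.b₂ _ _ _ (r X X (Str.nil X).cl) (p X Y (K A.toGrQuiver X Y s.cl)) := by
  have h (X Y : A.Ob) (t : A.Str X Y) (ht : p.VanishBelow t.length) :
      (g.lm ⋆ p.up ⋆ G).pre (K A.toGrQuiver) X Y t.cl =
        T.emb _ _ (p X Y (K A.toGrQuiver X Y t.cl)) := by
    rw [LMap.pre_apply, K_cl]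
    exact cod_eq_of_vanishBelow g.lm_nil hG _ (by rwa [Str.length_twist])
  rw [LMap.toComp_apply, ← conv_assoc, conv_eq_right s, h X Y s hp, conv_cl, Str.csum_nil, f.lm_nil,
    T.nil_app, Comp.up_apply, AInfCat.bc_emb_emb]
  intro X' Y' t ht
  rw [h _ _ t (hp.mono ht.le), K_cl, hp _ (by rwa [Str.length_twist]), map_zero]

theorem leftMul_apply {X Y : C.Ob} (a : C.hom X Y) {Z : C.Ob} (z : C.hom Y Z) :
    C.leftMul a Z z = C.b₂ X Y Z a (C.koszul 1 Y Z z) := by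
  rw [AInfCat.leftMul, LinearMap.comp_apply, koszul_odd (by decide)]

theorem B₂oe_lowest {p : Comp A.toGrQuiver C.toGrQuiver g.obj g.obj} (hp' : p.IsEven) {X Y : A.Ob}
    (s : A.Str X Y) (hp : p.VanishBelow s.length) :
    B₂oe C.bc f.lm r g.lm p g.lm X Y s.cl =
      C.leftMul (r X X (Str.nil X).cl) _ (p.fam s.seq s.ten) := by
  rw [B₂oe, B₂_lowest g.lm_nil s hp, leftMul_apply, Comp.fam_ten, hp']

/-- The minus sign arises when the Koszul operator is moved from the argument of the odd p to its
value, where `leftMul` expects it. -/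
theorem B₂oo_lowest {p : Comp A.toGrQuiver C.toGrQuiver g.obj g.obj} (hp' : p.IsOdd) {X Y : A.Ob}
    (s : A.Str X Y) (hp : p.VanishBelow s.length) :
    B₂oo C.bc f.lm r g.lm p g.lm X Y s.cl =
      -C.leftMul (r X X (Str.nil X).cl) _ (p.fam s.seq s.ten) := by
  rw [B₂oo, B₂_lowest g.lm_pre_K_nil s hp, leftMul_apply, Comp.fam_ten, hp', map_neg, neg_neg]

end Lowest

end AInf

/-! ### Additivity of B₁ and B₂ -/

namespace AInf

open GrQuiver

namespace GrQuiver

section Additive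

variable {k : Type u} [CommRing k] {A C : GrQuiver k} {f g h : A.Ob → C.Ob}
  (a : Comp A A (fun X => X) (fun X => X)) (b : Comp C C (fun X => X) (fun X => X))
  (F : LMap A C f f) (G : LMap A C g g) (H : LMap A C h h)

theorem B₁e_add (r p : Comp A C f g) : B₁e a b F (r + p) G = B₁e a b F r G + B₁e a b F p G := by
  simp only [B₁e, Comp.up_add, conv_add, add_conv, LMap.toComp_add, Comp.pre_add]
  abel

theorem B₁e_sub (r p : Comp A C f g) : B₁e a b F (r - p) G = B₁e a b F r G - B₁e a b F p G := by
  simp only [B₁e, Comp.up_sub, conv_sub, sub_conv, LMap.toComp_sub, Comp.pre_sub]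
  abel

theorem B₁o_add (r p : Comp A C f g) : B₁o a b F (r + p) G = B₁o a b F r G + B₁o a b F p G := by
  simp only [B₁o, Comp.up_add, conv_add, add_conv, LMap.toComp_add, Comp.pre_add]
  abel

theorem B₁o_sub (r p : Comp A C f g) : B₁o a b F (r - p) G = B₁o a b F r G - B₁o a b F p G := by
  simp only [B₁o, Comp.up_sub, conv_sub, sub_conv, LMap.toComp_sub, Comp.pre_sub]
  abel

theorem B₂oe_add (r : Comp A C f g) (p q : Comp A C g h) :
    B₂oe b F r G (p + q) H = B₂oe b F r G p H + B₂oe b F r G q H := by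
  simp only [B₂oe, Comp.up_add, conv_add, add_conv, LMap.toComp_add, LMap.pre_add]

theorem B₂oe_sub (r : Comp A C f g) (p q : Comp A C g h) :
    B₂oe b F r G (p - q) H = B₂oe b F r G p H - B₂oe b F r G q H := by
  simp only [B₂oe, Comp.up_sub, conv_sub, sub_conv, LMap.toComp_sub, LMap.pre_sub]

theorem B₂oo_sub (r : Comp A C f g) (p q : Comp A C g h) :
    B₂oo b F r G (p - q) H = B₂oo b F r G p H - B₂oo b F r G q H := by
  simp only [B₂oo, Comp.up_sub, conv_sub, sub_conv, LMap.toComp_sub, LMap.pre_sub]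

theorem B₂oo_sub_left (r r' : Comp A C f g) (p : Comp A C g h) :
    B₂oo b F (r - r') G p H = B₂oo b F r G p H - B₂oo b F r' G p H := by
  simp only [B₂oo, Comp.up_sub, conv_sub, sub_conv, LMap.toComp_sub]

end Additive

end GrQuiver

/-! ### Solving the cone equations length by length -/

section Step

variable {k : Type u} [CommRing k] {A C : AInfCat k} {f g : AInfFunctor A C}

/-- Solutions chosen on sequences of length n and extended by zero to all other lengths; the result
is a correction term concentrated in one length. -/
theorem HomDeg.exists_comp {f g : A.Ob → C.Ob} (n : ℕ) (e : ℤ)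
    (Q : ∀ ⦃X Y : A.Ob⦄ (p : A.Seq X Y), (Ten p →ₗ[k] C.hom (f X) (g Y)) → Prop)
    (hQ : ∀ ⦃X Y : A.Ob⦄ (p : A.Seq X Y), p.length = n → ∃ φ ∈ HomDeg p C (f X) (g Y) e, Q p φ) :
    ∃ w : Comp A.toGrQuiver C.toGrQuiver f g, w.HasDeg e ∧ w.VanishBelow n ∧
      ∀ ⦃X Y : A.Ob⦄ (p : A.Seq X Y), p.length = n → Q p (w.fam p) := by
  have : ∀ (X Y : A.Ob) (p : A.Seq X Y), ∃ φ ∈ HomDeg p C (f X) (g Y) e,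
      (p.length = n → Q p φ) ∧ (p.length ≠ n → φ = 0) := by
    intro X Y p
    by_cases hp : p.length = n
    · obtain ⟨φ, h₁, h₂⟩ := hQ p hp
      exact ⟨φ, h₁, fun _ => h₂, fun h => absurd hp h⟩
    · exact ⟨0, Submodule.zero_mem _, fun h => absurd h hp, fun _ => rfl⟩
  choose φ hdeg hφ hφ₀ using this
  let Φ : Family A.toGrQuiver C.toGrQuiver f g := fun X Y p => φ X Y p
  refine ⟨Φ.lin, ?_, ?_, ?_⟩
  · exact Family.HasDegree.lin fun X Y p d z hz => hdeg X Y p d z hz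
  · intro X Y s hs
    rw [Family.lin_cl]
    have : φ X Y s.seq = 0 := hφ₀ _ _ _ (by rw [s.length_seq]; omega)
    exact LinearMap.congr_fun this s.ten
  · intro X Y p hp
    rw [Family.fam_lin]
    exact hφ X Y p hp

theorem GrQuiver.Comp.HasDeg.fam_mem {f g : A.Ob → C.Ob} {r : Comp A.toGrQuiver C.toGrQuiver f g}
    {e : ℤ} (hr : r.HasDeg e) {X Y : A.Ob} (p : A.Seq X Y) :
    r.fam p ∈ HomDeg p C (f X) (g Y) e := fun d z hz => hr.fam p d z hz

theorem GrQuiver.Comp.VanishBelow.succ {f g : A.Ob → C.Ob} {r : Comp A.toGrQuiver C.toGrQuiver f g}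
    {n : ℕ} (hr : r.VanishBelow n)
    (h : ∀ ⦃X Y : A.Ob⦄ (s : A.Str X Y), s.length = n → r X Y s.cl = 0) : r.VanishBelow (n + 1) :=
  fun X Y s hs => by
    rcases Nat.lt_succ_iff_lt_or_eq.1 hs with h' | h'
    · exact hr s h'
    · exact h s h'

theorem B₁e_vanishBelow {p : Comp A.toGrQuiver C.toGrQuiver f.obj g.obj} {n : ℕ}
    (hp : p.VanishBelow n) : (B₁e A.bc C.bc f.lm p g.lm).VanishBelow n := fun X Y s hs => by
  -- Only the parity of `d` matters here, so any even value would do.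
  rw [B₁e_lowest (d := 0) Even.zero s (hp.mono hs.le),
    hp.fam_eq_zero s.seq (by rwa [s.length_seq]), map_zero, LinearMap.zero_apply]

theorem B₁o_vanishBelow {p : Comp A.toGrQuiver C.toGrQuiver f.obj g.obj} {n : ℕ}
    (hp : p.VanishBelow n) : (B₁o A.bc C.bc f.lm p g.lm).VanishBelow n := fun X Y s hs => by
  rw [B₁o_lowest (d := 1) odd_one s (hp.mono hs.le),
    hp.fam_eq_zero s.seq (by rwa [s.length_seq]), map_zero, LinearMap.zero_apply]

theorem B₂oe_vanishBelow {r : Comp A.toGrQuiver C.toGrQuiver f.obj g.obj}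
    {p : Comp A.toGrQuiver C.toGrQuiver g.obj g.obj} (hp' : p.IsEven) {n : ℕ}
    (hp : p.VanishBelow n) : (B₂oe C.bc f.lm r g.lm p g.lm).VanishBelow n := fun X Y s hs => by
  rw [B₂oe_lowest hp' s (hp.mono hs.le),
    hp.fam_eq_zero s.seq (by rwa [s.length_seq]), LinearMap.zero_apply, map_zero]

theorem B₁e_hasDeg {p : Comp A.toGrQuiver C.toGrQuiver f.obj g.obj} {d d' : ℤ} (hp : p.HasDeg d)
    (hd : d + 1 = d') : (B₁e A.bc C.bc f.lm p g.lm).HasDeg d' :=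
  (LMap.HasDeg.toComp (f.hasDeg.conv (hp.up.conv g.hasDeg (add_zero d)) (zero_add d)) C.hasDeg_bc
    hd).sub (hp.comp A.hasDeg_bc.hat (by omega))

theorem B₁o_hasDeg {p : Comp A.toGrQuiver C.toGrQuiver f.obj g.obj} {d d' : ℤ} (hp : p.HasDeg d)
    (hd : d + 1 = d') : (B₁o A.bc C.bc f.lm p g.lm).HasDeg d' :=
  (LMap.HasDeg.toComp (f.hasDeg.conv (hp.up.conv g.hasDeg.pre_K (add_zero d)) (zero_add d))
    C.hasDeg_bc hd).add (hp.comp A.hasDeg_bc.hat (by omega))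

theorem B₂oe_hasDeg {r : Comp A.toGrQuiver C.toGrQuiver f.obj g.obj} {d e d' : ℤ} (hr : r.HasDeg d)
    {h : AInfFunctor A C} {p : Comp A.toGrQuiver C.toGrQuiver g.obj h.obj} (hp : p.HasDeg e)
    (hd : d + e + 1 = d') : (B₂oe C.bc f.lm r g.lm p h.lm).HasDeg d' :=
  LMap.HasDeg.toComp (f.hasDeg.conv (hr.up.conv
    (g.hasDeg.conv (hp.up.conv h.hasDeg (add_zero e)) (zero_add e)).pre_K rfl) (zero_add _))
    C.hasDeg_bc hd

theorem B₂eo_hasDeg {r : Comp A.toGrQuiver C.toGrQuiver f.obj g.obj} {d e d' : ℤ} (hr : r.HasDeg d)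
    {h : AInfFunctor A C} {p : Comp A.toGrQuiver C.toGrQuiver g.obj h.obj} (hp : p.HasDeg e)
    (hd : d + e + 1 = d') : (B₂eo C.bc f.lm r g.lm p h.lm).HasDeg d' :=
  LMap.HasDeg.toComp (f.hasDeg.conv (hr.up.conv
    (g.hasDeg.conv (hp.up.conv h.hasDeg.pre_K (add_zero e)) (zero_add e)) rfl) (zero_add _))
    C.hasDeg_bc hd

/-- An approximate solution `(v, x)` of `t = vB₁`, `y + (r ⊗ v)B₂ = xB₁`, which is correct on strings of
length less than `n`. -/
structure IsApprox (f g : AInfFunctor A C) (r : Comp A.toGrQuiver C.toGrQuiver f.obj g.obj)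
    (t : Comp A.toGrQuiver C.toGrQuiver g.obj g.obj)
    (y : Comp A.toGrQuiver C.toGrQuiver f.obj g.obj) (n : ℕ)
    (v : Comp A.toGrQuiver C.toGrQuiver g.obj g.obj)
    (x : Comp A.toGrQuiver C.toGrQuiver f.obj g.obj) : Prop where
  hasDeg_v : v.HasDeg (-2)
  hasDeg_x : x.HasDeg (-3)
  left : (t - B₁e A.bc C.bc g.lm v g.lm).VanishBelow n
  right : (y + B₂oe C.bc f.lm r g.lm v g.lm - B₁o A.bc C.bc f.lm x g.lm).VanishBelow n

set_option maxHeartbeats 1600000 in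
-- One step of the acyclicity of the cone. The errors t' and y' form a cycle, so their leading
-- components satisfy the hypotheses of the quasi-isomorphism: first t' is corrected by w through
-- injectivity, then the new y-error by a cycle w₂ and a boundary of z through surjectivity.
theorem IsApprox.step {r : Comp A.toGrQuiver C.toGrQuiver f.obj g.obj} (hr : r.HasDeg (-1))
    (hr' : B₁o A.bc C.bc f.lm r g.lm = 0)
    (H : ResolutionAssumptions f g.obj fun X => r X X (Str.nil X).cl)
    {t : Comp A.toGrQuiver C.toGrQuiver g.obj g.obj} (ht : t.HasDeg (-1))
    (ht' : B₁o A.bc C.bc g.lm t g.lm = 0)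
    {y : Comp A.toGrQuiver C.toGrQuiver f.obj g.obj} (hy : y.HasDeg (-2))
    (hty : B₂oo C.bc f.lm r g.lm t g.lm = B₁e A.bc C.bc f.lm y g.lm) {n : ℕ}
    {v : Comp A.toGrQuiver C.toGrQuiver g.obj g.obj} {x : Comp A.toGrQuiver C.toGrQuiver f.obj g.obj}
    (hvx : IsApprox f g r t y n v x) :
    ∃ v' x', IsApprox f g r t y (n + 1) v' x' ∧ (v' - v).VanishBelow n := by
  have hf := f.isHom
  have hg := g.isHom
  have hA := A.isDiff_bc
  have hC := C.isDiff_bc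
  have e1 : Odd (-1 : ℤ) := by decide
  have e2 : Even (-2 : ℤ) := by decide
  have e3 : Odd (-3 : ℤ) := by decide
  have hrodd := hr.isOdd e1
  -- The error pair satisfies the cone equation for every choice of v and x, as the subtracted terms
  -- are themselves a boundary in the cone.
  have hB {v : Comp A.toGrQuiver C.toGrQuiver g.obj g.obj} (hv : v.HasDeg (-2))
      {x : Comp A.toGrQuiver C.toGrQuiver f.obj g.obj} (hx : x.HasDeg (-3)) :
      B₂oo C.bc f.lm r g.lm (t - B₁e A.bc C.bc g.lm v g.lm) g.lm =
        B₁e A.bc C.bc f.lm (y + B₂oe C.bc f.lm r g.lm v g.lm - B₁o A.bc C.bc f.lm x g.lm) g.lm := by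
    rw [B₂oo_sub, B₁e_sub, B₁e_add, B₁e_B₁o hf hg hA hC (hx.isOdd e3),
      B₁e_B₂oe hf hg hg hA hC hrodd hr' (hv.isEven e2), hty]
    abel
  have hδ {v : Comp A.toGrQuiver C.toGrQuiver g.obj g.obj} (hv : v.HasDeg (-2)) :
      B₁o A.bc C.bc g.lm (t - B₁e A.bc C.bc g.lm v g.lm) g.lm = 0 := by
    rw [B₁o_sub, ht', B₁o_B₁e hg hg hA hC (hv.isEven e2), sub_zero]
  have degt {v : Comp A.toGrQuiver C.toGrQuiver g.obj g.obj} (hv : v.HasDeg (-2)) :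
      (t - B₁e A.bc C.bc g.lm v g.lm).HasDeg (-1) := ht.sub (B₁e_hasDeg hv (by norm_num))
  have degy {v : Comp A.toGrQuiver C.toGrQuiver g.obj g.obj} (hv : v.HasDeg (-2))
      {x : Comp A.toGrQuiver C.toGrQuiver f.obj g.obj} (hx : x.HasDeg (-3)) :
      (y + B₂oe C.bc f.lm r g.lm v g.lm - B₁o A.bc C.bc f.lm x g.lm).HasDeg (-2) :=
    (hy.add (B₂oe_hasDeg hr hv (by norm_num))).sub (B₁o_hasDeg hx (by norm_num))
  obtain ⟨hv, hx, h₁, h₂⟩ := hvx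
  set t' := t - B₁e A.bc C.bc g.lm v g.lm with ht'_def
  set y' := y + B₂oe C.bc f.lm r g.lm v g.lm - B₁o A.bc C.bc f.lm x g.lm with hy'_def
  obtain ⟨w, hw, hwn, hwt⟩ := HomDeg.exists_comp (A := A) (C := C) (f := g.obj) (g := g.obj) n (-2)
    (fun X Y p φ => homD p C (g.obj X) (g.obj Y) (-2) φ = t'.fam p) fun X Y p hp => by
      refine (H.quasiIso X Y X Y p (-1)).1 (t'.fam p) ((degt hv).fam_mem p) ?_
        -- The leading term of (r ⊗ t')B₂ is minus the image of t', so it is -y' that exhibits this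
        -- image as a boundary.
        ⟨-y'.fam p, Submodule.neg_mem _ ((degy hv hx).fam_mem p), ?_⟩
      · refine ten_hom_ext p (fun q => homD q C (g.obj X) (g.obj Y) (-1) (t'.fam q)) (fun _ => 0)
          fun s hs => ?_
        subst hs
        rw [s.length_seq] at hp
        rw [← B₁o_lowest e1 s (hp ▸ h₁), hδ hv]
        rfl
      · rw [map_neg, neg_eq_iff_eq_neg]
        refine ten_hom_ext p (fun q => homD q C (f.obj X) (g.obj Y) (-1 - 1) (y'.fam q))
          (fun q => -LinearMap.llcomp k (Ten q) (C.hom (g.obj X) (g.obj Y)) (C.hom (f.obj X) (g.obj Y))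
            (C.leftMul (r X X (Str.nil X).cl) (g.obj Y)) (t'.fam q)) fun s hs => ?_
        subst hs
        rw [s.length_seq] at hp
        rw [← B₁e_lowest (by decide) s (hp ▸ h₂), ← hB hv hx,
          B₂oo_lowest ((degt hv).isOdd e1) s (hp ▸ h₁)]
        rfl
  have hvw : (v + w).HasDeg (-2) := hv.add hw
  set t₁ := t - B₁e A.bc C.bc g.lm (v + w) g.lm with ht₁_def
  set y₁ := y + B₂oe C.bc f.lm r g.lm (v + w) g.lm - B₁o A.bc C.bc f.lm x g.lm with hy₁_def
  have ht₁ : t₁.VanishBelow (n + 1) := by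
    have : t₁ = t' - B₁e A.bc C.bc g.lm w g.lm := by
      rw [ht₁_def, ht'_def, B₁e_add]; abel
    rw [this]
    refine (h₁.sub (B₁e_vanishBelow hwn)).succ fun X Y s hs => ?_
    rw [Pi.sub_apply, Pi.sub_apply, LinearMap.sub_apply, B₁e_lowest e2 s (hs ▸ hwn),
      hwt s.seq (s.length_seq.trans hs), Comp.fam_ten, sub_self]
  -- Adding w may spoil the y-error in length n, but in no smaller length.
  have hy₁ : y₁.VanishBelow n := by
    have : y₁ = y' + B₂oe C.bc f.lm r g.lm w g.lm := by
      rw [hy₁_def, hy'_def, B₂oe_add]; abel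
    rw [this]
    exact h₂.add (B₂oe_vanishBelow (hw.isEven e2) hwn)
  -- The t-error now vanishes in length n, so the length n component of y₁ is a cycle. Surjectivity
  -- writes it as the image of a cycle w₂ plus a boundary; w₂ being a cycle, subtracting it does not
  -- disturb the t-error in length n.
  obtain ⟨w₂, hw₂, hw₂n, hw₂y⟩ := HomDeg.exists_comp (A := A) (C := C) (f := g.obj) (g := g.obj) n (-2)
    (fun X Y p φ => homD p C (g.obj X) (g.obj Y) (-2) φ = 0 ∧
      ∃ χ ∈ HomDeg p C (f.obj X) (g.obj Y) (-3), homD p C (f.obj X) (g.obj Y) (-3) χ =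
        y₁.fam p - LinearMap.llcomp k (Ten p) (C.hom (g.obj X) (g.obj Y)) (C.hom (f.obj X) (g.obj Y))
            (C.leftMul (r X X (Str.nil X).cl) (g.obj Y)) φ) fun X Y p hp => by
      refine (H.quasiIso X Y X Y p (-2)).2 (y₁.fam p) ((degy hvw hx).fam_mem p) ?_
      refine ten_hom_ext p (fun q => homD q C (f.obj X) (g.obj Y) (-2) (y₁.fam q)) (fun _ => 0)
          fun s hs => ?_
      subst hs
      rw [s.length_seq] at hp
      rw [← B₁e_lowest (by decide) s (hp ▸ hy₁), ← hB hvw hx,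
        B₂oo_lowest ((degt hvw).isOdd e1) s (ht₁.mono (by omega)), Comp.fam_ten, ht₁ s (by omega),
        map_zero, neg_zero]
      rfl
  obtain ⟨z, hz, hzn, hzy⟩ := HomDeg.exists_comp (A := A) (C := C) (f := f.obj) (g := g.obj) n (-3)
    (fun X Y p χ => homD p C (f.obj X) (g.obj Y) (-3) χ =
        y₁.fam p - LinearMap.llcomp k (Ten p) (C.hom (g.obj X) (g.obj Y)) (C.hom (f.obj X) (g.obj Y))
            (C.leftMul (r X X (Str.nil X).cl) (g.obj Y)) (w₂.fam p)) fun X Y p hp => (hw₂y p hp).2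
  refine ⟨v + w - w₂, x + z, ⟨hvw.sub hw₂, hx.add hz, ?_, ?_⟩, ?_⟩
  · have : t - B₁e A.bc C.bc g.lm (v + w - w₂) g.lm = t₁ + B₁e A.bc C.bc g.lm w₂ g.lm := by
      rw [ht₁_def, B₁e_sub]; abel
    rw [this]
    refine ((ht₁.mono (Nat.le_succ n)).add (B₁e_vanishBelow hw₂n)).succ fun X Y s hs => ?_
    rw [Pi.add_apply, Pi.add_apply, LinearMap.add_apply, ht₁ s (by omega),
      B₁e_lowest e2 s (hs ▸ hw₂n), (hw₂y s.seq (s.length_seq.trans hs)).1, LinearMap.zero_apply,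
      add_zero]
  · have : y + B₂oe C.bc f.lm r g.lm (v + w - w₂) g.lm - B₁o A.bc C.bc f.lm (x + z) g.lm =
        y₁ - B₂oe C.bc f.lm r g.lm w₂ g.lm - B₁o A.bc C.bc f.lm z g.lm := by
      rw [hy₁_def, B₂oe_sub, B₁o_add]; abel
    rw [this]
    refine ((hy₁.sub (B₂oe_vanishBelow (hw₂.isEven e2) hw₂n)).sub (B₁o_vanishBelow hzn)).succ
      fun X Y s hs => ?_
    rw [Pi.sub_apply, Pi.sub_apply, LinearMap.sub_apply, Pi.sub_apply, Pi.sub_apply,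
      LinearMap.sub_apply, B₂oe_lowest (hw₂.isEven e2) s (hs ▸ hw₂n), B₁o_lowest e3 s (hs ▸ hzn),
      hzy s.seq (s.length_seq.trans hs), LinearMap.sub_apply, ← Comp.fam_ten y₁]
    exact sub_eq_zero.2 rfl
  · have : v + w - w₂ - v = w - w₂ := by abel
    rw [this]
    exact hwn.sub hw₂n

/-- Left cancellation of r up to homotopy. The approximate solutions stabilise in each length, so v
is assembled componentwise from them; the x-parts serve only to keep the induction going. -/
theorem exists_eq_B₁e {r : Comp A.toGrQuiver C.toGrQuiver f.obj g.obj} (hr : r.HasDeg (-1))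
    (hr' : B₁o A.bc C.bc f.lm r g.lm = 0)
    (H : ResolutionAssumptions f g.obj fun X => r X X (Str.nil X).cl)
    {t : Comp A.toGrQuiver C.toGrQuiver g.obj g.obj} (ht : t.HasDeg (-1))
    (ht' : B₁o A.bc C.bc g.lm t g.lm = 0)
    {y : Comp A.toGrQuiver C.toGrQuiver f.obj g.obj} (hy : y.HasDeg (-2))
    (hty : B₂oo C.bc f.lm r g.lm t g.lm = B₁e A.bc C.bc f.lm y g.lm) :
    ∃ v : Comp A.toGrQuiver C.toGrQuiver g.obj g.obj, v.HasDeg (-2) ∧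
      t = B₁e A.bc C.bc g.lm v g.lm := by
  let S (n : ℕ) := {vx : Comp A.toGrQuiver C.toGrQuiver g.obj g.obj ×
    Comp A.toGrQuiver C.toGrQuiver f.obj g.obj // IsApprox f g r t y n vx.1 vx.2}
  have hstep (n : ℕ) (s : S n) : ∃ s' : S (n + 1), (s'.1.1 - s.1.1).VanishBelow n := by
    obtain ⟨v', x', h, h'⟩ := s.2.step hr hr' H ht ht' hy hty
    exact ⟨⟨(v', x'), h⟩, h'⟩
  choose next hnext using hstep
  -- With n = 0 nothing is required below length n, so the zero pair is an admissible start.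
  let s₀ : S 0 := ⟨(0, 0), fun _ _ _ _ _ => Submodule.zero_mem _, fun _ _ _ _ _ => Submodule.zero_mem _,
    fun _ _ _ h => absurd h (Nat.not_lt_zero _), fun _ _ _ h => absurd h (Nat.not_lt_zero _)⟩
  let seq : ∀ n, S n := fun n => Nat.rec s₀ next n
  have hseq (m n : ℕ) : ((seq (m + n)).1.1 - (seq m).1.1).VanishBelow m := by
    induction n with
    | zero => intro X Y s _; simp
    | succ n ih =>
      have h : (seq (m + (n + 1))).1.1 - (seq m).1.1 =
          ((seq (m + n + 1)).1.1 - (seq (m + n)).1.1) + ((seq (m + n)).1.1 - (seq m).1.1) := by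
        rw [sub_add_sub_cancel]; rfl
      rw [h]
      exact ((hnext (m + n) (seq (m + n))).mono (Nat.le_add_right m n)).add ih
  -- Stage n is correct in lengths less than n, so length m is read off from stage m + 1.
  let V : Family A.toGrQuiver C.toGrQuiver g.obj g.obj := fun X Y p =>
    (seq (p.length + 1)).1.1.fam p
  have hV {X Y : A.Ob} (s : A.Str X Y) : V.lin X Y s.cl = (seq (s.length + 1)).1.1 X Y s.cl := by
    rw [Family.lin_cl, Family.val]
    change (seq (s.seq.length + 1)).1.1.fam s.seq s.ten = _
    rw [Comp.fam_ten, s.length_seq]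
  have hVn (n : ℕ) : ((seq n).1.1 - V.lin).VanishBelow n := by
    intro X Y s hs
    obtain ⟨j, rfl⟩ := Nat.exists_eq_add_of_le hs
    have := hseq (s.length + 1) j s (Nat.lt_succ_self _)
    rw [Pi.sub_apply, Pi.sub_apply, LinearMap.sub_apply] at this ⊢
    rw [hV]
    exact this
  refine ⟨V.lin, ?_, Comp.ext_cl fun X Y s => ?_⟩
  · refine Family.HasDegree.lin fun X Y p d z hz => ?_
    exact (seq (p.length + 1)).2.hasDeg_v.fam p d z hz
  · have h₁ := (seq (s.length + 1)).2.left s (Nat.lt_succ_self _)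
    have h₂ := B₁e_vanishBelow (hVn (s.length + 1)) s (Nat.lt_succ_self _)
    rw [B₁e_sub] at h₂
    rw [Pi.sub_apply, Pi.sub_apply, LinearMap.sub_apply, sub_eq_zero] at h₁ h₂
    exact h₁.trans h₂

end Step

end AInf

/-! ### Unitality of g -/

open AInf GrQuiver in
/-- The homotopy between `g i^C` and `i^B g`. -/
theorem AInf.exists_unital_homotopy {k : Type u} [CommRing k] (B C : AInfCat.{u} k)
    (iB : Coder B B (fun X => X) (fun X => X) (-1)) (hiB : IsUnitTransformation B iB)
    (iC : Coder C C (fun X => X) (fun X => X) (-1)) (hiC : IsUnitTransformation C iC)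
    (f g : AInfFunctor B C) (hf : f.IsUnital iB iC)
    (r : Coder B C f.obj g.obj (-1)) (hr : IsNatural f.str r g.str)
    (hr₀ : ResolutionAssumptions f g.obj fun X => r.zeroth X) :
    ∃ v : Comp B.toGrQuiver C.toGrQuiver g.obj g.obj, v.HasDeg (-2) ∧
      g.lm.toComp iC.comp.lin - g.cp.pre (hat iB.comp.lin) = B₁e B.bc C.bc g.lm v g.lm := by
  have hF := f.isHom
  have hG := g.isHom
  have hA := B.isDiff_bc
  have hC := C.isDiff_bc
  have e1 : Odd (-1 : ℤ) := by decide
  have e2 : Even (-2 : ℤ) := by decide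
  have hrd : r.comp.lin.HasDeg (-1) := r.degree.lin
  have hrodd := hrd.isOdd e1
  have hiBd : iB.comp.lin.HasDeg (-1) := iB.degree.lin
  have hiCd : iC.comp.lin.HasDeg (-1) := iC.degree.lin
  have hr' : B₁o B.bc C.bc f.lm r.comp.lin g.lm = 0 := Comp.ext_cl fun X Y s => by
    rw [← B₁_odd f g e1 r s, hr s]; rfl
  have hnB := hiB.natural.hat_toComp
  have hnC := hiC.natural.hat_toComp
  have hφ := f.isGeom.pre_hat f.cp_nil iB.comp.lin
  have hγ := g.isGeom.pre_hat g.cp_nil iB.comp.lin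
  obtain ⟨v₀, hv₀⟩ := hf
  have hv₀' : f.lm.toComp iC.comp.lin - f.cp.pre (hat iB.comp.lin) =
      B₁e B.bc C.bc f.lm v₀.comp.lin f.lm := Comp.ext_cl fun X Y s => by
    have := hv₀ s
    rw [B₁_even f f e2, functorThenUnit_eq, unitThenFunctor_eq] at this
    exact this
  have hv₀d : v₀.comp.lin.HasDeg (-2) := v₀.degree.lin
  have hr₀' : ResolutionAssumptions f g.obj fun X => r.comp.lin X X (Str.nil X).cl := by
    simpa only [Family.lin_cl, Coder.zeroth] using hr₀
  have hR : (f.lm ⋆ r.comp.lin.up ⋆ g.lm.pre (K B.toGrQuiver)).HasDeg (-1) :=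
    f.hasDeg.conv (hrd.up.conv g.hasDeg.pre_K (add_zero _)) (zero_add _)
  have hI := B₁e_toComp hF hG hrodd hr' hA hnC
  have hJ := B₁e_pre hr' hA (hiBd.isOdd e1) hnB hφ hγ
  have hv := B₁e_B₂eo hF hF hG hA hC (hv₀d.isEven e2) hrodd hr'
  -- The witness y combines three homotopies: v₀ ⊗ r replaces f i^C by i^B f to the left of r, and
  -- the two subtracted terms are the naturality homotopies for i^B and i^C. The products with r on
  -- the right cancel in the sum.
  refine exists_eq_B₁e hrd hr' hr₀'
    (y := B₂eo C.bc f.lm v₀.comp.lin f.lm r.comp.lin g.lm - r.comp.lin.pre (hat iB.comp.lin) -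
      (f.lm ⋆ r.comp.lin.up ⋆ g.lm.pre (K B.toGrQuiver)).toComp iC.comp.lin) ?_ ?_ ?_ ?_
  · exact (g.hasDeg.toComp hiCd (by norm_num)).sub
      (Comp.HasDeg.comp (e := 0) g.comp_degree.lin hiBd.hat (by norm_num))
  · rw [B₁o_sub, B₁o_toComp hG hnC, B₁o_pre hA (hiBd.isOdd e1) hnB hγ g.cp_pre_hat, sub_zero]
  · exact ((B₂eo_hasDeg hv₀d hrd (by norm_num)).sub (hrd.comp hiBd.hat (by norm_num))).sub
      (hR.toComp hiCd (by norm_num))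
  · rw [B₁e_sub, B₁e_sub, hI, hJ, hv, ← hv₀', B₂oo_sub, B₂oo_sub_left]
    abel

open AInf in
theorem mainTheorem11 {k : Type u} [CommRing k] (B C : AInfCat.{u} k)
    (iB : Coder B B (fun X => X) (fun X => X) (-1)) (hiB : IsUnitTransformation B iB)
    (iC : Coder C C (fun X => X) (fun X => X) (-1)) (hiC : IsUnitTransformation C iC)
    (f g : AInfFunctor B C) (hf : f.IsUnital iB iC)
    (r₀ : ∀ X : B.Ob, C.hom (f.obj X) (g.obj X))
    (hr₀ : ResolutionAssumptions f g.obj r₀)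
    (r : Coder B C f.obj g.obj (-1)) (hr : IsNatural f.str r g.str)
    (hrr₀ : ∀ X : B.Ob, r.zeroth X = r₀ X) :
    g.IsUnital iB iC := by
  obtain rfl : (fun X => r.zeroth X) = r₀ := funext hrr₀
  obtain ⟨v, hv, h⟩ := AInf.exists_unital_homotopy B C iB hiB iC hiC f g hf r hr hr₀
  refine ⟨⟨v.fam, hv.fam⟩, fun X Y s => ?_⟩
  rw [B₁_even g g (by decide), functorThenUnit_eq, unitThenFunctor_eq, GrQuiver.Comp.lin_fam, ← h]
  rfl
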